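/- Let $H$ be a complex Hilbert space (not necessarily separable, possibly infinite-dimensional), let $k$ be an integer with $0<k<\dim H$, and if $\dim H=2k$ assume also that $k\ge 4$. Let $\mathcal P_k(H)$ be the set of all rank-$k$ projections on $H$, i.e. self-adjoint idempotent bounded operators whose range has dimension $k$. Let $f:\mathcal P_k(H)\to\mathcal P_k(H)$ be a bijection preserving commutativity in both directions, i.e. for all $P,Q\in\mathcal P_k(H)$ $$PQ=QP\iff f(P)f(Q)=f(Q)f(P).$$ Then one of the following holds: (1) there is a unitary or anti-unitary operator $U$ on $H$ such that $f(P)=UPU^*$ for every $P\in\mathcal P_k(H)$; (2) $\dim H=2k$ and there is a unitary or anti-unitary operator $U$ on $H$ such that for every $P\in\mathcal P_k(H)$ either $f(P)=UPU^*$ or $f(P)=\mathrm{Id}-UPU^*$. -/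

import Mathlib

/-- The set `P_k(H)` of all rank-`k` projections (self-adjoint idempotent bounded operators whose
range has dimension `k`) on the complex Hilbert space `H`. -/
def rankProjections (H : Type*) [NormedAddCommGroup H] [InnerProductSpace ℂ H] [CompleteSpace H]
    (k : ℕ) : Set (H →L[ℂ] H) :=
  {P | IsStarProjection P ∧ Module.rank ℂ (LinearMap.range (P : H →ₗ[ℂ] H)) = (k : Cardinal)}

/-- The operator `U A U*`, for `U` unitary (`H ≃ₗᵢ[ℂ] H`) or anti-unitary (`H ≃ₗᵢ⋆[ℂ] H`).
In both cases `U* = U⁻¹`. -/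
def conjOperator {H : Type*} [NormedAddCommGroup H] [InnerProductSpace ℂ H]
    {σ τ : ℂ →+* ℂ} [RingHomInvPair σ τ] [RingHomInvPair τ σ]
    (U : H ≃ₛₗᵢ[σ] H) (A : H →L[ℂ] H) : H →L[ℂ] H :=
  (U.toContinuousLinearEquiv : H →SL[σ] H).comp
    (A.comp (U.symm.toContinuousLinearEquiv : H →SL[τ] H))

/-!
A projection of rank `k` is identified with its range, a point of the Grassmannian `Gr H k`. Two
projections commute if and only if the orthogonal projection onto one range maps the other range
into itself (`Compatible`, `Gr.Comm`). Replacing projections by their complements when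
`dim H < 2 * k`, one may assume `2 * k ≤ dim H`; for `k = 1`, commutativity is orthogonality of
distinct lines, and Uhlhorn's theorem below applies at once. So let `2 ≤ k`.

**Commutativity determines adjacency.** Neighbours in the Grassmann graph (`dim (P ⊓ Q) = k - 1`)
are characterized, up to replacing `Q` by `Qᗮ` when `dim H = 2 * k`, by the commutativity relation
alone (`near_iff`). For noncommuting `P` and `Q` the characterization has two halves. The first,
`MinimallyNoncommuting`, provides a commuting set `S` commuting with `P` and `Q` whose commutant is
barely noncommutative. Diagonalizing `S` in a Hilbert basis, one finds that `S` consists of the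
coordinate subspaces that do not separate two basis vectors, so that `P` and `Q` are diagonal
outside the plane `E` of these two vectors (`MinimallyNoncommuting.exists_reducingPlane`). The
second, `UniquePartner`, then forces `P` and `Q`, or `P` and `Qᗮ`, to agree outside `E`
(`ReducingPlane.near`). Conversely `IsFrame.sameCommutant_partner` shows that neighbours have a
unique partner. Commuting neighbours are recognized as the partners for noncommuting ones.

**From adjacency to lines.** Cliques of the Grassmann graph lie in stars (all `P` above a given `X`
of dimension `k - 1`) or in tops (all `P` below a given subspace of dimension `k + 1`)
(`star_or_top`). A star is not mapped to a top: if `2 * k < dim H`, some `R` commutes with a whole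
top but none commutes with a whole star, and if `dim H = 2 * k`, complements turn tops into stars.
Hence the given bijection induces one of `Gr H (k - 1)` (`exists_equiv_inc`), and descending further
one reaches a bijection of the lines of `H` (`exists_line_equiv`). It preserves orthogonality, and
`P` is mapped to the span of the images of its lines or to the complement of that span
(`exists_line_equiv_of_comm`).

**Uhlhorn's theorem.** In dimension at least three a bijection of the lines preserving orthogonality
is induced by a unitary or anti-unitary operator
(`IsOrthoMap.exists_unitary_or_antiunitary`). Such a bijection preserves coplanarity, so
representatives `F x` of the images of the lines can be chosen with `F x - F y` on the image of the
line of `x - y`; then `F` is additive, hence semilinear for some endomorphism `σ` of `ℂ`.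
Orthogonality makes `σ` commute with conjugation, so that `σ` is the identity or the conjugation,
and makes `F` a multiple of an isometry.
-/

section

open Module Submodule

/-! ### Submodules invariant under a projection -/

section Compatible

variable {H : Type*} [NormedAddCommGroup H] [InnerProductSpace ℂ H]

/-- The orthogonal projection onto `V` maps `W` into itself. -/
def Compatible (V W : Submodule ℂ H) [V.HasOrthogonalProjection] : Prop :=
  ∀ x ∈ W, V.starProjection x ∈ W

variable {V W W' : Submodule ℂ H} [V.HasOrthogonalProjection]

lemma Compatible.inf (h : Compatible V W) (h' : Compatible V W') : Compatible V (W ⊓ W') :=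
  fun x hx => ⟨h x hx.1, h' x hx.2⟩

lemma Compatible.sup (h : Compatible V W) (h' : Compatible V W') : Compatible V (W ⊔ W') := by
  intro x hx
  obtain ⟨y, hy, z, hz, rfl⟩ := mem_sup.1 hx
  rw [map_add]
  exact add_mem (mem_sup_left (h y hy)) (mem_sup_right (h' z hz))

lemma Compatible.orthogonal (h : Compatible V W) : Compatible V Wᗮ := by
  intro x hx
  rw [mem_orthogonal]
  intro y hy
  rw [← inner_starProjection_left_eq_right]
  exact (mem_orthogonal _ _).1 hx _ (h y hy)

lemma compatible_bot : Compatible V ⊥ := by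
  intro x hx
  rw [mem_bot] at hx
  simp [hx]

lemma Compatible.finset_inf {ι : Type*} {s : Finset ι} {f : ι → Submodule ℂ H}
    (h : ∀ i ∈ s, Compatible V (f i)) : Compatible V (s.inf f) := by
  intro x hx
  rw [Submodule.mem_finsetInf] at hx ⊢
  exact fun i hi => h i hi x (hx i hi)

lemma compatible_of_le (h : V ≤ W) : Compatible V W :=
  fun x _ => h (starProjection_apply_mem V x)

lemma compatible_of_ge (h : W ≤ V) : Compatible V W := by
  intro x hx
  rwa [starProjection_eq_self_iff.2 (h hx)]

lemma compatible_of_le_orthogonal (h : W ≤ Vᗮ) : Compatible V W := by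
  intro x hx
  rw [(starProjection_apply_eq_zero_iff V).2 (h hx)]
  exact zero_mem _

lemma compatible_orthogonal_left : Compatible Vᗮ W ↔ Compatible V W := by
  unfold Compatible
  refine forall₂_congr fun x hx => ?_
  rw [starProjection_orthogonal_val]
  exact sub_mem_iff_right _ hx

lemma compatible_iff_commute [W.HasOrthogonalProjection] :
    Compatible V W ↔ Commute V.starProjection W.starProjection := by
  constructor
  · intro h
    refine ContinuousLinearMap.ext fun x => ?_
    change V.starProjection (W.starProjection x) = W.starProjection (V.starProjection x)
    refine (eq_starProjection_of_mem_orthogonal (h _ (starProjection_apply_mem W x)) ?_).symm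
    rw [← map_sub]
    exact h.orthogonal _ (sub_starProjection_mem_orthogonal x)
  · intro h x hx
    have := DFunLike.congr_fun h x
    change V.starProjection (W.starProjection x) = W.starProjection (V.starProjection x) at this
    rw [starProjection_eq_self_iff.2 hx] at this
    rw [this]
    exact starProjection_apply_mem _ _

lemma Compatible.symm [W.HasOrthogonalProjection] (h : Compatible V W) : Compatible W V :=
  compatible_iff_commute.2 (compatible_iff_commute.1 h).symm

lemma compatible_span_singleton {x : H} :
    Compatible V (ℂ ∙ x) ↔ x ∈ V ∨ x ∈ Vᗮ := by
  constructor
  · intro h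
    obtain ⟨c, hc⟩ := mem_span_singleton.1 (h x (mem_span_singleton_self x))
    by_cases hc0 : c = 0
    · right
      rw [hc0, zero_smul] at hc
      exact (starProjection_apply_eq_zero_iff V).1 hc.symm
    · left
      have : c • x ∈ V := hc ▸ starProjection_apply_mem V x
      exact (smul_mem_iff _ hc0).1 this
  · rintro (h | h)
    · exact compatible_of_ge ((span_singleton_le_iff_mem _ _).2 h)
    · exact compatible_of_le_orthogonal ((span_singleton_le_iff_mem _ _).2 h)

/-- A vector space is not the union of two proper subspaces. -/
lemma le_or_le_of_forall_mem_or {V₁ V₂ W : Submodule ℂ H} (h : ∀ x ∈ W, x ∈ V₁ ∨ x ∈ V₂) :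
    W ≤ V₁ ∨ W ≤ V₂ := by
  by_contra hcon
  rw [not_or, SetLike.not_le_iff_exists, SetLike.not_le_iff_exists] at hcon
  obtain ⟨⟨x, hx, hx1⟩, ⟨y, hy, hy2⟩⟩ := hcon
  have hx2 := (h x hx).resolve_left hx1
  have hy1 := (h y hy).resolve_right hy2
  rcases h _ (add_mem hx hy) with h1 | h2
  · exact hx1 ((add_mem_cancel_right hy1).1 h1)
  · exact hy2 ((add_mem_cancel_left hx2).1 h2)

lemma le_or_le_orthogonal_of_forall_line (h : ∀ x ∈ W, Compatible V (ℂ ∙ x)) :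
    W ≤ V ∨ W ≤ Vᗮ :=
  le_or_le_of_forall_mem_or fun x hx => compatible_span_singleton.1 (h x hx)

lemma Compatible.eq_sup (h : Compatible V W) : W = (W ⊓ V) ⊔ (W ⊓ Vᗮ) := by
  refine le_antisymm (fun x hx => ?_) (sup_le inf_le_left inf_le_left)
  have h1 := h x hx
  rw [← add_sub_cancel (V.starProjection x) x]
  exact add_mem_sup ⟨h1, starProjection_apply_mem _ _⟩
    ⟨sub_mem hx h1, sub_starProjection_mem_orthogonal x⟩

lemma exists_ne_zero_mem_orthogonal (V : Submodule ℂ H) [FiniteDimensional ℂ V]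
    (h : (finrank ℂ V : Cardinal) < Module.rank ℂ H) : ∃ u ∈ Vᗮ, u ≠ 0 := by
  by_contra hcon
  push Not at hcon
  have h1 : Vᗮ = ⊥ := (Submodule.eq_bot_iff _).2 hcon
  rw [orthogonal_eq_bot_iff] at h1
  rw [finrank_eq_rank, h1, rank_top] at h
  exact lt_irrefl _ h

end Compatible

/-! ### Commuting families of projections -/

section CoordSpan

open scoped InnerProductSpace

variable {H : Type*} [NormedAddCommGroup H] [InnerProductSpace ℂ H] {ι : Type*}

/-- The span of the members of a Hilbert basis with index in the finite set `F`. -/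
def coordSpan (b : HilbertBasis ι ℂ H) (F : Finset ι) : Submodule ℂ H :=
  span ℂ (b '' F)

variable (b : HilbertBasis ι ℂ H)

instance (F : Finset ι) : FiniteDimensional ℂ (coordSpan b F) :=
  FiniteDimensional.span_of_finite ℂ (F.finite_toSet.image b)

lemma HilbertBasis.eq_zero_of_forall_inner {x : H} (h : ∀ i, ⟪b i, x⟫_ℂ = 0) : x = 0 := by
  apply b.repr.injective
  ext i
  simp [HilbertBasis.repr_apply_apply, h i]

variable {b}

lemma mem_coordSpan {F : Finset ι} {x : H} :
    x ∈ coordSpan b F ↔ ∀ i ∉ F, ⟪b i, x⟫_ℂ = 0 := by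
  classical
  constructor
  · intro hx i hi
    have : coordSpan b F ≤ (ℂ ∙ b i)ᗮ := by
      refine span_le.2 ?_
      rintro _ ⟨j, hj, rfl⟩
      rw [SetLike.mem_coe, mem_orthogonal_singleton_iff_inner_right]
      exact b.orthonormal.2 (by rintro rfl; exact hi hj)
    exact (mem_orthogonal_singleton_iff_inner_right).1 (this hx)
  · intro h
    have hx : x = ∑ i ∈ F, ⟪b i, x⟫_ℂ • b i := by
      rw [← sub_eq_zero]
      refine b.eq_zero_of_forall_inner fun i => ?_
      rw [inner_sub_right, inner_sum]
      simp only [inner_smul_right, orthonormal_iff_ite.1 b.orthonormal]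
      by_cases hi : i ∈ F
      · simp [hi]
      · simp [hi, h i hi]
    rw [hx]
    exact sum_mem fun i hi => smul_mem _ _ (subset_span ⟨i, hi, rfl⟩)

lemma apply_mem_coordSpan {F : Finset ι} {i : ι} : b i ∈ coordSpan b F ↔ i ∈ F := by
  refine ⟨fun h => ?_, fun h => subset_span ⟨i, h, rfl⟩⟩
  by_contra hi
  have := mem_coordSpan.1 h i hi
  rw [inner_self_eq_zero] at this
  exact b.orthonormal.ne_zero i this

lemma apply_mem_coordSpan_orthogonal {F : Finset ι} {i : ι} :
    b i ∈ (coordSpan b F)ᗮ ↔ i ∉ F := by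
  refine ⟨fun h hi => ?_, fun h => ?_⟩
  · have := (mem_orthogonal _ _).1 h _ (apply_mem_coordSpan.2 hi)
    rw [inner_self_eq_zero] at this
    exact b.orthonormal.ne_zero i this
  · rw [mem_orthogonal']
    exact fun u hu => mem_coordSpan.1 hu i h

lemma finrank_coordSpan (F : Finset ι) : finrank ℂ (coordSpan b F) = F.card := by
  have h1 : LinearIndependent ℂ (fun i : F => b i) :=
    b.orthonormal.linearIndependent.comp _ Subtype.val_injective
  have h2 : coordSpan b F = span ℂ (Set.range fun i : F => b i) := by
    rw [coordSpan]; congr 1; ext; simp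
  rw [h2, finrank_span_eq_card h1, Fintype.card_coe]

lemma coordSpan_inf [DecidableEq ι] (F G : Finset ι) :
    coordSpan b F ⊓ coordSpan b G = coordSpan b (F ∩ G) := by
  ext x
  simp only [mem_inf, mem_coordSpan, Finset.mem_inter, not_and_or]
  exact ⟨fun h i hi => hi.elim (h.1 i) (h.2 i),
    fun h => ⟨fun i hi => h i (Or.inl hi), fun i hi => h i (Or.inr hi)⟩⟩

lemma coordSpan_singleton (i : ι) : coordSpan b {i} = ℂ ∙ b i := by
  simp [coordSpan]

lemma compatible_span {V : Submodule ℂ H} [V.HasOrthogonalProjection] {s : Set H}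
    (h : ∀ x ∈ s, Compatible V (ℂ ∙ x)) : Compatible V (span ℂ s) := by
  intro x hx
  induction hx using span_induction with
  | mem x hx => exact span_mono (Set.singleton_subset_iff.2 hx) (h x hx x (mem_span_singleton_self x))
  | zero => simp
  | add x y _ _ hx hy => rw [map_add]; exact add_mem hx hy
  | smul c x _ hx => rw [map_smul]; exact smul_mem _ _ hx

lemma compatible_coordSpan {V : Submodule ℂ H} [V.HasOrthogonalProjection] {F : Finset ι}
    (h : ∀ i ∈ F, Compatible V (ℂ ∙ b i)) : Compatible V (coordSpan b F) := by
  refine compatible_span ?_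
  rintro _ ⟨i, hi, rfl⟩
  exact h i hi

/-- The finitely many coordinates in `F` need not be preserved one by one: `coordSpan b F` is the
common orthogonal complement of the other members of the basis. -/
lemma compatible_coordSpan_of_compl {V : Submodule ℂ H} [V.HasOrthogonalProjection]
    {F : Finset ι} (h : ∀ i ∉ F, Compatible V (ℂ ∙ b i)) : Compatible V (coordSpan b F) := by
  intro x hx
  rw [mem_coordSpan] at hx ⊢
  intro i hi
  rw [← inner_starProjection_left_eq_right]
  obtain ⟨c, hc⟩ := mem_span_singleton.1 (h i hi _ (mem_span_singleton_self _))
  rw [← hc, inner_smul_left, hx i hi, mul_zero]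

lemma compatible_coordSpan_coordSpan (F G : Finset ι) :
    Compatible (coordSpan b F) (coordSpan b G) :=
  compatible_coordSpan fun i _ => compatible_span_singleton.2 (by
    rw [apply_mem_coordSpan, apply_mem_coordSpan_orthogonal]; exact em _)

lemma compatible_coordSpan_line (F : Finset ι) (i : ι) :
    Compatible (coordSpan b F) (ℂ ∙ b i) := by
  rw [← coordSpan_singleton]
  exact compatible_coordSpan_coordSpan _ _

lemma exists_eq_coordSpan {V : Submodule ℂ H} [FiniteDimensional ℂ V]
    (h : ∀ i, Compatible V (ℂ ∙ b i)) : ∃ F, V = coordSpan b F := by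
  have hfin : {i | b i ∈ V}.Finite := by
    have h1 : LinearIndependent ℂ (fun i : {i | b i ∈ V} => (⟨b i, i.2⟩ : V)) :=
      LinearIndependent.of_comp V.subtype
        (b.orthonormal.linearIndependent.comp _ Subtype.val_injective)
    exact Set.finite_coe_iff.1 (h1.finite)
  refine ⟨hfin.toFinset, le_antisymm (fun x hx => mem_coordSpan.2 fun i hi => ?_) ?_⟩
  · rw [Set.Finite.mem_toFinset] at hi
    exact (mem_orthogonal' _ _).1 ((compatible_span_singleton.1 (h i)).resolve_left hi) x hx
  · refine span_le.2 ?_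
    rintro _ ⟨i, hi, rfl⟩
    simpa using hi

lemma compatible_of_forall_line {V W : Submodule ℂ H} [V.HasOrthogonalProjection]
    [FiniteDimensional ℂ W] (hV : ∀ i, Compatible V (ℂ ∙ b i))
    (hW : ∀ i, Compatible W (ℂ ∙ b i)) : Compatible V W := by
  obtain ⟨F, rfl⟩ := exists_eq_coordSpan hW
  exact compatible_coordSpan fun i _ => hV i

lemma Compatible.line_of_inter [DecidableEq ι] {V : Submodule ℂ H} [V.HasOrthogonalProjection]
    {F G : Finset ι} {i : ι} (hF : Compatible V (coordSpan b F))
    (hG : Compatible V (coordSpan b G)) (h : F ∩ G = {i}) : Compatible V (ℂ ∙ b i) := by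
  have := hF.inf hG
  rwa [coordSpan_inf, h, coordSpan_singleton] at this

/-- The index set of a Hilbert basis is as large as the algebraic dimension, as far as finite
cardinalities are concerned. -/
lemma exists_disjoint_finset_card [DecidableEq ι] (b : HilbertBasis ι ℂ H) (A : Finset ι) (m : ℕ)
    (h : ((A.card + m : ℕ) : Cardinal) ≤ Module.rank ℂ H) :
    ∃ F : Finset ι, F.card = m ∧ Disjoint A F := by
  induction m with
  | zero => exact ⟨∅, rfl, by simp⟩
  | succ m ih =>
    obtain ⟨F, hF, hd⟩ := ih (le_trans (by exact_mod_cast Nat.le_succ _) h)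
    obtain ⟨u, hu, hu0⟩ := exists_ne_zero_mem_orthogonal (coordSpan b (A ∪ F)) (by
      refine lt_of_lt_of_le ?_ h
      rw [finrank_coordSpan, Finset.card_union_of_disjoint hd, hF]
      exact_mod_cast Nat.lt_succ_self _)
    obtain ⟨i, hi⟩ : ∃ i, i ∉ A ∪ F := by
      by_contra! hall
      exact hu0 (b.eq_zero_of_forall_inner fun i =>
        (mem_orthogonal _ _).1 hu _ (apply_mem_coordSpan.2 (hall i)))
    rw [Finset.mem_union, not_or] at hi
    refine ⟨insert i F, by rw [Finset.card_insert_of_notMem hi.2, hF], ?_⟩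
    rw [Finset.disjoint_insert_right]
    exact ⟨hi.1, hd⟩

end CoordSpan

section Diagonalization

variable {H : Type*} [NormedAddCommGroup H] [InnerProductSpace ℂ H] {α : Type*}

/-- A nonzero subspace invariant under commuting finite-rank projections contains a common invariant
line, even if the projections are infinitely many. -/
lemma exists_common_line (V : α → Submodule ℂ H) [∀ a, FiniteDimensional ℂ (V a)]
    (hV : ∀ a a', Compatible (V a) (V a')) (K : Submodule ℂ H) (hK : ∀ a, Compatible (V a) K)
    (hK0 : K ≠ ⊥) : ∃ x ∈ K, x ≠ 0 ∧ ∀ a, Compatible (V a) (ℂ ∙ x) := by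
  by_cases hall : ∀ a, K ≤ (V a)ᗮ
  · obtain ⟨x, hx, hx0⟩ := exists_mem_ne_zero_of_ne_bot hK0
    exact ⟨x, hx, hx0, fun a => compatible_span_singleton.2 (Or.inr (hall a hx))⟩
  push Not at hall
  obtain ⟨a₀, ha₀⟩ := hall
  -- a nonzero common invariant subspace of least dimension
  let p : ℕ → Prop := fun d => ∃ M : Submodule ℂ H, FiniteDimensional ℂ M ∧ M ≠ ⊥ ∧ M ≤ K ∧
    (∀ a, Compatible (V a) M) ∧ finrank ℂ M = d
  have hp : ∃ d, p d := by
    refine ⟨_, K ⊓ V a₀, inferInstance, ?_, inf_le_left, fun a => (hK a).inf (hV a a₀), rfl⟩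
    intro hbot
    have := (hK a₀).eq_sup
    rw [hbot, bot_sup_eq] at this
    exact ha₀ (this ▸ inf_le_right)
  classical
  obtain ⟨M, hMfin, hM0, hMK, hMV, hMd⟩ := Nat.find_spec hp
  obtain ⟨x, hx, hx0⟩ := exists_mem_ne_zero_of_ne_bot hM0
  refine ⟨x, hMK hx, hx0, fun a => compatible_span_singleton.2 ?_⟩
  by_cases hbot : M ⊓ V a = ⊥
  · right
    have := (hMV a).eq_sup
    rw [hbot, bot_sup_eq] at this
    rw [this] at hx
    exact hx.2
  · left
    have h1 : Nat.find hp ≤ finrank ℂ (M ⊓ V a : Submodule ℂ H) :=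
      Nat.find_min' hp ⟨M ⊓ V a, inferInstance, hbot, inf_le_left.trans hMK,
        fun a' => (hMV a').inf (hV a' a), rfl⟩
    have h2 : M ⊓ V a = M := eq_of_le_of_finrank_le inf_le_left (hMd.trans_le h1)
    rw [← h2] at hx
    exact hx.2

/-- Pairwise commuting finite-rank projections are simultaneously diagonal in some Hilbert basis.
-/
theorem exists_diagonal_hilbertBasis [CompleteSpace H] (V : α → Submodule ℂ H)
    [∀ a, FiniteDimensional ℂ (V a)] (hV : ∀ a a', Compatible (V a) (V a')) :
    ∃ (w : Set H) (b : HilbertBasis w ℂ H), ∀ a i, Compatible (V a) (ℂ ∙ b i) := by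
  let 𝓢 : Set (Set H) := {s | Orthonormal ℂ ((↑) : s → H) ∧ ∀ x ∈ s, ∀ a, Compatible (V a) (ℂ ∙ x)}
  obtain ⟨s, hs⟩ : ∃ s, Maximal (· ∈ 𝓢) s := by
    refine zorn_subset 𝓢 fun c hc hchain => ⟨⋃₀ c, ⟨?_, ?_⟩, fun t ht => Set.subset_sUnion_of_mem ht⟩
    · exact orthonormal_sUnion_of_directed hchain.directedOn fun t ht => (hc ht).1
    · rintro x ⟨t, ht, hx⟩
      exact (hc ht).2 x hx
  have hbot : (span ℂ (Set.range ((↑) : s → H)))ᗮ = ⊥ := by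
    classical
    by_contra hne
    rw [Subtype.range_coe] at hne
    obtain ⟨x, hx, hx0, hxV⟩ := exists_common_line V hV (span ℂ s)ᗮ
      (fun a => (compatible_span fun y hy => hs.prop.2 y hy a).orthogonal) hne
    have hx0' : ((‖x‖⁻¹ : ℝ) : ℂ) ≠ 0 := by simpa using hx0
    set y : H := ((‖x‖⁻¹ : ℝ) : ℂ) • x with hy
    have hy1 : ‖y‖ = 1 := by
      rw [hy, norm_smul]; simp [hx0]
    have hyo : y ∈ (span ℂ s)ᗮ := smul_mem _ _ hx
    have hys : y ∉ s := fun h => by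
      have := (mem_orthogonal _ _).1 hyo y (subset_span h)
      rw [inner_self_eq_zero] at this
      rw [this] at hy1
      simp at hy1
    refine hys (hs.le_of_ge (y := insert y s) ⟨?_, ?_⟩ (Set.subset_insert _ _)
      (Set.mem_insert _ _))
    · rw [orthonormal_subtype_iff_ite]
      have h0 := orthonormal_subtype_iff_ite.1 hs.prop.1
      have hyo' := (mem_orthogonal _ _).1 hyo
      rintro u (rfl | hu) v (rfl | hv)
      · simp [hy1]
      · rw [if_neg (by rintro rfl; exact hys hv)]
        exact inner_eq_zero_symm.1 (hyo' v (subset_span hv))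
      · rw [if_neg (by rintro rfl; exact hys hu)]
        exact hyo' u (subset_span hu)
      · exact h0 u hu v hv
    · rintro u (rfl | hu) a
      · rw [hy, span_singleton_smul_eq (IsUnit.mk0 _ hx0')]
        exact hxV a
      · exact hs.prop.2 u hu a
  refine ⟨s, HilbertBasis.mkOfOrthogonalEqBot hs.prop.1 hbot, fun a i => ?_⟩
  rw [HilbertBasis.coe_mkOfOrthogonalEqBot]
  exact hs.prop.2 i i.2 a

end Diagonalization

/-! ### Notions defined from a symmetric relation -/

section Commutants

variable {α : Type*}

/-- `T` is in the double commutant of `{P, Q}` for the symmetric relation `r`. -/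
def InBicommutant (r : α → α → Prop) (P Q T : α) : Prop :=
  ∀ R, r R P → r R Q → r R T

/-- `P` and `Q` have the same commutant. -/
def SameCommutant (r : α → α → Prop) (P Q : α) : Prop :=
  ∀ R, r R P ↔ r R Q

/-- `P` and `Q` do not commute, but both commute with a commuting set `S` whose commutant is as
small as possible: adding to `S` any further element of its commutant makes the commutant
commutative. -/
def MinimallyNoncommuting (r : α → α → Prop) (P Q : α) : Prop :=
  ¬ r P Q ∧ ∃ S : Set α, (∀ A ∈ S, ∀ B ∈ S, r A B) ∧ (∀ A ∈ S, r A P ∧ r A Q) ∧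
    ∀ R ∉ S, (∀ A ∈ S, r R A) → ∀ T₁ T₂, (∀ A ∈ S, r T₁ A) → (∀ A ∈ S, r T₂ A) →
      r T₁ R → r T₂ R → r T₁ T₂

/-- Up to `SameCommutant` there is at most one element of the double commutant of `{P, Q}`, other
than `P`, that commutes with `P` but not with `Q`. -/
def UniquePartner (r : α → α → Prop) (P Q : α) : Prop :=
  ∀ T₁ T₂, InBicommutant r P Q T₁ → InBicommutant r P Q T₂ → r T₁ P → r T₂ P →
    ¬ r T₁ Q → ¬ r T₂ Q → ¬ SameCommutant r T₁ P → ¬ SameCommutant r T₂ P → SameCommutant r T₁ T₂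

/-- The description, in terms of commutativity only, of noncommuting neighbours in the
Grassmann graph, up to orthogonal complementation. -/
def NoncommutingNeighbours (r : α → α → Prop) (P Q : α) : Prop :=
  MinimallyNoncommuting r P Q ∧ UniquePartner r P Q

/-- The description, in terms of commutativity only, of commuting neighbours in the
Grassmann graph, up to orthogonal complementation. -/
def CommutingNeighbours (r : α → α → Prop) (P Q : α) : Prop :=
  r P Q ∧ ¬ SameCommutant r P Q ∧
    ∃ R, NoncommutingNeighbours r P R ∧ InBicommutant r P R Q ∧ ¬ r R Q

variable {β : Type*} {r : α → α → Prop} {s : β → β → Prop}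

lemma InBicommutant.map (e : r ≃r s) {P Q T : α} (h : InBicommutant r P Q T) :
    InBicommutant s (e P) (e Q) (e T) := by
  intro R
  obtain ⟨R, rfl⟩ := e.surjective R
  simpa only [e.map_rel_iff] using h R

lemma SameCommutant.map (e : r ≃r s) {P Q : α} (h : SameCommutant r P Q) :
    SameCommutant s (e P) (e Q) := by
  intro R
  obtain ⟨R, rfl⟩ := e.surjective R
  simpa only [e.map_rel_iff] using h R

lemma InBicommutant.map_iff (e : r ≃r s) {P Q T : α} :
    InBicommutant s (e P) (e Q) (e T) ↔ InBicommutant r P Q T :=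
  ⟨fun h => by simpa using h.map e.symm, fun h => h.map e⟩

lemma SameCommutant.map_iff (e : r ≃r s) {P Q : α} :
    SameCommutant s (e P) (e Q) ↔ SameCommutant r P Q :=
  ⟨fun h => by simpa using h.map e.symm, fun h => h.map e⟩

lemma MinimallyNoncommuting.map (e : r ≃r s) {P Q : α} (h : MinimallyNoncommuting r P Q) :
    MinimallyNoncommuting s (e P) (e Q) := by
  obtain ⟨hPQ, S, hS, hSPQ, hmax⟩ := h
  refine ⟨by rwa [e.map_rel_iff], e '' S, ?_, ?_, ?_⟩
  · rintro _ ⟨A, hA, rfl⟩ _ ⟨B, hB, rfl⟩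
    exact e.map_rel_iff.2 (hS A hA B hB)
  · rintro _ ⟨A, hA, rfl⟩
    simpa only [e.map_rel_iff] using hSPQ A hA
  · intro R hR hRS T₁ T₂
    obtain ⟨R, rfl⟩ := e.surjective R
    obtain ⟨T₁, rfl⟩ := e.surjective T₁
    obtain ⟨T₂, rfl⟩ := e.surjective T₂
    rw [e.injective.mem_set_image] at hR
    simp only [Set.forall_mem_image, e.map_rel_iff] at hRS ⊢
    exact fun h1 h2 => hmax R hR (fun A hA => hRS hA) T₁ T₂ (fun A hA => h1 hA) fun A hA => h2 hA

lemma UniquePartner.map (e : r ≃r s) {P Q : α} (h : UniquePartner r P Q) :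
    UniquePartner s (e P) (e Q) := by
  intro T₁ T₂
  obtain ⟨T₁, rfl⟩ := e.surjective T₁
  obtain ⟨T₂, rfl⟩ := e.surjective T₂
  simpa only [e.map_rel_iff, InBicommutant.map_iff, SameCommutant.map_iff] using h T₁ T₂

lemma NoncommutingNeighbours.map (e : r ≃r s) {P Q : α} (h : NoncommutingNeighbours r P Q) :
    NoncommutingNeighbours s (e P) (e Q) :=
  ⟨h.1.map e, h.2.map e⟩

lemma CommutingNeighbours.map (e : r ≃r s) {P Q : α} (h : CommutingNeighbours r P Q) :
    CommutingNeighbours s (e P) (e Q) := by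
  obtain ⟨h1, h2, R, hR, h3, h4⟩ := h
  exact ⟨e.map_rel_iff.2 h1, by rwa [SameCommutant.map_iff], e R, hR.map e, h3.map e,
    by rwa [e.map_rel_iff]⟩

end Commutants

/-! ### The Grassmannian and double commutants -/

section Grassmannian

variable {H : Type*} [NormedAddCommGroup H] [InnerProductSpace ℂ H]

variable (H) in
/-- The Grassmannian of `k`-dimensional subspaces of `H`. Rank-`k` projections are handled through
their ranges. -/
abbrev Gr (k : ℕ) : Type _ :=
  {V : Submodule ℂ H // FiniteDimensional ℂ V ∧ finrank ℂ V = k}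

namespace Gr

variable {k : ℕ}

instance (P : Gr H k) : FiniteDimensional ℂ P.1 := P.2.1

lemma finrank_val (P : Gr H k) : finrank ℂ P.1 = k := P.2.2

/-- The projections onto `P` and `Q` commute. -/
def Comm (P Q : Gr H k) : Prop := Compatible P.1 Q.1

/-- `P` and `Q` are neighbours in the Grassmann graph: their intersection has codimension one in
both. -/
def Adj (P Q : Gr H k) : Prop := finrank ℂ (P.1 ⊓ Q.1 : Submodule ℂ H) + 1 = k

/-- `P` is a neighbour of `Q` or of the orthogonal complement of `Q`; the second alternative can
occur only if `dim H = 2 * k`. -/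
def Near (P Q : Gr H k) : Prop := Adj P Q ∨ ∃ Q' : Gr H k, Q'.1 = Q.1ᗮ ∧ Adj P Q'

lemma Comm.symm {P Q : Gr H k} (h : Comm P Q) : Comm Q P := Compatible.symm h

lemma comm_self (P : Gr H k) : Comm P P := compatible_of_le le_rfl

lemma Adj.symm {P Q : Gr H k} (h : Adj P Q) : Adj Q P := by
  rwa [Adj, inf_comm]

lemma eq_of_le {P Q : Gr H k} (h : P.1 ≤ Q.1) : P = Q :=
  Subtype.ext (Submodule.eq_of_le_of_finrank_eq h (P.2.2.trans Q.2.2.symm))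

lemma Adj.ne {P Q : Gr H k} (h : Adj P Q) : P ≠ Q := by
  rintro rfl
  rw [Adj, inf_idem, P.2.2] at h
  omega

lemma adj_of_le {P Q : Gr H k} {X : Submodule ℂ H} (hX : finrank ℂ X + 1 = k)
    (hP : X ≤ P.1) (hQ : X ≤ Q.1) (hne : P ≠ Q) : Adj P Q := by
  have h1 := finrank_mono (le_inf hP hQ)
  have h2 : finrank ℂ (P.1 ⊓ Q.1 : Submodule ℂ H) < finrank ℂ P.1 := by
    refine finrank_lt_finrank_of_lt (lt_of_le_of_ne inf_le_left fun h => hne ?_)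
    exact eq_of_le (inf_eq_left.1 h)
  rw [P.2.2] at h2
  rw [Adj]
  omega

end Gr

/-- The standing assumptions on the dimensions. For `k = 2` they give `5 ≤ dim H`, and when
`dim H = 2 * k` they keep a neighbour of `P` in the Grassmann graph away from the neighbours of
`Pᗮ`. -/
structure GoodDim (H : Type*) [NormedAddCommGroup H] [InnerProductSpace ℂ H] (k : ℕ) : Prop where
  two_le : 2 ≤ k
  two_mul_le : ((2 * k : ℕ) : Cardinal) ≤ Module.rank ℂ H
  four_le : Module.rank ℂ H = ((2 * k : ℕ) : Cardinal) → 4 ≤ k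

lemma finrank_sup_span_singleton {V : Submodule ℂ H} [FiniteDimensional ℂ V] {x : H}
    (hx : x ∉ V) : finrank ℂ (V ⊔ ℂ ∙ x : Submodule ℂ H) = finrank ℂ V + 1 := by
  have hx0 : x ≠ 0 := fun h => hx (h ▸ zero_mem _)
  have h1 := finrank_sup_add_finrank_inf_eq V (ℂ ∙ x)
  have h2 : V ⊓ (ℂ ∙ x) = ⊥ := by
    rw [eq_bot_iff]
    rintro y ⟨hy, hyx⟩
    obtain ⟨c, rfl⟩ := mem_span_singleton.1 hyx
    by_cases hc : c = 0
    · simp [hc]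
    · exact absurd ((smul_mem_iff _ hc).1 hy) hx
  rw [h2, finrank_bot, finrank_span_singleton hx0] at h1
  omega

lemma notMem_of_mem_orthogonal {V : Submodule ℂ H} {x : H} (hx : x ∈ Vᗮ) (hx0 : x ≠ 0) :
    x ∉ V := fun h => hx0 (by
  have := (mem_orthogonal _ _).1 hx x h
  rwa [inner_self_eq_zero] at this)

lemma eq_zero_of_mem_of_mem_orthogonal {V : Submodule ℂ H} {x : H} (hx : x ∈ V) (hx' : x ∈ Vᗮ) :
    x = 0 := by
  by_contra h
  exact notMem_of_mem_orthogonal hx' h hx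

/-- Adjoining to `X` the line through a vector outside it. -/
def Gr.cons {k : ℕ} (X : Gr H k) (x : H) (hx : x ∉ X.1) : Gr H (k + 1) :=
  ⟨X.1 ⊔ ℂ ∙ x, inferInstance, by rw [finrank_sup_span_singleton hx, X.2.2]⟩

lemma finrank_inf_add_finrank_inf_orthogonal {V W : Submodule ℂ H} [V.HasOrthogonalProjection]
    [FiniteDimensional ℂ W] (h : Compatible V W) :
    finrank ℂ (W ⊓ V : Submodule ℂ H) + finrank ℂ (W ⊓ Vᗮ : Submodule ℂ H) = finrank ℂ W := by
  have h1 := finrank_sup_add_finrank_inf_eq (W ⊓ V) (W ⊓ Vᗮ)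
  have h2 : (W ⊓ V) ⊓ (W ⊓ Vᗮ) = ⊥ := by
    rw [eq_bot_iff]
    exact fun x hx => (mem_bot ℂ).2 (eq_zero_of_mem_of_mem_orthogonal hx.1.2 hx.2.2)
  rw [← h.eq_sup, h2, finrank_bot] at h1
  omega

section Compl

variable {k : ℕ}

/-- If one `k`-dimensional subspace has a `k`-dimensional orthogonal complement, then
`dim H = 2 * k`. -/
lemma rank_eq_of_orthogonal {P Q : Gr H k} (h : Q.1 = P.1ᗮ) :
    Module.rank ℂ H = ((2 * k : ℕ) : Cardinal) := by
  have h1 : P.1 ⊔ Q.1 = ⊤ := by rw [h]; exact sup_orthogonal_of_hasOrthogonalProjection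
  have h2 : P.1 ⊓ Q.1 = ⊥ := by rw [h]; exact inf_orthogonal_eq_bot _
  have h3 := Submodule.rank_sup_add_rank_inf_eq P.1 Q.1
  rw [h1, h2, rank_top, rank_bot, add_zero, ← finrank_eq_rank ℂ P.1, ← finrank_eq_rank ℂ Q.1,
    P.2.2, Q.2.2] at h3
  rw [h3]
  push_cast
  ring

lemma exists_orthogonal (h : Module.rank ℂ H = ((2 * k : ℕ) : Cardinal)) (P : Gr H k) :
    ∃ Q : Gr H k, Q.1 = P.1ᗮ := by
  have hfin : FiniteDimensional ℂ H := by
    apply Module.finite_of_rank_eq_nat h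
  refine ⟨⟨P.1ᗮ, inferInstance, ?_⟩, rfl⟩
  have h1 := finrank_add_finrank_orthogonal P.1
  rw [P.2.2, finrank_eq_of_rank_eq h] at h1
  omega

end Compl

section SameCommutant

open Gr

variable {k : ℕ}

lemma exists_diagonal_hilbertBasis_of_four [CompleteSpace H] (V₁ V₂ V₃ V₄ : Submodule ℂ H)
    [FiniteDimensional ℂ V₁] [FiniteDimensional ℂ V₂] [FiniteDimensional ℂ V₃]
    [FiniteDimensional ℂ V₄] (h₁₂ : Compatible V₁ V₂) (h₁₃ : Compatible V₁ V₃)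
    (h₁₄ : Compatible V₁ V₄) (h₂₃ : Compatible V₂ V₃) (h₂₄ : Compatible V₂ V₄)
    (h₃₄ : Compatible V₃ V₄) :
    ∃ (w : Set H) (b : HilbertBasis w ℂ H), ∀ i, Compatible V₁ (ℂ ∙ b i) ∧
      Compatible V₂ (ℂ ∙ b i) ∧ Compatible V₃ (ℂ ∙ b i) ∧ Compatible V₄ (ℂ ∙ b i) := by
  let V : Fin 4 → Submodule ℂ H := ![V₁, V₂, V₃, V₄]
  have i0 : FiniteDimensional ℂ (V 0) := ‹FiniteDimensional ℂ V₁›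
  have i1 : FiniteDimensional ℂ (V 1) := ‹FiniteDimensional ℂ V₂›
  have i2 : FiniteDimensional ℂ (V 2) := ‹FiniteDimensional ℂ V₃›
  have i3 : FiniteDimensional ℂ (V 3) := ‹FiniteDimensional ℂ V₄›
  have inst : ∀ a, FiniteDimensional ℂ (V a) := by
    intro a
    fin_cases a
    exacts [i0, i1, i2, i3]
  obtain ⟨w, b, hb⟩ := exists_diagonal_hilbertBasis V (by
    have hlt : ∀ a a', a < a' → Compatible (V a) (V a') := by
      intro a a' h
      fin_cases a <;> fin_cases a' <;> first | exact absurd h (by decide) | assumption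
    intro a a'
    rcases lt_trichotomy a a' with h | rfl | h
    · exact hlt _ _ h
    · exact compatible_of_le le_rfl
    · exact (hlt _ _ h).symm)
  exact ⟨w, b, fun i => ⟨hb 0 i, hb 1 i, hb 2 i, hb 3 i⟩⟩

lemma exists_line_eq {ι : Type*} {b : HilbertBasis ι ℂ H} {x : H} (hx : x ≠ 0)
    (h : ∀ i, Compatible (ℂ ∙ x) (ℂ ∙ b i)) : ∃ l, (ℂ ∙ x) = ℂ ∙ b l := by
  obtain ⟨F, hF⟩ := exists_eq_coordSpan h
  have h1 : F.card = 1 := by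
    rw [← finrank_coordSpan (b := b), ← hF, finrank_span_singleton hx]
  obtain ⟨l, rfl⟩ := Finset.card_eq_one.1 h1
  exact ⟨l, by rw [hF, coordSpan_singleton]⟩

/-- The coordinate subspace of a `k`-element set of indices. -/
def coordGr {ι : Type*} (b : HilbertBasis ι ℂ H) (F : Finset ι) (hF : F.card = k) : Gr H k :=
  ⟨coordSpan b F, inferInstance, by rw [finrank_coordSpan, hF]⟩

lemma exists_inter_eq_singleton {ι : Type*} [DecidableEq ι] (b : HilbertBasis ι ℂ H)
    (hk : GoodDim H k) (l : ι) : ∃ F G : Finset ι, F.card = k ∧ G.card = k ∧ F ∩ G = {l} := by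
  have h2 := hk.two_le
  obtain ⟨A, hA, hd⟩ := exists_disjoint_finset_card b {l} (2 * (k - 1)) (by
    refine le_trans ?_ hk.two_mul_le
    rw [Finset.card_singleton]
    exact_mod_cast (by omega))
  rw [Finset.disjoint_singleton_left] at hd
  obtain ⟨B, hBA, hB⟩ := Finset.exists_subset_card_eq (show k - 1 ≤ A.card by omega)
  refine ⟨insert l B, insert l (A \ B), ?_, ?_, ?_⟩
  · rw [Finset.card_insert_of_notMem fun h => hd (hBA h), hB]; omega
  · rw [Finset.card_insert_of_notMem fun h => hd (Finset.mem_sdiff.1 h).1,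
      Finset.card_sdiff_of_subset hBA]; omega
  · rw [← Finset.insert_inter_distrib, Finset.inter_sdiff_self]; rfl

/-- A line invariant under `P` is the intersection of two `k`-dimensional subspaces commuting with
`P`, so it is invariant under everything in the double commutant of `P`. -/
lemma compatible_line_of_commutant [CompleteSpace H] (hk : GoodDim H k) {P T : Gr H k}
    (hT : ∀ R, Comm R P → Comm R T) {x : H} (hx : Compatible P.1 (ℂ ∙ x)) :
    Compatible T.1 (ℂ ∙ x) := by
  classical
  by_cases hx0 : x = 0
  · rw [hx0, span_zero_singleton]; exact compatible_bot
  obtain ⟨w, b, hb⟩ := exists_diagonal_hilbertBasis_of_four P.1 (ℂ ∙ x) ⊥ ⊥ hx compatible_bot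
    compatible_bot compatible_bot compatible_bot compatible_bot
  obtain ⟨l, hl⟩ := exists_line_eq hx0 fun i => (hb i).2.1
  obtain ⟨F, G, hF, hG, hFG⟩ := exists_inter_eq_singleton b hk l
  have key : ∀ F : Finset w, F.card = k → Compatible T.1 (coordSpan b F) := fun F hF =>
    (hT (coordGr b F hF) (compatible_of_forall_line (fun i => compatible_coordSpan_line F i)
      fun i => (hb i).1)).symm
  rw [hl]
  exact (key F hF).line_of_inter (key G hG) hFG

lemma comm_iff_of_eq_orthogonal {P Q : Gr H k} (h : Q.1 = P.1ᗮ) (R : Gr H k) :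
    Comm R P ↔ Comm R Q := by
  rw [Comm, Comm, h]
  exact ⟨fun h => h.orthogonal, fun h => by simpa using h.orthogonal⟩

lemma eq_orthogonal_symm {P Q : Gr H k} (h : Q.1 = P.1ᗮ) : P.1 = Q.1ᗮ := by
  rw [h, orthogonal_orthogonal]

/-- The commutant determines a `k`-dimensional subspace up to orthogonal complement. -/
theorem sameCommutant_iff [CompleteSpace H] (hk : GoodDim H k) {P Q : Gr H k} :
    SameCommutant Comm P Q ↔ P = Q ∨ Q.1 = P.1ᗮ := by
  refine ⟨fun h => ?_, ?_⟩
  · have hl : ∀ x, Compatible P.1 (ℂ ∙ x) → Compatible Q.1 (ℂ ∙ x) := fun x hx =>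
      compatible_line_of_commutant hk (fun R => (h R).1) hx
    have h1 := le_or_le_orthogonal_of_forall_line (V := Q.1) (W := P.1) fun x hx =>
      hl x (compatible_span_singleton.2 (Or.inl hx))
    have h2 := le_or_le_orthogonal_of_forall_line (V := Q.1) (W := P.1ᗮ) fun x hx =>
      hl x (compatible_span_singleton.2 (Or.inr hx))
    rcases h1 with h1 | h1
    · exact Or.inl (Gr.eq_of_le h1)
    · rcases h2 with h2 | h2
      · exact Or.inr (le_antisymm (by rwa [le_orthogonal_iff_le_orthogonal]) h2)
      · -- here `Q` would be orthogonal to everything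
        exfalso
        have : (⊤ : Submodule ℂ H) ≤ Q.1ᗮ := by
          rw [← sup_orthogonal_of_hasOrthogonalProjection (K := P.1)]
          exact sup_le h1 h2
        have hbot : Q.1 = ⊥ := by
          rw [eq_bot_iff]
          intro x hx
          exact eq_zero_of_mem_of_mem_orthogonal hx (this mem_top)
        have h3 := Q.2.2
        rw [hbot, finrank_bot] at h3
        have := hk.two_le
        omega
  · rintro (rfl | h)
    · exact fun R => Iff.rfl
    · exact comm_iff_of_eq_orthogonal h

end SameCommutant

end Grassmannian

/-! ### Reducing planes -/

section ReducingPlane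

open Gr
open scoped InnerProductSpace

variable {H : Type*} [NormedAddCommGroup H] [InnerProductSpace ℂ H]

/-- `E` is a plane reducing both `P` and `Q`, and their projections commute on its orthogonal
complement. -/
structure ReducingPlane (P Q E : Submodule ℂ H) [P.HasOrthogonalProjection]
    [Q.HasOrthogonalProjection] : Prop where
  finrank_eq : finrank ℂ E = 2
  left : Compatible P E
  right : Compatible Q E
  comm : ∀ x ∈ Eᗮ, P.starProjection (Q.starProjection x) = Q.starProjection (P.starProjection x)

lemma exists_eq_span_singleton {V : Submodule ℂ H} (h : finrank ℂ V = 1) :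
    ∃ v ∈ V, v ≠ 0 ∧ V = ℂ ∙ v := by
  obtain ⟨v, hv0, hv⟩ := finrank_eq_one_iff'.1 h
  refine ⟨v, v.2, fun h => hv0 (Subtype.ext h), le_antisymm (fun x hx => ?_) ?_⟩
  · obtain ⟨c, hc⟩ := hv ⟨x, hx⟩
    exact mem_span_singleton.2 ⟨c, congrArg Subtype.val hc⟩
  · exact (span_singleton_le_iff_mem _ _).2 v.2

variable {P Q E : Submodule ℂ H} [FiniteDimensional ℂ P] [FiniteDimensional ℂ Q]

lemma ReducingPlane.finiteDimensional (h : ReducingPlane P Q E) : FiniteDimensional ℂ E :=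
  FiniteDimensional.of_finrank_pos (by rw [h.finrank_eq]; norm_num)

lemma ReducingPlane.symm (h : ReducingPlane P Q E) : ReducingPlane Q P E :=
  ⟨h.finrank_eq, h.right, h.left, fun x hx => (h.comm x hx).symm⟩

lemma starProjection_comm_of_line {z : H} (hP : Compatible P (ℂ ∙ z))
    (hQ : Compatible Q (ℂ ∙ z)) :
    P.starProjection (Q.starProjection z) = Q.starProjection (P.starProjection z) := by
  obtain ⟨c, hc⟩ := mem_span_singleton.1 (hP z (mem_span_singleton_self z))
  obtain ⟨d, hd⟩ := mem_span_singleton.1 (hQ z (mem_span_singleton_self z))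
  rw [← hc, ← hd, map_smul, map_smul, ← hc, ← hd, smul_comm]

/-- A line in the plane `E` reducing both projections makes them commute: its complement in `E` is
then a reducing line as well. -/
lemma ReducingPlane.compatible_of_line (h : ReducingPlane P Q E) {z : H} (hz : z ∈ E)
    (hz0 : z ≠ 0) (hP : Compatible P (ℂ ∙ z)) (hQ : Compatible Q (ℂ ∙ z)) : Compatible P Q := by
  have := h.finiteDimensional
  have hle : (ℂ ∙ z) ≤ E := (span_singleton_le_iff_mem _ _).2 hz
  have h1 := finrank_add_inf_finrank_orthogonal hle
  rw [finrank_span_singleton hz0, h.finrank_eq] at h1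
  obtain ⟨v, -, -, hv⟩ := exists_eq_span_singleton
    (V := ((ℂ ∙ z)ᗮ ⊓ E : Submodule ℂ H)) (by omega)
  have hPv := hv ▸ hP.orthogonal.inf h.left
  have hQv := hv ▸ hQ.orthogonal.inf h.right
  have hE : E = (ℂ ∙ z) ⊔ ℂ ∙ v := by
    rw [← hv, sup_orthogonal_inf_of_hasOrthogonalProjection hle]
  rw [compatible_iff_commute]
  refine ContinuousLinearMap.ext fun x => ?_
  change P.starProjection (Q.starProjection x) = Q.starProjection (P.starProjection x)
  obtain ⟨e, he, y, hy, rfl⟩ := E.exists_add_mem_mem_orthogonal x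
  rw [hE] at he
  obtain ⟨a, ha, c, hc, rfl⟩ := mem_sup.1 he
  obtain ⟨s, rfl⟩ := mem_span_singleton.1 ha
  obtain ⟨t, rfl⟩ := mem_span_singleton.1 hc
  simp only [map_add, map_smul, h.comm y hy, starProjection_comm_of_line hP hQ,
    starProjection_comm_of_line hPv hQv]

lemma ReducingPlane.eq_zero (h : ReducingPlane P Q E) (hne : ¬ Compatible P Q) {z : H}
    (hz : z ∈ E) (hP : z ∈ P ∨ z ∈ Pᗮ) (hQ : z ∈ Q ∨ z ∈ Qᗮ) : z = 0 := by
  by_contra hz0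
  exact hne (h.compatible_of_line hz hz0 (compatible_span_singleton.2 hP)
    (compatible_span_singleton.2 hQ))

/-- A subspace compatible with `P` and `Q` is compatible with the plane on which their projections
fail to commute: its complement is the kernel of the commutator. -/
lemma ReducingPlane.compatible_of_commutant (h : ReducingPlane P Q E) (hne : ¬ Compatible P Q)
    {R : Submodule ℂ H} [FiniteDimensional ℂ R] (hP : Compatible R P) (hQ : Compatible R Q) :
    Compatible R E := by
  have := h.finiteDimensional
  rw [compatible_iff_commute] at hP hQ
  have hP' : ∀ x, R.starProjection (P.starProjection x) = P.starProjection (R.starProjection x) :=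
    fun x => DFunLike.congr_fun hP x
  have hQ' : ∀ x, R.starProjection (Q.starProjection x) = Q.starProjection (R.starProjection x) :=
    fun x => DFunLike.congr_fun hQ x
  have hinj : ∀ e ∈ E, P.starProjection (Q.starProjection e) = Q.starProjection (P.starProjection e) →
      e = 0 := by
    intro e he heq
    have h0 : P.starProjection (Q.starProjection e) = 0 := by
      refine h.eq_zero hne (h.left _ (h.right _ he)) (Or.inl (starProjection_apply_mem _ _)) ?_
      rw [heq]
      exact Or.inl (starProjection_apply_mem _ _)
    have hQe : Q.starProjection e = 0 := h.eq_zero hne (h.right _ he)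
      (Or.inr ((starProjection_apply_eq_zero_iff P).1 h0)) (Or.inl (starProjection_apply_mem _ _))
    rw [h0] at heq
    have hPe : P.starProjection e = 0 := h.eq_zero hne (h.left _ he)
      (Or.inl (starProjection_apply_mem _ _))
      (Or.inr ((starProjection_apply_eq_zero_iff Q).1 heq.symm))
    exact h.eq_zero hne he (Or.inr ((starProjection_apply_eq_zero_iff P).1 hPe))
      (Or.inr ((starProjection_apply_eq_zero_iff Q).1 hQe))
  suffices hc : Compatible R Eᗮ by simpa using hc.orthogonal
  intro x hx
  obtain ⟨e, he, y, hy, hxy⟩ := E.exists_add_mem_mem_orthogonal (R.starProjection x)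
  have hcomm : P.starProjection (Q.starProjection (R.starProjection x)) =
      Q.starProjection (P.starProjection (R.starProjection x)) := by
    rw [← hQ', ← hP', h.comm x hx, hQ', hP']
  rw [hxy] at hcomm
  simp only [map_add, h.comm y hy, add_left_inj] at hcomm
  rw [hxy, hinj e he hcomm, zero_add]
  exact hy

/-- If `P` and `Q` do not commute, then both `P` and `Pᗮ` meet the plane `E` in a line. -/
lemma ReducingPlane.finrank_inf (h : ReducingPlane P Q E) (hne : ¬ Compatible P Q) :
    finrank ℂ (E ⊓ P : Submodule ℂ H) = 1 ∧ finrank ℂ (E ⊓ Pᗮ : Submodule ℂ H) = 1 := by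
  have := h.finiteDimensional
  have h1 := finrank_inf_add_finrank_inf_orthogonal h.left
  rw [h.finrank_eq] at h1
  have hE : E ≠ ⊥ := by
    rintro rfl
    simpa using h.finrank_eq
  -- `E` cannot lie in `P` or in its complement: it would be spanned by reducing vectors
  have hout : ∀ V : Submodule ℂ H, (V = P ∨ V = Pᗮ) → ¬ E ≤ V := by
    intro V hV hle
    refine hE ?_
    have h2 : ∀ z ∈ E, (z ∈ Q ∨ z ∈ Qᗮ) → z = 0 := fun z hz hzQ =>
      h.eq_zero hne hz (by rcases hV with rfl | rfl; exacts [Or.inl (hle hz), Or.inr (hle hz)]) hzQ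
    rw [h.right.eq_sup, eq_bot_iff]
    exact sup_le (fun z hz => (mem_bot ℂ).2 (h2 z hz.1 (Or.inl hz.2)))
      fun z hz => (mem_bot ℂ).2 (h2 z hz.1 (Or.inr hz.2))
  have h3 : finrank ℂ (E ⊓ P : Submodule ℂ H) ≠ 0 := fun h0 => by
    rw [finrank_eq_zero] at h0
    have h4 := h.left.eq_sup
    rw [h0, bot_sup_eq] at h4
    exact hout _ (Or.inr rfl) (h4.le.trans inf_le_right)
  have h5 : finrank ℂ (E ⊓ Pᗮ : Submodule ℂ H) ≠ 0 := fun h0 => by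
    rw [finrank_eq_zero] at h0
    have h4 := h.left.eq_sup
    rw [h0, sup_bot_eq] at h4
    exact hout _ (Or.inl rfl) (h4.le.trans inf_le_right)
  omega

/-- Projections that are diagonal in a Hilbert basis except at two of its members. -/
lemma reducingPlane_of_diagonal_off_pair {ι : Type*} [DecidableEq ι] {b : HilbertBasis ι ℂ H}
    {i j : ι} (hij : i ≠ j) (hP : ∀ l, l ≠ i → l ≠ j → Compatible P (ℂ ∙ b l))
    (hQ : ∀ l, l ≠ i → l ≠ j → Compatible Q (ℂ ∙ b l)) :
    ReducingPlane P Q (coordSpan b {i, j}) := by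
  have hP' : ∀ l ∉ ({i, j} : Finset ι), Compatible P (ℂ ∙ b l) := fun l hl => by
    simp only [Finset.mem_insert, Finset.mem_singleton, not_or] at hl
    exact hP l hl.1 hl.2
  have hQ' : ∀ l ∉ ({i, j} : Finset ι), Compatible Q (ℂ ∙ b l) := fun l hl => by
    simp only [Finset.mem_insert, Finset.mem_singleton, not_or] at hl
    exact hQ l hl.1 hl.2
  have hPE := compatible_coordSpan_of_compl hP'
  have hQE := compatible_coordSpan_of_compl hQ'
  refine ⟨by rw [finrank_coordSpan, Finset.card_pair hij], hPE, hQE, fun x hx => ?_⟩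
  rw [← sub_eq_zero]
  refine b.eq_zero_of_forall_inner fun m => ?_
  rw [inner_sub_right, sub_eq_zero]
  simp only [← inner_starProjection_left_eq_right]
  by_cases hm : m ∈ ({i, j} : Finset ι)
  · have hbm : b m ∈ coordSpan b {i, j} := apply_mem_coordSpan.2 hm
    rw [(mem_orthogonal _ _).1 hx _ (hPE _ (hQE _ hbm)),
      (mem_orthogonal _ _).1 hx _ (hQE _ (hPE _ hbm))]
  · rw [starProjection_comm_of_line (hP' m hm) (hQ' m hm)]

end ReducingPlane

section Partners

open Gr

variable {H : Type*} [NormedAddCommGroup H] [InnerProductSpace ℂ H] {k : ℕ} {P Q : Gr H k}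
  {E : Submodule ℂ H}

lemma ReducingPlane.compatible_inf_orthogonal {P Q : Submodule ℂ H} [FiniteDimensional ℂ P]
    [FiniteDimensional ℂ Q] (h : ReducingPlane P Q E) : Compatible P (Q ⊓ Eᗮ) := by
  intro x hx
  refine ⟨?_, h.left.orthogonal _ hx.2⟩
  refine starProjection_eq_self_iff.1 ?_
  rw [← h.comm x hx.2, starProjection_eq_self_iff.2 hx.1]

lemma ReducingPlane.finrank_inf_orthogonal (h : ReducingPlane P.1 Q.1 E) (hne : ¬ Comm P Q) :
    finrank ℂ (P.1 ⊓ Eᗮ : Submodule ℂ H) + 1 = k := by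
  have := h.finiteDimensional
  have h1 := finrank_inf_add_finrank_inf_orthogonal h.left.symm
  rw [inf_comm, (h.finrank_inf hne).1, P.2.2] at h1
  omega

lemma mem_of_mem_sup_orthogonal {X V : Submodule ℂ H} (hX : X ≤ Eᗮ) (hV : V ≤ E) {x : H}
    (hx : x ∈ X ⊔ V) (hxE : x ∈ E) : x ∈ V := by
  obtain ⟨y, hy, z, hz, rfl⟩ := mem_sup.1 hx
  have : y ∈ E := (Submodule.add_mem_iff_left _ (hV hz)).1 hxE
  rwa [eq_zero_of_mem_of_mem_orthogonal this (hX hy), zero_add]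

lemma finrank_sup_of_le_orthogonal {X V : Submodule ℂ H} [FiniteDimensional ℂ X]
    [FiniteDimensional ℂ V] (h : X ≤ Vᗮ) :
    finrank ℂ (X ⊔ V : Submodule ℂ H) = finrank ℂ X + finrank ℂ V := by
  have h1 := finrank_sup_add_finrank_inf_eq X V
  have h2 : X ⊓ V = ⊥ := by
    rw [eq_bot_iff]
    exact fun x hx => (mem_bot ℂ).2 (eq_zero_of_mem_of_mem_orthogonal hx.2 (h hx.1))
  rw [h2, finrank_bot] at h1
  omega

/-- The subspace obtained from `P` by replacing its line in the plane `E` by the orthogonal line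
of `E`. -/
noncomputable def ReducingPlane.flip (h : ReducingPlane P.1 Q.1 E) (hne : ¬ Comm P Q) : Gr H k :=
  ⟨(P.1 ⊓ Eᗮ) ⊔ (E ⊓ P.1ᗮ), have := h.finiteDimensional; inferInstance, by
    have := h.finiteDimensional
    rw [finrank_sup_of_le_orthogonal (inf_le_right.trans (orthogonal_le inf_le_left)),
      (h.finrank_inf hne).2, h.finrank_inf_orthogonal hne]⟩

lemma ReducingPlane.flip_val (h : ReducingPlane P.1 Q.1 E) (hne : ¬ Comm P Q) :
    (h.flip hne).1 = (P.1 ⊓ Eᗮ) ⊔ (E ⊓ P.1ᗮ) := rfl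

lemma ReducingPlane.inBicommutant_flip (h : ReducingPlane P.1 Q.1 E) (hne : ¬ Comm P Q) :
    InBicommutant Comm P Q (h.flip hne) := by
  intro R hP hQ
  have hE := h.compatible_of_commutant hne hP hQ
  exact (Compatible.inf hP hE.orthogonal).sup (hE.inf (Compatible.orthogonal hP))

/-- A subspace meeting the plane `E` in a line of `P` or of `Pᗮ` does not commute with `Q`. -/
lemma ReducingPlane.not_compatible_of_inf {T : Submodule ℂ H}
    (h : ReducingPlane P.1 Q.1 E) (hne : ¬ Comm P Q) {z : H} (hz : z ∈ E) (hz0 : z ≠ 0)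
    (hzT : z ∈ T)
    (hT : ∀ x ∈ T, x ∈ E → x ∈ P.1 ∨ x ∈ P.1ᗮ) : ¬ Compatible Q.1 T := by
  intro hc
  have h1 : Q.1.starProjection z = 0 := h.eq_zero hne (h.right z hz)
    (hT _ (hc z hzT) (h.right z hz)) (Or.inl (starProjection_apply_mem _ _))
  exact hz0 (h.eq_zero hne hz (hT z hzT hz) (Or.inr ((starProjection_apply_eq_zero_iff _).1 h1)))

lemma ReducingPlane.flip_of_mem (h : ReducingPlane P.1 Q.1 E) (hne : ¬ Comm P Q) {x : H}
    (hx : x ∈ (h.flip hne).1) (hxE : x ∈ E) : x ∈ P.1ᗮ :=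
  (mem_of_mem_sup_orthogonal inf_le_right inf_le_left hx hxE).2

lemma ReducingPlane.exists_mem_inf (h : ReducingPlane P.1 Q.1 E) (hne : ¬ Comm P Q) :
    ∃ z ∈ E, z ≠ 0 ∧ z ∈ P.1 := by
  obtain ⟨z, hz, hz0, -⟩ := exists_eq_span_singleton (h.finrank_inf hne).1
  exact ⟨z, hz.1, hz0, hz.2⟩

lemma ReducingPlane.exists_mem_inf_orthogonal (h : ReducingPlane P.1 Q.1 E) (hne : ¬ Comm P Q) :
    ∃ z ∈ E, z ≠ 0 ∧ z ∈ P.1ᗮ := by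
  obtain ⟨z, hz, hz0, -⟩ := exists_eq_span_singleton (h.finrank_inf hne).2
  exact ⟨z, hz.1, hz0, hz.2⟩

lemma ReducingPlane.comm_flip (h : ReducingPlane P.1 Q.1 E) (hne : ¬ Comm P Q) :
    Comm (h.flip hne) P := by
  have hP : Compatible P.1 P.1 := compatible_of_le le_rfl
  exact Comm.symm ((hP.inf h.left.orthogonal).sup (h.left.inf hP.orthogonal))

lemma ReducingPlane.not_comm_flip (h : ReducingPlane P.1 Q.1 E) (hne : ¬ Comm P Q) :
    ¬ Comm (h.flip hne) Q := by
  obtain ⟨z, hz, hz0, hzP⟩ := h.exists_mem_inf_orthogonal hne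
  exact fun hc => h.not_compatible_of_inf hne hz hz0
    (by rw [h.flip_val]; exact mem_sup_right ⟨hz, hzP⟩)
    (fun x hx hxE => Or.inr (h.flip_of_mem hne hx hxE)) hc.symm

lemma ReducingPlane.not_sameCommutant_flip [CompleteSpace H] (hk : GoodDim H k)
    (h : ReducingPlane P.1 Q.1 E) (hne : ¬ Comm P Q) : ¬ SameCommutant Comm (h.flip hne) P := by
  rw [sameCommutant_iff hk]
  rintro (heq | heq)
  · obtain ⟨z, hz, hz0, hzP⟩ := h.exists_mem_inf hne
    rw [← heq] at hzP
    have := h.flip_of_mem hne hzP hz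
    rw [← heq] at this
    exact hz0 (eq_zero_of_mem_of_mem_orthogonal hzP this)
  · have h1 := h.finrank_inf_orthogonal hne
    have h2 : P.1 ⊓ Eᗮ = ⊥ := by
      rw [eq_bot_iff]
      intro x hx
      have hx' : x ∈ (h.flip hne).1 := mem_sup_left hx
      have hxP := hx.1
      rw [heq] at hxP
      exact (mem_bot ℂ).2 (eq_zero_of_mem_of_mem_orthogonal hx' hxP)
    rw [h2, finrank_bot] at h1
    have := hk.two_le
    omega

/-- Among the noncommuting pairs with a reducing plane `E`, those with a unique partner are
neighbours in the Grassmann graph up to orthogonal complement: otherwise `Q`, with its line in `E`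
replaced by the line of `P`, would be a second partner. -/
theorem ReducingPlane.near [CompleteSpace H] (hk : GoodDim H k) (h : ReducingPlane P.1 Q.1 E)
    (hne : ¬ Comm P Q) (hU : UniquePartner Comm P Q) : Near P Q := by
  have hEfin := h.finiteDimensional
  have hPX := h.finrank_inf_orthogonal hne
  have hQX := h.symm.finrank_inf_orthogonal (fun hc => hne hc.symm)
  have hPQ : P ≠ Q := by rintro rfl; exact hne (comm_self P)
  by_cases hXY : P.1 ⊓ Eᗮ = Q.1 ⊓ Eᗮ
  · exact Or.inl (adj_of_le hPX inf_le_left (hXY ▸ inf_le_left) hPQ)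
  obtain ⟨z, hz, hz0, hzP⟩ := h.exists_mem_inf hne
  let T : Gr H k := ⟨(Q.1 ⊓ Eᗮ) ⊔ (E ⊓ P.1), inferInstance, by
    rw [finrank_sup_of_le_orthogonal (inf_le_right.trans (orthogonal_le inf_le_left)),
      (h.finrank_inf hne).1, hQX]⟩
  have hTP : ∀ x ∈ T.1, x ∈ E → x ∈ P.1 := fun x hx hxE =>
    (mem_of_mem_sup_orthogonal inf_le_right inf_le_left hx hxE).2
  have hzT : z ∈ T.1 := mem_sup_right ⟨hz, hzP⟩
  have hT1 : InBicommutant Comm P Q T := fun R hP hQ => by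
    have hE := h.compatible_of_commutant hne hP hQ
    exact (Compatible.inf hQ hE.orthogonal).sup (hE.inf hP)
  have hT2 : Comm T P := Comm.symm
    (h.compatible_inf_orthogonal.sup (h.left.inf (compatible_of_le le_rfl)))
  have hT3 : ¬ Comm T Q := fun hc =>
    h.not_compatible_of_inf hne hz hz0 hzT (fun x hx hxE => Or.inl (hTP x hx hxE)) hc.symm
  have hT4 : ¬ SameCommutant Comm T P := by
    rw [sameCommutant_iff hk]
    rintro (heq | heq)
    · refine hXY (Submodule.eq_of_le_of_finrank_eq ?_ (by omega)).symm
      exact le_inf (heq ▸ le_sup_left) inf_le_right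
    · rw [heq] at hzP
      exact hz0 (eq_zero_of_mem_of_mem_orthogonal hzT hzP)
  have hsame := hU _ _ (h.inBicommutant_flip hne) hT1 (h.comm_flip hne) hT2 (h.not_comm_flip hne)
    hT3 (h.not_sameCommutant_flip hk hne) hT4
  rw [sameCommutant_iff hk] at hsame
  rcases hsame with heq | heq
  · rw [← heq] at hzT
    exact absurd (eq_zero_of_mem_of_mem_orthogonal hzP (h.flip_of_mem hne hzT hz)) hz0
  · obtain ⟨Q', hQ'⟩ := exists_orthogonal (rank_eq_of_orthogonal heq) Q
    refine Or.inr ⟨Q', hQ', adj_of_le hPX inf_le_left ?_ ?_⟩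
    · rw [hQ']
      intro x hx
      have hxT : x ∈ T.1ᗮ := by
        rw [heq, orthogonal_orthogonal]
        exact mem_sup_left hx
      rw [h.right.symm.eq_sup, ← inf_orthogonal, mem_inf]
      exact ⟨orthogonal_le inf_le_right hx.2, orthogonal_le le_sup_left hxT⟩
    · rintro rfl
      exact hne (compatible_of_le_orthogonal (le_orthogonal_iff_le_orthogonal.1 hQ'.le))

end Partners

/-! ### Minimally noncommuting pairs -/

section Separation

open Gr
open scoped InnerProductSpace

variable {H : Type*} [NormedAddCommGroup H] [InnerProductSpace ℂ H] {k : ℕ} {ι : Type*}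
  {b : HilbertBasis ι ℂ H}

/-- If the members of the diagonal family `S` separate the basis vectors, then everything that
commutes with `S` is diagonal. -/
lemma diagonal_of_separating {S : Set (Gr H k)}
    (hS : ∀ A ∈ S, ∀ i, Compatible A.1 (ℂ ∙ b i))
    (hsep : ∀ i j, i ≠ j → ∃ A ∈ S, ¬ (b i ∈ A.1 ↔ b j ∈ A.1)) {T : Submodule ℂ H}
    [T.HasOrthogonalProjection] (hT : ∀ A ∈ S, Compatible T A.1) (l : ι) :
    Compatible T (ℂ ∙ b l) := by
  classical
  have hmem : ∀ A ∈ S, ∀ i, b i ∈ A.1 ∨ b i ∈ A.1ᗮ := fun A hA i =>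
    compatible_span_singleton.1 (hS A hA i)
  have key : ∀ l, (∃ A ∈ S, b l ∈ A.1) → Compatible T (ℂ ∙ b l) := by
    rintro l ⟨A, hA, hl⟩
    obtain ⟨F, hF⟩ := exists_eq_coordSpan (hS A hA)
    have hW : ∀ m, ∃ W : Submodule ℂ H, m ≠ l → Compatible T W ∧ b l ∈ W ∧ b m ∈ Wᗮ := by
      intro m
      by_cases hm : m = l
      · exact ⟨⊤, fun h => absurd hm h⟩
      obtain ⟨B, hB, hlm⟩ := hsep m l hm
      rcases hmem B hB l with hlB | hlB
      · exact ⟨B.1, fun _ => ⟨hT B hB, hlB, (hmem B hB m).resolve_left fun h => hlm (by tauto)⟩⟩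
      · refine ⟨B.1ᗮ, fun _ => ⟨(hT B hB).orthogonal, hlB, ?_⟩⟩
        rw [orthogonal_orthogonal]
        by_contra hmB
        have : b l ∈ B.1 := by tauto
        exact b.orthonormal.ne_zero l (eq_zero_of_mem_of_mem_orthogonal this hlB)
    choose W hW using hW
    have heq : (ℂ ∙ b l) = A.1 ⊓ (F.erase l).inf W := by
      apply le_antisymm
      · rw [span_singleton_le_iff_mem, mem_inf, Submodule.mem_finsetInf]
        exact ⟨hl, fun m hm => (hW m (Finset.mem_erase.1 hm).1).2.1⟩
      · intro x hx
        rw [← coordSpan_singleton, mem_coordSpan]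
        intro m hm
        rw [Finset.mem_singleton] at hm
        by_cases hmF : m ∈ F
        · exact (mem_orthogonal' _ _).1 (hW m hm).2.2 x
            (Submodule.mem_finsetInf.1 hx.2 m (Finset.mem_erase.2 ⟨hm, hmF⟩))
        · exact mem_coordSpan.1 (hF ▸ hx.1) m hmF
    rw [heq]
    exact (hT A hA).inf (Compatible.finset_inf fun m hm => (hW m (Finset.mem_erase.1 hm).1).1)
  by_cases hl : ∃ A ∈ S, b l ∈ A.1
  · exact key l hl
  · rw [← coordSpan_singleton]
    refine compatible_coordSpan_of_compl fun m hm => key m ?_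
    rw [Finset.mem_singleton] at hm
    obtain ⟨A, hA, hlm⟩ := hsep m l hm
    exact ⟨A, hA, by by_contra h; exact hl ⟨A, hA, by tauto⟩⟩

/-- For `l ∉ {i, j}` there are two `k`-element sets of indices, neither of them separating `i` from
`j`, with intersection `{l}`. -/
lemma exists_inter_eq_singleton_of_pair [DecidableEq ι] (b : HilbertBasis ι ℂ H)
    (hk : GoodDim H k) {i j l : ι} (hij : i ≠ j) (hi : l ≠ i) (hj : l ≠ j) :
    ∃ F G : Finset ι, F.card = k ∧ G.card = k ∧ (i ∈ F ↔ j ∈ F) ∧ (i ∈ G ↔ j ∈ G) ∧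
      F ∩ G = {l} := by
  have h2 := hk.two_le
  have hcard : ({l, i, j} : Finset ι).card = 3 := Finset.card_eq_three.2 ⟨l, i, j, hi, hj, hij, rfl⟩
  by_cases hk3 : 3 ≤ k
  · obtain ⟨A, hA, hd⟩ := exists_disjoint_finset_card b {l, i, j} (2 * k - 4) (by
      refine le_trans ?_ hk.two_mul_le
      rw [hcard]
      exact_mod_cast (by omega))
    obtain ⟨B, hBA, hB⟩ := Finset.exists_subset_card_eq (show k - 1 ≤ A.card by omega)
    have hdB : ∀ x ∈ A, x ≠ l ∧ x ≠ i ∧ x ≠ j := fun x hx => by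
      have := Finset.disjoint_right.1 hd hx
      simpa using this
    refine ⟨insert l B, {l, i, j} ∪ (A \ B), ?_, ?_, ?_, ?_, ?_⟩
    · rw [Finset.card_insert_of_notMem fun h => (hdB _ (hBA h)).1 rfl, hB]; omega
    · rw [Finset.card_union_of_disjoint (hd.mono_right Finset.sdiff_subset), hcard,
        Finset.card_sdiff_of_subset hBA]; omega
    · have h1 : i ∉ B := fun h => (hdB _ (hBA h)).2.1 rfl
      have h2 : j ∉ B := fun h => (hdB _ (hBA h)).2.2 rfl
      simp [h1, h2, hi.symm, hj.symm]
    · simp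
    · ext x
      simp only [Finset.mem_inter, Finset.mem_insert, Finset.mem_union, Finset.mem_singleton,
        Finset.mem_sdiff]
      constructor
      · rintro ⟨hx | hx, hx'⟩
        · exact hx
        · have := hdB x (hBA hx)
          tauto
      · rintro rfl
        simp
  · obtain rfl : k = 2 := by omega
    have h5 : ((5 : ℕ) : Cardinal) ≤ Module.rank ℂ H := by
      have hlt : ((4 : ℕ) : Cardinal) < Module.rank ℂ H :=
        lt_of_le_of_ne hk.two_mul_le fun h => by
          have := hk.four_le h.symm
          omega
      have := Order.succ_le_of_lt hlt
      rw [Cardinal.succ_natCast] at this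
      exact_mod_cast this
    obtain ⟨A, hA, hd⟩ := exists_disjoint_finset_card b {l, i, j} 2 (by rwa [hcard])
    obtain ⟨p, q, hpq, rfl⟩ := Finset.card_eq_two.1 hA
    simp only [Finset.disjoint_insert_right, Finset.mem_insert, Finset.mem_singleton,
      Finset.disjoint_singleton_right, not_or] at hd
    obtain ⟨⟨hpl, hpi, hpj⟩, hql, hqi, hqj⟩ := hd
    refine ⟨{l, p}, {l, q}, Finset.card_pair (Ne.symm hpl), Finset.card_pair (Ne.symm hql),
      ?_, ?_, ?_⟩
    · simp [hi.symm, hj.symm, Ne.symm hpi, Ne.symm hpj]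
    · simp [hi.symm, hj.symm, Ne.symm hqi, Ne.symm hqj]
    · ext x
      simp only [Finset.mem_inter, Finset.mem_insert, Finset.mem_singleton]
      constructor
      · rintro ⟨rfl | rfl, h | h⟩ <;> simp_all
      · rintro rfl; simp

lemma compatible_line_of_nonseparating [DecidableEq ι] (hk : GoodDim H k) {i j : ι} (hij : i ≠ j)
    {T : Submodule ℂ H} [T.HasOrthogonalProjection]
    (hT : ∀ F : Finset ι, F.card = k → (i ∈ F ↔ j ∈ F) → Compatible T (coordSpan b F)) {l : ι}
    (hi : l ≠ i) (hj : l ≠ j) : Compatible T (ℂ ∙ b l) := by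
  obtain ⟨F, G, hF, hG, hF', hG', hFG⟩ := exists_inter_eq_singleton_of_pair b hk hij hi hj
  exact (hT F hF hF').line_of_inter (hT G hG hG') hFG

/-- The commuting set `S` witnessing that `P` and `Q` are minimally noncommuting consists of the
coordinate subspaces, in a suitable Hilbert basis, that do not separate two given basis vectors. The
span of these two vectors is a reducing plane. -/
theorem MinimallyNoncommuting.exists_reducingPlane [CompleteSpace H] (hk : GoodDim H k)
    {P Q : Gr H k} (h : MinimallyNoncommuting Comm P Q) :
    ∃ E, ReducingPlane P.1 Q.1 E := by
  classical
  obtain ⟨hPQ, S, hS, hSPQ, hmax⟩ := h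
  obtain ⟨w, b, hb⟩ := exists_diagonal_hilbertBasis (fun A : S => A.1.1)
    fun A B => hS A A.2 B B.2
  replace hb : ∀ A ∈ S, ∀ i, Compatible A.1 (ℂ ∙ b i) := fun A hA => hb ⟨A, hA⟩
  obtain ⟨i, j, hij, hsep⟩ : ∃ i j, i ≠ j ∧ ∀ A ∈ S, (b i ∈ A.1 ↔ b j ∈ A.1) := by
    by_contra! hcon
    have hcon' : ∀ i j, i ≠ j → ∃ A ∈ S, ¬ (b i ∈ A.1 ↔ b j ∈ A.1) := fun i j hij => by
      obtain ⟨A, hA, h⟩ := hcon i j hij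
      exact ⟨A, hA, by tauto⟩
    exact hPQ (compatible_of_forall_line
      (diagonal_of_separating hb hcon' fun A hA => (hSPQ A hA).1.symm)
      (diagonal_of_separating hb hcon' fun A hA => (hSPQ A hA).2.symm))
  have h2 := hk.two_le
  have hfull : ∀ F : Finset w, ∀ hF : F.card = k, (i ∈ F ↔ j ∈ F) → coordGr b F hF ∈ S := by
    intro F hF hFij
    by_contra hR
    -- two noncommuting elements of the commutant of `S ∪ {coordGr b F hF}`
    obtain ⟨G, hG, hd⟩ := exists_disjoint_finset_card b {i, j} (k - 1) (by
      refine le_trans ?_ hk.two_mul_le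
      rw [Finset.card_pair hij]
      exact_mod_cast (by omega))
    simp only [Finset.disjoint_insert_left, Finset.disjoint_singleton_left] at hd
    have hbi : b i ∉ coordSpan b G := fun h => hd.1 (apply_mem_coordSpan.1 h)
    have hbij : b i + b j ∉ coordSpan b G := fun h => by
      have h1 := mem_coordSpan.1 h i hd.1
      rw [inner_add_right, b.orthonormal.2 hij, add_zero, inner_self_eq_zero] at h1
      exact b.orthonormal.ne_zero i h1
    have hk1 : k - 1 + 1 = k := by omega
    let T₁ : Gr H k := ⟨coordSpan b G ⊔ ℂ ∙ b i, inferInstance, by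
      rw [finrank_sup_span_singleton hbi, finrank_coordSpan, hG, hk1]⟩
    let T₂ : Gr H k := ⟨coordSpan b G ⊔ ℂ ∙ (b i + b j), inferInstance, by
      rw [finrank_sup_span_singleton hbij, finrank_coordSpan, hG, hk1]⟩
    have hcomm : ∀ A : Gr H k, (∀ i, Compatible A.1 (ℂ ∙ b i)) → (b i ∈ A.1 ↔ b j ∈ A.1) →
        Comm T₁ A ∧ Comm T₂ A := by
      intro A hA hAij
      refine ⟨Comm.symm ((compatible_coordSpan fun l _ => hA l).sup (hA i)),
        Comm.symm ((compatible_coordSpan fun l _ => hA l).sup ?_)⟩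
      have hi := compatible_span_singleton.1 (hA i)
      have hj := compatible_span_singleton.1 (hA j)
      rw [compatible_span_singleton]
      rcases hi with hi | hi
      · exact Or.inl (add_mem hi (hAij.1 hi))
      · refine Or.inr (add_mem hi (hj.resolve_left fun h => ?_))
        exact b.orthonormal.ne_zero i (eq_zero_of_mem_of_mem_orthogonal (hAij.2 h) hi)
    have hR' := hcomm (coordGr b F hF) (compatible_coordSpan_line F) (by
      simpa only [coordGr, apply_mem_coordSpan] using hFij)
    have hT : Comm T₁ T₂ := hmax _ hR
      (fun A hA => Comm.symm (compatible_of_forall_line (hb A hA) (compatible_coordSpan_line F)))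
      T₁ T₂ (fun A hA => (hcomm A (hb A hA) (hsep A hA)).1)
      (fun A hA => (hcomm A (hb A hA) (hsep A hA)).2) hR'.1 hR'.2
    -- the projection of `b i + b j` to `T₁` is `b i`, which is not in `T₂`
    have h1 : T₁.1.starProjection (b i + b j) = b i := by
      have hi : b i ∈ T₁.1 := mem_sup_right (mem_span_singleton_self _)
      have hj : b j ∈ T₁.1ᗮ := by
        change b j ∈ (coordSpan b G ⊔ ℂ ∙ b i)ᗮ
        rw [← inf_orthogonal, mem_inf]
        exact ⟨apply_mem_coordSpan_orthogonal.2 hd.2,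
          mem_orthogonal_singleton_iff_inner_right.2 (b.orthonormal.2 hij)⟩
      rw [map_add, starProjection_eq_self_iff.2 hi, (starProjection_apply_eq_zero_iff _).2 hj,
        add_zero]
    have h2 : b i ∈ T₂.1 := by
      rw [← h1]
      exact hT _ (mem_sup_right (mem_span_singleton_self _))
    have h3 : T₂.1 ≤ (ℂ ∙ (b i - b j))ᗮ := by
      have hii : ⟪b i, b i⟫_ℂ = 1 := by
        simp [inner_self_eq_norm_sq_to_K, b.orthonormal.1]
      have hjj : ⟪b j, b j⟫_ℂ = 1 := by
        simp [inner_self_eq_norm_sq_to_K, b.orthonormal.1]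
      refine sup_le (span_le.2 ?_) ((span_singleton_le_iff_mem _ _).2 ?_)
      · rintro _ ⟨g, hg, rfl⟩
        have hgi : i ≠ g := by rintro rfl; exact hd.1 hg
        have hgj : j ≠ g := by rintro rfl; exact hd.2 hg
        rw [SetLike.mem_coe, mem_orthogonal_singleton_iff_inner_right, inner_sub_left,
          b.orthonormal.2 hgi, b.orthonormal.2 hgj, sub_zero]
      · rw [mem_orthogonal_singleton_iff_inner_right, inner_sub_left, inner_add_right,
          inner_add_right, b.orthonormal.2 hij, b.orthonormal.2 hij.symm, hii, hjj]
        simp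
    have h4 := mem_orthogonal_singleton_iff_inner_right.1 (h3 h2)
    rw [inner_sub_left, b.orthonormal.2 hij.symm, sub_zero, inner_self_eq_zero] at h4
    exact b.orthonormal.ne_zero i h4
  refine ⟨coordSpan b {i, j}, reducingPlane_of_diagonal_off_pair hij ?_ ?_⟩
  · exact fun l hi hj => compatible_line_of_nonseparating hk hij
      (fun F hF hFij => (hSPQ _ (hfull F hF hFij)).1.symm) hi hj
  · exact fun l hi hj => compatible_line_of_nonseparating hk hij
      (fun F hF hFij => (hSPQ _ (hfull F hF hFij)).2.symm) hi hj

end Separation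

/-! ### Frames of neighbours -/

section Frames

open Gr
open scoped InnerProductSpace

variable {H : Type*} [NormedAddCommGroup H] [InnerProductSpace ℂ H] {k : ℕ} {P Q : Gr H k}
  {u v : H}

/-- Orthogonal vectors `u` and `v` such that `P` is spanned by `P ⊓ Q` and `u`, and `P ⊔ Q` is
spanned by `P` and `v`. -/
structure IsFrame (P Q : Gr H k) (u v : H) : Prop where
  left_ne : u ≠ 0
  right_ne : v ≠ 0
  left_mem : u ∈ (P.1 ⊓ Q.1)ᗮ
  right_mem : v ∈ P.1ᗮ
  eq_sup : P.1 = (P.1 ⊓ Q.1) ⊔ ℂ ∙ u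
  sup_eq : P.1 ⊔ Q.1 = P.1 ⊔ ℂ ∙ v

lemma Gr.Adj.finrank_sup (h : Adj P Q) : finrank ℂ (P.1 ⊔ Q.1 : Submodule ℂ H) = k + 1 := by
  have h1 := finrank_sup_add_finrank_inf_eq P.1 Q.1
  rw [P.2.2, Q.2.2] at h1
  rw [Adj] at h
  omega

lemma Gr.Adj.exists_isFrame (h : Adj P Q) : ∃ u v, IsFrame P Q u v := by
  have h1 := finrank_add_inf_finrank_orthogonal (show P.1 ⊓ Q.1 ≤ P.1 from inf_le_left)
  have h2 := finrank_add_inf_finrank_orthogonal (show P.1 ≤ P.1 ⊔ Q.1 from le_sup_left)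
  have h3 := h
  rw [Adj] at h3
  rw [P.2.2] at h1
  rw [P.2.2, h.finrank_sup] at h2
  obtain ⟨u, hu, hu0, hu'⟩ := exists_eq_span_singleton
    (V := ((P.1 ⊓ Q.1)ᗮ ⊓ P.1 : Submodule ℂ H)) (by omega)
  obtain ⟨v, hv, hv0, hv'⟩ := exists_eq_span_singleton
    (V := (P.1ᗮ ⊓ (P.1 ⊔ Q.1) : Submodule ℂ H)) (by omega)
  refine ⟨u, v, hu0, hv0, hu.1, hv.1, ?_, ?_⟩
  · rw [← hu', sup_orthogonal_inf_of_hasOrthogonalProjection inf_le_left]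
  · rw [← hv', sup_orthogonal_inf_of_hasOrthogonalProjection le_sup_left]

lemma IsFrame.left_mem' (h : IsFrame P Q u v) : u ∈ P.1 := by
  rw [h.eq_sup]
  exact mem_sup_right (mem_span_singleton_self u)

lemma IsFrame.right_mem' (h : IsFrame P Q u v) : v ∈ (P.1 ⊓ Q.1)ᗮ :=
  orthogonal_le inf_le_left h.right_mem

lemma IsFrame.inner_eq (h : IsFrame P Q u v) : ⟪u, v⟫_ℂ = 0 :=
  (mem_orthogonal _ _).1 h.right_mem u h.left_mem'

lemma IsFrame.span_left_eq (h : IsFrame P Q u v) : (ℂ ∙ u) = P.1 ⊓ (P.1 ⊓ Q.1)ᗮ := by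
  refine le_antisymm ((span_singleton_le_iff_mem _ _).2 ⟨h.left_mem', h.left_mem⟩) ?_
  rintro x ⟨hx, hx'⟩
  rw [h.eq_sup] at hx
  obtain ⟨y, hy, z, hz, rfl⟩ := mem_sup.1 hx
  have hz' : z ∈ (P.1 ⊓ Q.1)ᗮ := (span_singleton_le_iff_mem _ _).2 h.left_mem hz
  rw [SetLike.mem_coe, Submodule.add_mem_iff_left _ hz'] at hx'
  rwa [eq_zero_of_mem_of_mem_orthogonal hy hx', zero_add]

lemma IsFrame.span_right_eq (h : IsFrame P Q u v) : (ℂ ∙ v) = (P.1 ⊔ Q.1) ⊓ P.1ᗮ := by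
  have hv : v ∈ P.1 ⊔ Q.1 := by
    rw [h.sup_eq]; exact mem_sup_right (mem_span_singleton_self v)
  refine le_antisymm ((span_singleton_le_iff_mem _ _).2 ⟨hv, h.right_mem⟩) ?_
  rintro x ⟨hx, hx'⟩
  rw [h.sup_eq] at hx
  obtain ⟨y, hy, z, hz, rfl⟩ := mem_sup.1 hx
  have hz' : z ∈ P.1ᗮ := (span_singleton_le_iff_mem _ _).2 h.right_mem hz
  rw [SetLike.mem_coe, Submodule.add_mem_iff_left _ hz'] at hx'
  rwa [eq_zero_of_mem_of_mem_orthogonal hy hx', zero_add]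

/-- The plane spanned by a frame is the orthogonal complement of `P ⊓ Q` in `P ⊔ Q`. -/
lemma IsFrame.mem_plane (h : IsFrame P Q u v) {x : H} (hx : x ∈ P.1 ⊔ Q.1)
    (hx' : x ∈ (P.1 ⊓ Q.1)ᗮ) : x ∈ (ℂ ∙ u) ⊔ ℂ ∙ v := by
  rw [h.sup_eq] at hx
  obtain ⟨p, hp, e, he, rfl⟩ := mem_sup.1 hx
  rw [h.eq_sup] at hp
  obtain ⟨y, hy, d, hd, rfl⟩ := mem_sup.1 hp
  have hd' : d ∈ (P.1 ⊓ Q.1)ᗮ := (span_singleton_le_iff_mem _ _).2 h.left_mem hd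
  have he' : e ∈ (P.1 ⊓ Q.1)ᗮ := (span_singleton_le_iff_mem _ _).2 h.right_mem' he
  have hy' : y ∈ (P.1 ⊓ Q.1)ᗮ := by
    rwa [Submodule.add_mem_iff_left _ he', Submodule.add_mem_iff_left _ hd'] at hx'
  rw [eq_zero_of_mem_of_mem_orthogonal hy hy', zero_add]
  exact add_mem_sup hd he

lemma IsFrame.eq_sup_right (h : IsFrame P Q u v) :
    Q.1 = (P.1 ⊓ Q.1) ⊔ (Q.1 ⊓ ((ℂ ∙ u) ⊔ ℂ ∙ v)) := by
  refine le_antisymm (fun x hx => ?_) (sup_le inf_le_right inf_le_left)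
  obtain ⟨y, hy, z, hz, rfl⟩ := (P.1 ⊓ Q.1).exists_add_mem_mem_orthogonal x
  have hzQ : z ∈ Q.1 := (Submodule.add_mem_iff_right _ hy.2).1 hx
  exact add_mem_sup hy ⟨hzQ, h.mem_plane (mem_sup_right hzQ) hz⟩

lemma IsFrame.compatible_right (h : IsFrame P Q u v) {A : Submodule ℂ H}
    [A.HasOrthogonalProjection] (hA : Compatible A (P.1 ⊓ Q.1))
    (hE : (ℂ ∙ u) ⊔ (ℂ ∙ v) ≤ A ∨ (ℂ ∙ u) ⊔ (ℂ ∙ v) ≤ Aᗮ) : Compatible A Q.1 := by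
  rw [h.eq_sup_right]
  refine hA.sup ?_
  rcases hE with hE | hE
  · exact compatible_of_ge (inf_le_right.trans hE)
  · exact compatible_of_le_orthogonal (inf_le_right.trans hE)

/-- A Hilbert basis diagonalizing `P ⊓ Q`, the frame, and one more line. -/
lemma IsFrame.exists_hilbertBasis [CompleteSpace H] (h : IsFrame P Q u v) {x : H}
    (hx : Compatible (P.1 ⊓ Q.1) (ℂ ∙ x)) (hux : Compatible (ℂ ∙ u) (ℂ ∙ x))
    (hvx : Compatible (ℂ ∙ v) (ℂ ∙ x)) :
    ∃ (w : Set H) (b : HilbertBasis w ℂ H) (i j : w), i ≠ j ∧ (ℂ ∙ u) = ℂ ∙ b i ∧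
      (ℂ ∙ v) = ℂ ∙ b j ∧ (∀ l, Compatible (P.1 ⊓ Q.1) (ℂ ∙ b l)) ∧
      ∀ l, Compatible (ℂ ∙ x) (ℂ ∙ b l) := by
  obtain ⟨w, b, hb⟩ := exists_diagonal_hilbertBasis_of_four (P.1 ⊓ Q.1) (ℂ ∙ u) (ℂ ∙ v) (ℂ ∙ x)
    (compatible_span_singleton.2 (Or.inr h.left_mem))
    (compatible_span_singleton.2 (Or.inr h.right_mem')) hx
    (compatible_span_singleton.2
      (Or.inr (mem_orthogonal_singleton_iff_inner_right.2 h.inner_eq))) hux hvx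
  obtain ⟨i, hi⟩ := exists_line_eq h.left_ne fun l => (hb l).2.1
  obtain ⟨j, hj⟩ := exists_line_eq h.right_ne fun l => (hb l).2.2.1
  refine ⟨w, b, i, j, ?_, hi, hj, fun l => (hb l).1, fun l => (hb l).2.2.2⟩
  rintro rfl
  have h1 : u ∈ ℂ ∙ v := by rw [hj, ← hi]; exact mem_span_singleton_self u
  obtain ⟨c, rfl⟩ := mem_span_singleton.1 h1
  have h2 := h.inner_eq
  rw [inner_smul_left, mul_eq_zero, inner_self_eq_zero] at h2
  rcases h2 with h2 | h2
  · exact h.left_ne (by rw [(map_eq_zero _).1 h2, zero_smul])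
  · exact h.right_ne h2

lemma IsFrame.compatible_nonseparating {ι : Type*} {b : HilbertBasis ι ℂ H} {i j : ι}
    (h : IsFrame P Q u v) (hi : (ℂ ∙ u) = ℂ ∙ b i) (hj : (ℂ ∙ v) = ℂ ∙ b j)
    (hX : ∀ l, Compatible (P.1 ⊓ Q.1) (ℂ ∙ b l)) (F : Finset ι) (hF : i ∈ F ↔ j ∈ F) :
    Compatible (coordSpan b F) P.1 ∧ Compatible (coordSpan b F) Q.1 := by
  have hFX : Compatible (coordSpan b F) (P.1 ⊓ Q.1) :=
    compatible_of_forall_line (compatible_coordSpan_line F) hX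
  constructor
  · rw [h.eq_sup, hi]
    exact hFX.sup (compatible_coordSpan_line F i)
  · refine h.compatible_right hFX ?_
    rw [hi, hj]
    simp only [sup_le_iff, span_singleton_le_iff_mem, apply_mem_coordSpan,
      apply_mem_coordSpan_orthogonal]
    tauto

/-- For noncommuting neighbours, the coordinate subspaces that do not separate the two vectors of a
frame form a commuting set with minimal noncommutative commutant. -/
theorem Gr.Adj.minimallyNoncommuting [CompleteSpace H] (hk : GoodDim H k) (h : Adj P Q)
    (hne : ¬ Comm P Q) : MinimallyNoncommuting Comm P Q := by
  classical
  obtain ⟨u, v, hf⟩ := h.exists_isFrame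
  obtain ⟨w, b, i, j, hij, hi, hj, hX, -⟩ := hf.exists_hilbertBasis (x := 0)
    (by rw [span_zero_singleton]; exact compatible_bot)
    (by rw [span_zero_singleton]; exact compatible_bot)
    (by rw [span_zero_singleton]; exact compatible_bot)
  refine ⟨hne, {A | ∃ (F : Finset w) (hF : F.card = k), (i ∈ F ↔ j ∈ F) ∧ A = coordGr b F hF},
    ?_, ?_, ?_⟩
  · rintro _ ⟨F, hF, -, rfl⟩ _ ⟨G, hG, -, rfl⟩
    exact compatible_coordSpan_coordSpan F G
  · rintro _ ⟨F, hF, hFij, rfl⟩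
    exact hf.compatible_nonseparating hi hj hX F hFij
  · intro R hR hRS T₁ T₂ hT₁ hT₂ hT₁R hT₂R
    have hline : ∀ T : Gr H k, (∀ A ∈ {A | ∃ (F : Finset w) (hF : F.card = k), (i ∈ F ↔ j ∈ F) ∧
        A = coordGr b F hF}, Comm T A) → ∀ l, l ≠ i → l ≠ j → Compatible T.1 (ℂ ∙ b l) :=
      fun T hT l hli hlj => compatible_line_of_nonseparating hk hij
        (fun F hF hFij => hT _ ⟨F, hF, hFij, rfl⟩) hli hlj
    set E := coordSpan b {i, j} with hE
    have hRE : Compatible R.1 E := (reducingPlane_of_diagonal_off_pair hij (hline R hRS)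
      (hline R hRS)).left
    have hiE : b i ∈ E := apply_mem_coordSpan.2 (by simp)
    have hjE : b j ∈ E := apply_mem_coordSpan.2 (by simp)
    -- otherwise `R` is a nonseparating coordinate subspace
    have hproper : ¬ (E ≤ R.1 ∨ E ≤ R.1ᗮ) := by
      intro hER
      have hdiag : ∀ l, Compatible R.1 (ℂ ∙ b l) := by
        intro l
        by_cases hl : l = i ∨ l = j
        · have hlE : b l ∈ E := by rcases hl with rfl | rfl <;> assumption
          rw [compatible_span_singleton]
          exact hER.imp (fun h => h hlE) (fun h => h hlE)
        · rw [not_or] at hl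
          exact hline R hRS l hl.1 hl.2
      obtain ⟨F, hF⟩ := exists_eq_coordSpan hdiag
      have hFk : F.card = k := by
        rw [← finrank_coordSpan (b := b), ← hF, R.2.2]
      refine hR ⟨F, hFk, ?_, Subtype.ext hF⟩
      rw [hF] at hER
      rcases hER with hER | hER
      · exact iff_of_true (apply_mem_coordSpan.1 (hER hiE)) (apply_mem_coordSpan.1 (hER hjE))
      · exact iff_of_false (apply_mem_coordSpan_orthogonal.1 (hER hiE))
          (apply_mem_coordSpan_orthogonal.1 (hER hjE))
    have hdim := finrank_inf_add_finrank_inf_orthogonal hRE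
    have hE2 : finrank ℂ E = 2 := by rw [hE, finrank_coordSpan, Finset.card_pair hij]
    have h0 : finrank ℂ (E ⊓ R.1 : Submodule ℂ H) ≠ 0 := fun h0 => by
      rw [finrank_eq_zero] at h0
      have h1 := hRE.eq_sup
      rw [h0, bot_sup_eq] at h1
      exact hproper (Or.inr (h1.le.trans inf_le_right))
    have h0' : finrank ℂ (E ⊓ R.1ᗮ : Submodule ℂ H) ≠ 0 := fun h0 => by
      rw [finrank_eq_zero] at h0
      have h1 := hRE.eq_sup
      rw [h0, sup_bot_eq] at h1
      exact hproper (Or.inl (h1.le.trans inf_le_right))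
    obtain ⟨z, hz, hz0, hzE⟩ := exists_eq_span_singleton (V := E ⊓ R.1) (by omega)
    have hred := reducingPlane_of_diagonal_off_pair hij (hline T₁ hT₁) (hline T₂ hT₂)
    exact hred.compatible_of_line hz.1 hz0 (hzE ▸ hred.left.inf hT₁R) (hzE ▸ hred.right.inf hT₂R)

/-- The partner of `P` in the frame: the line of `u` is replaced by the line of `v`. -/
noncomputable def IsFrame.partner (h : IsFrame P Q u v) : Gr H k :=
  ⟨(P.1 ⊓ Q.1) ⊔ ℂ ∙ v, inferInstance, by
    have h1 := finrank_sup_span_singleton (notMem_of_mem_orthogonal h.right_mem' h.right_ne)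
    have h2 := finrank_sup_span_singleton (notMem_of_mem_orthogonal h.left_mem h.left_ne)
    rw [h1, ← h2, ← h.eq_sup, P.2.2]⟩

lemma IsFrame.adj_partner (h : IsFrame P Q u v) (hPQ : Adj P Q) : Adj P h.partner := by
  refine adj_of_le hPQ inf_le_left le_sup_left fun heq => ?_
  have hv : v ∈ P.1 := by
    rw [heq]
    exact mem_sup_right (mem_span_singleton_self v)
  exact notMem_of_mem_orthogonal h.right_mem h.right_ne hv

/-- The partner is, up to orthogonal complement, the only element other than `P` of the double
commutant of `{P, Q}` that commutes with `P` but not with `Q`. -/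
theorem IsFrame.sameCommutant_partner [CompleteSpace H] (hk : GoodDim H k) (h : IsFrame P Q u v)
    (hPQ : Adj P Q) {T : Gr H k} (hT : InBicommutant Comm P Q T) (hTP : Comm T P)
    (hTQ : ¬ Comm T Q) (hTP' : ¬ SameCommutant Comm T P) :
    SameCommutant Comm T h.partner := by
  classical
  rw [sameCommutant_iff hk] at hTP' ⊢
  -- `T` commutes with every line of `P ⊓ Q` and with every line orthogonal to `P ⊔ Q`
  have hline : ∀ x, (x ∈ P.1 ⊓ Q.1 ∨ x ∈ (P.1 ⊔ Q.1)ᗮ) → Compatible T.1 (ℂ ∙ x) := by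
    intro x hx
    by_cases hx0 : x = 0
    · rw [hx0, span_zero_singleton]; exact compatible_bot
    have hux : ⟪u, x⟫_ℂ = 0 := by
      rcases hx with hx | hx
      · exact (mem_orthogonal' _ _).1 h.left_mem x hx
      · exact (mem_orthogonal _ _).1 hx u (mem_sup_left h.left_mem')
    have hvx : ⟪v, x⟫_ℂ = 0 := by
      rcases hx with hx | hx
      · exact (mem_orthogonal' _ _).1 h.right_mem' x hx
      · refine (mem_orthogonal _ _).1 hx v ?_
        rw [h.sup_eq]
        exact mem_sup_right (mem_span_singleton_self v)
    obtain ⟨w, b, i, j, hij, hi, hj, hX, hxb⟩ := h.exists_hilbertBasis (x := x)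
      (compatible_span_singleton.2
        (hx.imp id fun hx => orthogonal_le (inf_le_left.trans le_sup_left) hx))
      (compatible_span_singleton.2
        (Or.inr (mem_orthogonal_singleton_iff_inner_right.2 hux)))
      (compatible_span_singleton.2
        (Or.inr (mem_orthogonal_singleton_iff_inner_right.2 hvx)))
    obtain ⟨l, hl⟩ := exists_line_eq hx0 hxb
    have hne : ∀ {y : H} {m : w}, y ≠ 0 → ⟪y, x⟫_ℂ = 0 → (ℂ ∙ y) = ℂ ∙ b m → l ≠ m := by
      rintro y m hy hyx hym rfl
      have hxy : x ∈ ℂ ∙ y := by rw [hym, ← hl]; exact mem_span_singleton_self x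
      exact hx0 (eq_zero_of_mem_of_mem_orthogonal hxy
        (mem_orthogonal_singleton_iff_inner_right.2 hyx))
    rw [hl]
    refine compatible_line_of_nonseparating hk hij (fun F hF hFij => ?_)
      (hne h.left_ne hux hi) (hne h.right_ne hvx hj)
    have := h.compatible_nonseparating hi hj hX F hFij
    exact (hT (coordGr b F hF) this.1 this.2).symm
  have hX := le_or_le_orthogonal_of_forall_line fun x hx => hline x (Or.inl hx)
  have hD := le_or_le_orthogonal_of_forall_line fun x hx => hline x (Or.inr hx)
  have hTX : Compatible T.1 (P.1 ⊓ Q.1) := hX.elim compatible_of_ge compatible_of_le_orthogonal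
  have hTD : Compatible T.1 (P.1 ⊔ Q.1) := by
    have : Compatible T.1 (P.1 ⊔ Q.1)ᗮ := hD.elim compatible_of_ge compatible_of_le_orthogonal
    simpa using this.orthogonal
  have hTu : u ∈ T.1 ∨ u ∈ T.1ᗮ := by
    rw [← compatible_span_singleton]
    rw [h.span_left_eq]
    exact Compatible.inf hTP hTX.orthogonal
  have hTv : v ∈ T.1 ∨ v ∈ T.1ᗮ := by
    rw [← compatible_span_singleton]
    rw [h.span_right_eq]
    exact hTD.inf (Compatible.orthogonal hTP)
  have hvsup : v ∈ P.1 ⊔ Q.1 := by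
    rw [h.sup_eq]; exact mem_sup_right (mem_span_singleton_self v)
  -- `u` and `v` are separated by `T`, since `T` does not commute with `Q`
  have hsplit : (u ∈ T.1 ∧ v ∈ T.1ᗮ) ∨ (v ∈ T.1 ∧ u ∈ T.1ᗮ) := by
    rcases hTu with hu | hu <;> rcases hTv with hv | hv
    · refine absurd (h.compatible_right hTX (Or.inl ?_)) hTQ
      simp only [sup_le_iff, span_singleton_le_iff_mem]
      exact ⟨hu, hv⟩
    · exact Or.inl ⟨hu, hv⟩
    · exact Or.inr ⟨hv, hu⟩
    · refine absurd (h.compatible_right hTX (Or.inr ?_)) hTQ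
      simp only [sup_le_iff, span_singleton_le_iff_mem]
      exact ⟨hu, hv⟩
  have hpart : h.partner.1 = (P.1 ⊓ Q.1) ⊔ ℂ ∙ v := rfl
  rcases hX with hX | hX
  · rcases hsplit with ⟨hu, -⟩ | ⟨hv, -⟩
    · refine absurd (Or.inl (Gr.eq_of_le ?_).symm) hTP'
      rw [h.eq_sup]
      exact sup_le hX ((span_singleton_le_iff_mem _ _).2 hu)
    · refine Or.inl (Gr.eq_of_le ?_).symm
      rw [hpart]
      exact sup_le hX ((span_singleton_le_iff_mem _ _).2 hv)
  · rcases hD with hD | hD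
    · have hle : T.1ᗮ ≤ P.1 ⊔ Q.1 := by
        rw [← orthogonal_orthogonal (P.1 ⊔ Q.1)]
        exact orthogonal_le hD
      have hfin : FiniteDimensional ℂ T.1ᗮ := finiteDimensional_of_le hle
      -- `T.1ᗮ` is a proper subspace of `P ⊔ Q`, so its dimension is at most `k`
      have hfr : ∀ y ∈ P.1 ⊔ Q.1, y ≠ 0 → y ∈ T.1 → finrank ℂ T.1ᗮ ≤ k := by
        intro y hy hy0 hyT
        have hlt : T.1ᗮ < P.1 ⊔ Q.1 := lt_of_le_of_ne hle fun heq =>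
          hy0 (eq_zero_of_mem_of_mem_orthogonal hyT (heq ▸ hy))
        have := finrank_lt_finrank_of_lt hlt
        rw [hPQ.finrank_sup] at this
        omega
      rcases hsplit with ⟨hu, hv⟩ | ⟨hv, hu⟩
      · refine Or.inr (Submodule.eq_of_le_of_finrank_le ?_ ?_)
        · rw [hpart]
          exact sup_le hX ((span_singleton_le_iff_mem _ _).2 hv)
        · rw [h.partner.2.2]
          exact hfr u (mem_sup_left h.left_mem') h.left_ne hu
      · refine absurd (Or.inr (Submodule.eq_of_le_of_finrank_le ?_ ?_)) hTP'
        · rw [h.eq_sup]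
          exact sup_le hX ((span_singleton_le_iff_mem _ _).2 hu)
        · rw [P.2.2]
          exact hfr v hvsup h.right_ne hv
    · -- here `T` would be contained in the plane of the frame, hence equal to it
      exfalso
      have hle : T.1 ≤ (ℂ ∙ u) ⊔ ℂ ∙ v := by
        intro x hx
        refine h.mem_plane ?_ ?_
        · rw [← orthogonal_orthogonal (P.1 ⊔ Q.1)]
          exact (le_orthogonal_iff_le_orthogonal.1 hD) hx
        · exact (le_orthogonal_iff_le_orthogonal.1 hX) hx
      have hfr : finrank ℂ ((ℂ ∙ u) ⊔ (ℂ ∙ v) : Submodule ℂ H) ≤ finrank ℂ T.1 := by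
        have h1 := Submodule.finrank_add_le_finrank_add_finrank (ℂ ∙ u) (ℂ ∙ v)
        rw [finrank_span_singleton h.left_ne, finrank_span_singleton h.right_ne] at h1
        rw [T.2.2]
        exact h1.trans hk.two_le
      have heq := Submodule.eq_of_le_of_finrank_le hle hfr
      have hu' : u ∈ T.1 := by
        rw [heq]; exact mem_sup_left (mem_span_singleton_self u)
      have hv' : v ∈ T.1 := by
        rw [heq]; exact mem_sup_right (mem_span_singleton_self v)
      rcases hsplit with ⟨-, hv⟩ | ⟨-, hu⟩
      · exact h.right_ne (eq_zero_of_mem_of_mem_orthogonal hv' hv)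
      · exact h.left_ne (eq_zero_of_mem_of_mem_orthogonal hu' hu)

end Frames

/-! ### The commutativity relation determines near-adjacency -/

section Neighbours

open Gr

variable {H : Type*} [NormedAddCommGroup H] [InnerProductSpace ℂ H] {k : ℕ} {P Q : Gr H k}
  {u v : H}

lemma IsFrame.eq_partner (h : IsFrame P Q u v) (hc : Comm P Q) : Q = h.partner := by
  refine Gr.eq_of_le ?_
  rw [Compatible.eq_sup hc]
  refine sup_le (by rw [inf_comm]; exact le_sup_left) ?_
  refine le_trans (inf_le_inf_right _ le_sup_right) (h.span_right_eq.ge.trans ?_)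
  exact le_sup_right

theorem Gr.Adj.noncommutingNeighbours [CompleteSpace H] (hk : GoodDim H k) (h : Adj P Q)
    (hne : ¬ Comm P Q) : NoncommutingNeighbours Comm P Q := by
  obtain ⟨u, v, hf⟩ := h.exists_isFrame
  refine ⟨h.minimallyNoncommuting hk hne, fun T₁ T₂ h1 h2 h3 h4 h5 h6 h7 h8 R => ?_⟩
  rw [hf.sameCommutant_partner hk h h1 h3 h5 h7 R, hf.sameCommutant_partner hk h h2 h4 h6 h8 R]

/-- A commuting neighbour `Q` of `P` is the partner of `P` for a noncommuting neighbour `R`, which is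
obtained by rotating the line of `Q` towards that of `P`. -/
theorem Gr.Adj.commutingNeighbours [CompleteSpace H] (hk : GoodDim H k) (h : Adj P Q)
    (hc : Comm P Q) : CommutingNeighbours Comm P Q := by
  obtain ⟨u, v, hf⟩ := h.exists_isFrame
  have huv : u + v ∈ (P.1 ⊓ Q.1)ᗮ := add_mem hf.left_mem hf.right_mem'
  have huv0 : u + v ≠ 0 := fun h0 => by
    have h1 : v ∈ P.1 := by
      rw [← neg_eq_of_add_eq_zero_right h0]
      exact neg_mem hf.left_mem'
    exact notMem_of_mem_orthogonal hf.right_mem hf.right_ne h1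
  have hX : finrank ℂ (P.1 ⊓ Q.1 : Submodule ℂ H) + 1 = k := h
  let R : Gr H k := ⟨(P.1 ⊓ Q.1) ⊔ ℂ ∙ (u + v), inferInstance, by
    rw [finrank_sup_span_singleton (notMem_of_mem_orthogonal huv huv0), hX]⟩
  have huvR : u + v ∈ R.1 := mem_sup_right (mem_span_singleton_self _)
  have hPR : Adj P R := by
    refine adj_of_le hX inf_le_left le_sup_left fun heq => ?_
    rw [← heq] at huvR
    exact notMem_of_mem_orthogonal hf.right_mem hf.right_ne
      ((Submodule.add_mem_iff_right _ hf.left_mem').1 huvR)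
  have hinf : P.1 ⊓ R.1 = P.1 ⊓ Q.1 := by
    refine (Submodule.eq_of_le_of_finrank_eq (le_inf inf_le_left le_sup_left) ?_).symm
    exact Nat.add_right_cancel (hX.trans (Eq.symm hPR))
  have hf' : IsFrame P R u v := by
    refine ⟨hf.left_ne, hf.right_ne, hinf ▸ hf.left_mem, hf.right_mem, hinf ▸ hf.eq_sup, ?_⟩
    have hu := hf.left_mem'
    refine le_antisymm (sup_le le_sup_left (sup_le (inf_le_left.trans le_sup_left) ?_))
      (sup_le le_sup_left ?_)
    · rw [span_singleton_le_iff_mem]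
      exact add_mem (mem_sup_left hu) (mem_sup_right (mem_span_singleton_self v))
    · rw [span_singleton_le_iff_mem, ← add_sub_cancel_left u v]
      exact sub_mem (mem_sup_right huvR) (mem_sup_left hu)
  have hQ : Q = hf'.partner := by
    rw [hf.eq_partner hc]
    exact Subtype.ext (congrArg (· ⊔ ℂ ∙ v) hinf.symm)
  have hne : ¬ Comm P R := by
    intro hPRc
    have h1 : u + v ∈ Q.1 := by
      rw [hQ, ← hf'.eq_partner hPRc]
      exact huvR
    have h2 : v ∈ Q.1 := by
      rw [hf.eq_partner hc]
      exact mem_sup_right (mem_span_singleton_self v)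
    have h3 : u ∈ Q.1 := (Submodule.add_mem_iff_left _ h2).1 h1
    exact notMem_of_mem_orthogonal hf.left_mem hf.left_ne ⟨hf.left_mem', h3⟩
  have hNN := hPR.noncommutingNeighbours hk hne
  obtain ⟨E, hE⟩ := hNN.1.exists_reducingPlane hk
  have hsame : SameCommutant Comm (hE.flip hne) Q := by
    rw [hQ]
    exact hf'.sameCommutant_partner hk hPR (hE.inBicommutant_flip hne) (hE.comm_flip hne)
      (hE.not_comm_flip hne) (hE.not_sameCommutant_flip hk hne)
  refine ⟨hc, ?_, R, hNN, fun A hAP hAR => (hsame A).1 (hE.inBicommutant_flip hne A hAP hAR),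
    fun hRQ => hE.not_comm_flip hne ((hsame R).2 hRQ).symm⟩
  rw [sameCommutant_iff hk]
  rintro (heq | heq)
  · exact h.ne heq
  · have h0 : P.1 ⊓ Q.1 = ⊥ := by rw [heq]; exact inf_orthogonal_eq_bot _
    rw [h0, finrank_bot] at hX
    have := hk.two_le
    omega

lemma near_of_inBicommutant [CompleteSpace H] (hk : GoodDim H k) {R : Gr H k} (h : Adj P R)
    (hQ : InBicommutant Comm P R Q) (hQP : Comm Q P) (hQR : ¬ Comm Q R)
    (hQP' : ¬ SameCommutant Comm Q P) : Near P Q := by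
  obtain ⟨u, v, hf⟩ := h.exists_isFrame
  have := hf.sameCommutant_partner hk h hQ hQP hQR hQP'
  rw [sameCommutant_iff hk] at this
  rcases this with rfl | heq
  · exact Or.inl (hf.adj_partner h)
  · exact Or.inr ⟨_, heq, hf.adj_partner h⟩

/-- Being neighbours in the Grassmann graph, up to orthogonal complement, is expressible through
commutativity. -/
theorem near_iff [CompleteSpace H] (hk : GoodDim H k) :
    Near P Q ↔ NoncommutingNeighbours Comm P Q ∨ CommutingNeighbours Comm P Q := by
  have hadj : ∀ {P Q : Gr H k}, Adj P Q →
      NoncommutingNeighbours Comm P Q ∨ CommutingNeighbours Comm P Q := by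
    intro P Q h
    by_cases hc : Comm P Q
    · exact Or.inr (h.commutingNeighbours hk hc)
    · exact Or.inl (h.noncommutingNeighbours hk hc)
  have hnear : ∀ {P Q : Gr H k}, NoncommutingNeighbours Comm P Q → Near P Q := by
    intro P Q h
    obtain ⟨E, hE⟩ := h.1.exists_reducingPlane hk
    exact hE.near hk h.1.1 h.2
  constructor
  · rintro (h | ⟨Q', hQ', h⟩)
    · exact hadj h
    · have hs := comm_iff_of_eq_orthogonal hQ'
      refine (hadj h).imp ?_ ?_
      · simp only [NoncommutingNeighbours, MinimallyNoncommuting, UniquePartner, InBicommutant,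
          ← hs, imp_self]
      · simp only [CommutingNeighbours, InBicommutant, SameCommutant, ← hs, imp_self]
  · rintro (h | ⟨hPQ, hns, R, hR, hbi, hRQ⟩)
    · exact hnear h
    · have hns' : ¬ SameCommutant Comm Q P := fun hs => hns fun A => (hs A).symm
      rcases hnear hR with h | ⟨R', hR', h⟩
      · exact near_of_inBicommutant hk h hbi hPQ.symm (fun h => hRQ h.symm) hns'
      · have hs := comm_iff_of_eq_orthogonal hR'
        refine near_of_inBicommutant hk h (fun A hAP hAR => hbi A hAP ((hs A).2 hAR)) hPQ.symm
          (fun h => hRQ ((hs Q).2 h).symm) hns'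

theorem near_map [CompleteSpace H] (hk : GoodDim H k)
    (e : (Comm : Gr H k → Gr H k → Prop) ≃r (Comm : Gr H k → Gr H k → Prop)) (h : Near P Q) :
    Near (e P) (e Q) := by
  rw [near_iff hk] at h ⊢
  exact h.imp (fun h => h.map e) fun h => h.map e

/-- A bijection preserving commutativity preserves orthogonal complements. -/
lemma map_orthogonal [CompleteSpace H] (hk : GoodDim H k)
    (e : (Comm : Gr H k → Gr H k → Prop) ≃r (Comm : Gr H k → Gr H k → Prop))
    (h : Q.1 = P.1ᗮ) : (e Q).1 = (e P).1ᗮ := by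
  have hs : SameCommutant Comm (e P) (e Q) :=
    SameCommutant.map e ((sameCommutant_iff hk).2 (Or.inr h))
  refine ((sameCommutant_iff hk).1 hs).resolve_left fun heq => ?_
  rw [← e.injective heq] at h
  have h1 := inf_orthogonal_eq_bot P.1
  rw [← h, inf_idem] at h1
  have h2 := P.2.2
  rw [h1, finrank_bot] at h2
  have := hk.two_le
  omega

end Neighbours

/-! ### Stars and tops -/

section Cliques

open Gr

variable {H : Type*} [NormedAddCommGroup H] [InnerProductSpace ℂ H] {m : ℕ}

lemma exists_gr_le_orthogonal (V : Submodule ℂ H) [FiniteDimensional ℂ V] (j : ℕ)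
    (h : ((finrank ℂ V + j : ℕ) : Cardinal) ≤ Module.rank ℂ H) : ∃ R : Gr H j, R.1 ≤ Vᗮ := by
  induction j with
  | zero => exact ⟨⟨⊥, inferInstance, finrank_bot ℂ H⟩, bot_le⟩
  | succ j ih =>
    obtain ⟨R, hR⟩ := ih (le_trans (by exact_mod_cast Nat.le_succ _) h)
    obtain ⟨u, hu, hu0⟩ := exists_ne_zero_mem_orthogonal (V ⊔ R.1) (by
      refine lt_of_lt_of_le ?_ h
      have := Submodule.finrank_add_le_finrank_add_finrank V R.1
      rw [R.2.2] at this
      exact_mod_cast (by omega))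
    rw [← inf_orthogonal, mem_inf] at hu
    exact ⟨R.cons u (notMem_of_mem_orthogonal hu.2 hu0),
      sup_le hR ((span_singleton_le_iff_mem _ _).2 hu.1)⟩

lemma le_cons (X : Gr H m) {x : H} (hx : x ∉ X.1) : X.1 ≤ (X.cons x hx).1 := le_sup_left

lemma mem_cons (X : Gr H m) {x : H} (hx : x ∉ X.1) : x ∈ (X.cons x hx).1 :=
  mem_sup_right (mem_span_singleton_self x)

lemma adj_of_common {X : Gr H m} {P Q : Gr H (m + 1)} (hP : X.1 ≤ P.1) (hQ : X.1 ≤ Q.1)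
    (hne : P ≠ Q) : Adj P Q :=
  adj_of_le (by rw [X.2.2]) hP hQ hne

lemma Gr.Adj.finrank_inf {P Q : Gr H (m + 1)} (h : Adj P Q) :
    finrank ℂ (P.1 ⊓ Q.1 : Submodule ℂ H) = m := by
  rw [Adj] at h
  omega

lemma inf_eq_of_common {X : Gr H m} {P Q : Gr H (m + 1)} (hP : X.1 ≤ P.1) (hQ : X.1 ≤ Q.1)
    (hne : P ≠ Q) : P.1 ⊓ Q.1 = X.1 :=
  (Submodule.eq_of_le_of_finrank_eq (le_inf hP hQ)
    (by rw [X.2.2, (adj_of_common hP hQ hne).finrank_inf])).symm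

/-- Two distinct neighbours with a given common `m`-dimensional subspace. -/
lemma exists_pair_above (X : Gr H m) (h : ((m + 2 : ℕ) : Cardinal) ≤ Module.rank ℂ H) :
    ∃ P Q : Gr H (m + 1), X.1 ≤ P.1 ∧ X.1 ≤ Q.1 ∧ P ≠ Q := by
  obtain ⟨u, hu, hu0⟩ := exists_ne_zero_mem_orthogonal X.1 (by
    refine lt_of_lt_of_le ?_ h
    rw [X.2.2]
    exact_mod_cast (by omega))
  have hu' := notMem_of_mem_orthogonal hu hu0
  obtain ⟨v, hv, hv0⟩ := exists_ne_zero_mem_orthogonal (X.cons u hu').1 (by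
    refine lt_of_lt_of_le ?_ h
    rw [(X.cons u hu').2.2]
    exact_mod_cast (by omega))
  have hv' : v ∉ X.1 := fun h => notMem_of_mem_orthogonal hv hv0 (le_cons X hu' h)
  refine ⟨X.cons u hu', X.cons v hv', le_cons _ _, le_cons _ _, fun heq => ?_⟩
  exact notMem_of_mem_orthogonal hv hv0 (heq ▸ mem_cons X hv')

/-- A clique of the Grassmann graph is contained in a star or in a top. -/
lemma star_or_top {S : Set (Gr H (m + 1))} (hS : ∀ A ∈ S, ∀ B ∈ S, A ≠ B → Adj A B)
    {P Q : Gr H (m + 1)} (hP : P ∈ S) (hQ : Q ∈ S) (hPQ : P ≠ Q) :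
    (∀ A ∈ S, P.1 ⊓ Q.1 ≤ A.1) ∨ ∀ A ∈ S, A.1 ≤ P.1 ⊔ Q.1 := by
  have hX := (hS P hP Q hQ hPQ).finrank_inf
  have hone : ∀ A ∈ S, P.1 ⊓ Q.1 ≤ A.1 ∨ A.1 ≤ P.1 ⊔ Q.1 := by
    intro A hA
    by_cases hAP : A = P
    · exact Or.inl (hAP ▸ inf_le_left)
    by_cases hAQ : A = Q
    · exact Or.inl (hAQ ▸ inf_le_right)
    have h1 := (hS A hA P hP hAP).finrank_inf
    have h2 := (hS A hA Q hQ hAQ).finrank_inf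
    by_cases heq : A.1 ⊓ P.1 = A.1 ⊓ Q.1
    · left
      have hle : A.1 ⊓ P.1 ≤ P.1 ⊓ Q.1 := le_inf inf_le_right (heq.le.trans inf_le_right)
      rw [← Submodule.eq_of_le_of_finrank_eq hle (h1.trans hX.symm)]
      exact inf_le_left
    · right
      have hlt : A.1 ⊓ P.1 < (A.1 ⊓ P.1) ⊔ (A.1 ⊓ Q.1) := by
        refine lt_of_le_of_ne le_sup_left fun h => heq ?_
        exact (Submodule.eq_of_le_of_finrank_eq (sup_eq_left.1 h.symm) (h2.trans h1.symm)).symm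
      have hfr := finrank_lt_finrank_of_lt hlt
      have hA' : (A.1 ⊓ P.1) ⊔ (A.1 ⊓ Q.1) = A.1 :=
        Submodule.eq_of_le_of_finrank_le (sup_le inf_le_left inf_le_left) (by
          rw [A.2.2]; omega)
      rw [← hA']
      exact sup_le_sup inf_le_right inf_le_right
  by_contra! hcon
  obtain ⟨⟨A, hA, hAX⟩, ⟨B, hB, hBZ⟩⟩ := hcon
  have hAZ := (hone A hA).resolve_left hAX
  have hBX := (hone B hB).resolve_right hBZ
  have hAB := (hS A hA B hB (by rintro rfl; exact hBZ hAZ)).finrank_inf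
  have hBZ' : P.1 ⊓ Q.1 = B.1 ⊓ (P.1 ⊔ Q.1) := by
    refine Submodule.eq_of_le_of_finrank_le (le_inf hBX (inf_le_left.trans le_sup_left)) ?_
    have hlt : B.1 ⊓ (P.1 ⊔ Q.1) < B.1 := lt_of_le_of_ne inf_le_left fun h =>
      hBZ (inf_eq_left.1 h)
    have := finrank_lt_finrank_of_lt hlt
    rw [B.2.2] at this
    omega
  have hle : A.1 ⊓ B.1 ≤ P.1 ⊓ Q.1 := by
    rw [hBZ']
    exact le_inf inf_le_right (inf_le_left.trans hAZ)
  rw [← Submodule.eq_of_le_of_finrank_eq hle (hAB.trans hX.symm)] at hAX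
  exact hAX inf_le_left

end Cliques

section Stars

open Gr

variable {H : Type*} [NormedAddCommGroup H] [InnerProductSpace ℂ H] {m : ℕ}

lemma Gr.Adj.orthogonal {k : ℕ} {P Q P' Q' : Gr H k} (h : Adj P Q) (hP : P'.1 = P.1ᗮ)
    (hQ : Q'.1 = Q.1ᗮ) : Adj P' Q' := by
  have hr := rank_eq_of_orthogonal hP
  have hfin : FiniteDimensional ℂ H := Module.finite_of_rank_eq_nat hr
  have h1 := finrank_add_finrank_orthogonal (P.1 ⊔ Q.1)
  rw [h.finrank_sup, finrank_eq_of_rank_eq hr] at h1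
  rw [Adj, hP, hQ, inf_orthogonal]
  omega

lemma eq_orthogonal_trans {k : ℕ} {P Q R : Gr H k} (h : Q.1 = P.1ᗮ) (h' : R.1 = Q.1ᗮ) : R = P :=
  Subtype.ext (by rw [h', h, orthogonal_orthogonal])

lemma Gr.Near.orthogonal_left {k : ℕ} {P Q P' : Gr H k} (h : Near P Q) (hP : P'.1 = P.1ᗮ) :
    Near P' Q := by
  rcases h with h | ⟨Q', hQ', h⟩
  · obtain ⟨Q', hQ'⟩ := exists_orthogonal (rank_eq_of_orthogonal hP) Q
    exact Or.inr ⟨Q', hQ', h.orthogonal hP hQ'⟩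
  · exact Or.inl (h.orthogonal hP (eq_orthogonal_symm hQ'))

lemma Gr.Near.orthogonal_right {k : ℕ} {P Q Q' : Gr H k} (h : Near P Q) (hQ : Q'.1 = Q.1ᗮ) :
    Near P Q' := by
  rcases h with h | ⟨R, hR, h⟩
  · exact Or.inr ⟨Q, eq_orthogonal_symm hQ, h⟩
  · obtain rfl : R = Q' := Subtype.ext (hR.trans hQ.symm)
    exact Or.inl h

/-- `X` is contained in `P` or, when `dim H = 2 * (m + 1)`, in the orthogonal complement of `P`. -/
def Inc (X : Gr H m) (P : Gr H (m + 1)) : Prop :=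
  X.1 ≤ P.1 ∨ ∃ P' : Gr H (m + 1), P'.1 = P.1ᗮ ∧ X.1 ≤ P'.1

lemma Inc.orthogonal {X : Gr H m} {P P' : Gr H (m + 1)} (h : Inc X P) (hP : P'.1 = P.1ᗮ) :
    Inc X P' := by
  rcases h with h | ⟨Q, hQ, h⟩
  · exact Or.inr ⟨P, eq_orthogonal_symm hP, h⟩
  · obtain rfl : Q = P' := Subtype.ext (hQ.trans hP.symm)
    exact Or.inl h

/-- Two neighbours of `P` cannot be nearly complementary. -/
lemma finrank_inf_lt_of_adj (hk : GoodDim H (m + 1)) {P A B B' : Gr H (m + 1)} (hA : Adj P A)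
    (hB : Adj P B) (hB' : B'.1 = B.1ᗮ) :
    finrank ℂ (A.1 ⊓ B'.1 : Submodule ℂ H) < m := by
  by_contra! hcon
  have h4 := hk.four_le (rank_eq_of_orthogonal hB')
  have hA' := hA.finrank_inf
  have hB'' := hB.finrank_inf
  have h1 := finrank_sup_add_finrank_inf_eq (P.1 ⊓ A.1) (A.1 ⊓ B'.1)
  have h2 : finrank ℂ ((P.1 ⊓ A.1) ⊔ (A.1 ⊓ B'.1) : Submodule ℂ H) ≤ m + 1 := by
    exact (finrank_mono (sup_le inf_le_right inf_le_left)).trans A.2.2.le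
  have h3 := finrank_sup_of_le_orthogonal (X := P.1 ⊓ A.1 ⊓ (A.1 ⊓ B'.1)) (V := P.1 ⊓ B.1)
    ((inf_le_right.trans inf_le_right).trans (hB'.le.trans (orthogonal_le inf_le_right)))
  have h5 : finrank ℂ ((P.1 ⊓ A.1 ⊓ (A.1 ⊓ B'.1)) ⊔ (P.1 ⊓ B.1) : Submodule ℂ H) ≤ m + 1 := by
    exact (finrank_mono (sup_le (inf_le_left.trans inf_le_left) inf_le_left)).trans P.2.2.le
  omega

/-- No `(m + 1)`-dimensional subspace is compatible with the whole star of `X`. -/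
lemma not_comm_star (hk : GoodDim H (m + 1)) (X : Gr H m) (R : Gr H (m + 1)) :
    ¬ ∀ P : Gr H (m + 1), X.1 ≤ P.1 → Comm R P := by
  intro h
  have h2m := hk.two_mul_le
  have hm := hk.two_le
  obtain ⟨P, Q, hP, hQ, hPQ⟩ := exists_pair_above X
    (le_trans (by exact_mod_cast (by omega)) h2m)
  have hX : Compatible R.1 X.1 := by
    rw [← inf_eq_of_common hP hQ hPQ]
    exact Compatible.inf (h P hP) (h Q hQ)
  have hline : ∀ x ∈ X.1ᗮ, Compatible R.1 (ℂ ∙ x) := by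
    intro x hx
    by_cases hx0 : x = 0
    · rw [hx0, span_zero_singleton]; exact compatible_bot
    have hx' := notMem_of_mem_orthogonal hx hx0
    have heq : (ℂ ∙ x) = (X.cons x hx').1 ⊓ X.1ᗮ := by
      refine le_antisymm ((span_singleton_le_iff_mem _ _).2 ⟨mem_cons X hx', hx⟩) ?_
      rintro y ⟨hy, hy'⟩
      exact mem_of_mem_sup_orthogonal (X := X.1) (E := X.1ᗮ) (by rw [orthogonal_orthogonal])
        ((span_singleton_le_iff_mem _ _).2 hx) hy hy'
    rw [heq]
    exact Compatible.inf (h _ (le_cons X hx')) hX.orthogonal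
  rcases le_or_le_orthogonal_of_forall_line hline with hle | hle
  · obtain ⟨u, hu, hu0⟩ := exists_ne_zero_mem_orthogonal (X.1 ⊔ R.1) (by
      refine lt_of_lt_of_le ?_ h2m
      have := Submodule.finrank_add_le_finrank_add_finrank X.1 R.1
      rw [R.2.2, X.2.2] at this
      exact_mod_cast (by omega))
    rw [← inf_orthogonal, mem_inf] at hu
    exact hu0 (eq_zero_of_mem_of_mem_orthogonal (hle hu.1) hu.2)
  · have h1 : R.1 ≤ X.1 := by
      rw [← orthogonal_orthogonal X.1]
      exact le_orthogonal_iff_le_orthogonal.1 hle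
    have h3 := finrank_mono h1
    rw [R.2.2, X.2.2] at h3
    omega

/-- A bijection preserving commutativity maps the star of `X` to the star of some `X'`, up to
orthogonal complements. -/
theorem exists_inc_map [CompleteSpace H] (hk : GoodDim H (m + 1))
    (e : (Comm : Gr H (m + 1) → Gr H (m + 1) → Prop) ≃r
      (Comm : Gr H (m + 1) → Gr H (m + 1) → Prop)) (X : Gr H m) :
    ∃ X' : Gr H m, ∀ P, Inc X P → Inc X' (e P) := by
  have h2m := hk.two_mul_le
  have hm := hk.two_le
  -- complements need not be considered separately
  suffices hs : ∃ X' : Gr H m, ∀ P : Gr H (m + 1), X.1 ≤ P.1 → Inc X' (e P) by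
    obtain ⟨X', hX'⟩ := hs
    refine ⟨X', fun P hP => ?_⟩
    rcases hP with hP | ⟨P', hP', hP⟩
    · exact hX' P hP
    · exact (hX' P' hP).orthogonal (map_orthogonal hk e (eq_orthogonal_symm hP'))
  obtain ⟨P₁, P₂, hP₁, hP₂, hne⟩ := exists_pair_above X
    (le_trans (by exact_mod_cast (by omega)) h2m)
  -- a lift of the image of the star of `X`, consisting of neighbours of `e P₁`
  let S : Set (Gr H (m + 1)) := {A | ∃ P : Gr H (m + 1), X.1 ≤ P.1 ∧
    (A = e P ∨ A.1 = (e P).1ᗮ) ∧ (A = e P₁ ∨ Adj (e P₁) A)}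
  have hlift : ∀ P : Gr H (m + 1), X.1 ≤ P.1 → ∃ A ∈ S, A = e P ∨ A.1 = (e P).1ᗮ := by
    intro P hP
    by_cases hPP : P = P₁
    · exact ⟨e P, ⟨P, hP, Or.inl rfl, Or.inl (by rw [hPP])⟩, Or.inl rfl⟩
    · rcases near_map hk e (Or.inl (adj_of_common hP₁ hP (Ne.symm hPP))) with h | ⟨A, hA, h⟩
      · exact ⟨e P, ⟨P, hP, Or.inl rfl, Or.inr h⟩, Or.inl rfl⟩
      · exact ⟨A, ⟨P, hP, Or.inr hA, Or.inr h⟩, Or.inr hA⟩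
  have hclique : ∀ A ∈ S, ∀ B ∈ S, A ≠ B → Adj A B := by
    rintro A ⟨P, hP, hAP, hA⟩ B ⟨Q, hQ, hBQ, hB⟩ hAB
    rcases hA with rfl | hA
    · exact hB.resolve_left (Ne.symm hAB)
    rcases hB with rfl | hB
    · exact hA.symm
    by_cases hPQ : P = Q
    · subst hPQ
      have hBA : A.1 = B.1ᗮ := by
        rcases hAP with rfl | hAP <;> rcases hBQ with rfl | hBQ
        · exact absurd rfl hAB
        · exact eq_orthogonal_symm hBQ
        · exact hAP
        · exact absurd (Subtype.ext (hAP.trans hBQ.symm)) hAB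
      have := finrank_inf_lt_of_adj hk hA hB hBA
      rw [inf_idem, A.2.2] at this
      omega
    · have hnear : Near A B := by
        have h1 : Near (e P) (e Q) := near_map hk e (Or.inl (adj_of_common hP hQ hPQ))
        have h2 : Near A (e Q) := by
          rcases hAP with rfl | hAP
          · exact h1
          · exact h1.orthogonal_left hAP
        rcases hBQ with rfl | hBQ
        · exact h2
        · exact h2.orthogonal_right hBQ
      rcases hnear with h | ⟨B', hB', h⟩
      · exact h
      · have h1 := finrank_inf_lt_of_adj hk hA hB hB'
        rw [h.finrank_inf] at h1
        exact absurd h1 (lt_irrefl m)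
  have h₁ : e P₁ ∈ S := ⟨P₁, hP₁, Or.inl rfl, Or.inl rfl⟩
  obtain ⟨Q₂, hQ₂, hQ₂'⟩ := hlift P₂ hP₂
  have hne' : e P₁ ≠ Q₂ := by
    rintro rfl
    rcases hQ₂' with h | h
    · exact hne (e.injective h)
    · have h1 : P₁.1 = P₂.1ᗮ := by
        obtain ⟨R, hR⟩ := exists_orthogonal (rank_eq_of_orthogonal h) P₂
        have h2 := map_orthogonal hk e hR
        rw [← h] at h2
        rw [← e.injective (Subtype.ext h2)]
        exact hR
      have h2 : X.1 = ⊥ := by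
        rw [← inf_eq_of_common hP₁ hP₂ hne, h1, inf_comm]
        exact inf_orthogonal_eq_bot _
      have h3 := X.2.2
      rw [h2, finrank_bot] at h3
      omega
  have hadj := hclique _ h₁ _ hQ₂ hne'
  rcases star_or_top hclique h₁ hQ₂ hne' with hstar | htop
  · refine ⟨⟨(e P₁).1 ⊓ Q₂.1, inferInstance, hadj.finrank_inf⟩, fun P hP => ?_⟩
    obtain ⟨A, hA, hAP⟩ := hlift P hP
    rcases hAP with rfl | hAP
    · exact Or.inl (hstar _ hA)
    · exact Or.inr ⟨A, hAP, hstar _ hA⟩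
  · by_cases hr : Module.rank ℂ H = ((2 * (m + 1) : ℕ) : Cardinal)
    · -- complements turn a top into a star
      have hfin : FiniteDimensional ℂ H := Module.finite_of_rank_eq_nat hr
      have h1 := finrank_add_finrank_orthogonal ((e P₁).1 ⊔ Q₂.1)
      rw [hadj.finrank_sup, finrank_eq_of_rank_eq hr] at h1
      refine ⟨⟨((e P₁).1 ⊔ Q₂.1)ᗮ, inferInstance, by omega⟩, fun P hP => ?_⟩
      obtain ⟨A, hA, hAP⟩ := hlift P hP
      obtain ⟨A', hA'⟩ := exists_orthogonal hr A
      have hle : ((e P₁).1 ⊔ Q₂.1)ᗮ ≤ A'.1 := hA' ▸ orthogonal_le (htop A hA)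
      rcases hAP with rfl | hAP
      · exact Or.inr ⟨A', hA', hle⟩
      · refine Or.inl ?_
        rw [← eq_orthogonal_trans hAP hA']
        exact hle
    · -- some `R` commutes with the whole top
      exfalso
      have hlt : ((2 * (m + 1) + 1 : ℕ) : Cardinal) ≤ Module.rank ℂ H := by
        have := Order.succ_le_of_lt (lt_of_le_of_ne h2m (Ne.symm hr))
        rw [Cardinal.succ_natCast] at this
        exact_mod_cast this
      obtain ⟨R, hR⟩ := exists_gr_le_orthogonal ((e P₁).1 ⊔ Q₂.1) (m + 1) (by
        refine le_trans ?_ hlt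
        rw [hadj.finrank_sup]
        exact_mod_cast (by omega))
      refine not_comm_star hk X (e.symm R) fun P hP => ?_
      rw [← e.map_rel_iff, e.apply_symm_apply]
      obtain ⟨A, hA, hAP⟩ := hlift P hP
      have hRA : Comm R A := compatible_of_le_orthogonal
        (le_orthogonal_iff_le_orthogonal.1 (hR.trans (orthogonal_le (htop A hA))))
      rcases hAP with rfl | hAP
      · exact hRA
      · exact (comm_iff_of_eq_orthogonal hAP R).2 hRA

end Stars

/-! ### Descent to lines -/

section Descent

open Gr
open scoped InnerProductSpace

variable {H : Type*} [NormedAddCommGroup H] [InnerProductSpace ℂ H] {m : ℕ}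

/-- The `Inc`-neighbourhood determines a subspace. -/
lemma eq_of_forall_inc (hk : GoodDim H (m + 1)) {X Y : Gr H m} (h : ∀ P, Inc X P → Inc Y P) :
    X = Y := by
  suffices hle : Y.1 ≤ X.1 from (Gr.eq_of_le hle).symm
  by_contra hle
  obtain ⟨y, hy, hyX⟩ := SetLike.not_le_iff_exists.1 hle
  obtain ⟨x, hx, w, hw, rfl⟩ := X.1.exists_add_mem_mem_orthogonal y
  have hw0 : w ≠ 0 := by
    rintro rfl
    rw [add_zero] at hyX
    exact hyX hx
  have hm := hk.two_le
  obtain ⟨w', hw', hw0'⟩ := exists_ne_zero_mem_orthogonal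
    (X.cons w (notMem_of_mem_orthogonal hw hw0)).1 (by
      refine lt_of_lt_of_le ?_ hk.two_mul_le
      rw [Gr.finrank_val]
      exact_mod_cast (by omega))
  have hw'X : w' ∈ X.1ᗮ := orthogonal_le (le_cons _ _) hw'
  have hww' : ⟪w, w'⟫_ℂ = 0 := (mem_orthogonal _ _).1 hw' w (mem_cons _ _)
  have hw'w : ⟪w', w⟫_ℂ = 0 := inner_eq_zero_symm.1 hww'
  -- the line of `w + w'` is neither that of `w` nor orthogonal to `w`
  have hu : w + w' ∈ X.1ᗮ := add_mem hw hw'X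
  have hinner : ⟪w + w', w⟫_ℂ ≠ 0 := by
    rw [inner_add_left, hw'w, add_zero]
    exact inner_self_ne_zero.2 hw0
  have hu0 : w + w' ≠ 0 := fun h0 => hinner (by rw [h0, inner_zero_left])
  have huX := notMem_of_mem_orthogonal hu hu0
  rcases h (X.cons _ huX) (Or.inl (le_cons X huX)) with hY | ⟨P', hP', hY⟩
  · have h1 : w ∈ (X.cons _ huX).1 :=
      (Submodule.add_mem_iff_right _ (le_cons X huX hx)).1 (hY hy)
    have h2 : w ∈ ℂ ∙ (w + w') := mem_of_mem_sup_orthogonal (X := X.1) (E := X.1ᗮ)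
      (by rw [orthogonal_orthogonal]) ((span_singleton_le_iff_mem _ _).2 hu) h1 hw
    obtain ⟨c, hc⟩ := mem_span_singleton.1 h2
    have h3 : ⟪w', c • (w + w')⟫_ℂ = 0 := by rw [hc, hw'w]
    rw [inner_smul_right, inner_add_right, hw'w, zero_add, mul_eq_zero, inner_self_eq_zero] at h3
    rcases h3 with h3 | h3
    · rw [h3, zero_smul] at hc
      exact hw0 hc.symm
    · exact hw0' h3
  · have h1 : x + w ∈ (X.cons _ huX).1ᗮ := hP' ▸ hY hy
    have h2 := (mem_orthogonal _ _).1 h1 _ (mem_cons X huX)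
    rw [inner_add_right, (mem_orthogonal' _ _).1 hu x hx, zero_add] at h2
    exact hinner h2

/-- A bijection preserving commutativity induces a bijection one dimension lower. -/
theorem exists_equiv_inc [CompleteSpace H] (hk : GoodDim H (m + 1))
    (e : (Comm : Gr H (m + 1) → Gr H (m + 1) → Prop) ≃r
      (Comm : Gr H (m + 1) → Gr H (m + 1) → Prop)) :
    ∃ g : Gr H m ≃ Gr H m, ∀ X P, Inc X P ↔ Inc (g X) (e P) := by
  choose g hg using exists_inc_map hk e
  choose g' hg' using exists_inc_map hk e.symm
  have h1 : ∀ X, g' (g X) = X := fun X => (eq_of_forall_inc hk fun P hP => by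
    simpa using hg' _ _ (hg X P hP)).symm
  have h2 : ∀ X, g (g' X) = X := fun X => (eq_of_forall_inc hk fun P hP => by
    simpa using hg _ _ (hg' X P hP)).symm
  refine ⟨⟨g, g', h1, h2⟩, fun X P => ⟨hg X P, fun h => ?_⟩⟩
  have := hg' _ _ h
  rw [e.symm_apply_apply] at this
  change Inc (g' (g X)) P at this
  rwa [h1] at this

lemma Gr.eq_zero_of_le_of_le_orthogonal {X : Gr H m} {V : Submodule ℂ H} (hX : X.1 ≤ V)
    (hX' : X.1 ≤ Vᗮ) : m = 0 := by
  have h1 : X.1 = ⊥ := by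
    rw [eq_bot_iff]
    exact fun x hx => (mem_bot ℂ).2 (eq_zero_of_mem_of_mem_orthogonal (hX hx) (hX' hx))
  have h2 := X.2.2
  rw [h1, finrank_bot] at h2
  exact h2.symm

lemma Gr.sup_eq_of_le {X Y : Gr H m} {P : Gr H (m + 1)} (hX : X.1 ≤ P.1) (hY : Y.1 ≤ P.1)
    (hne : X ≠ Y) : X.1 ⊔ Y.1 = P.1 := by
  refine Submodule.eq_of_le_of_finrank_le (sup_le hX hY) ?_
  have hlt : X.1 < X.1 ⊔ Y.1 := lt_of_le_of_ne le_sup_left fun h =>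
    hne (Gr.eq_of_le (sup_eq_left.1 h.symm)).symm
  have := finrank_lt_finrank_of_lt hlt
  rw [X.2.2] at this
  rw [P.2.2]
  omega

lemma Gr.adj_of_le_of_le {X Y : Gr H m} {P : Gr H (m + 1)} (hX : X.1 ≤ P.1) (hY : Y.1 ≤ P.1)
    (hne : X ≠ Y) : Adj X Y := by
  have h1 := finrank_sup_add_finrank_inf_eq X.1 Y.1
  rw [Gr.sup_eq_of_le hX hY hne, X.2.2, Y.2.2, P.2.2] at h1
  rw [Adj]
  omega

/-- Neighbours inside `P` are mapped to the same side of the image of `P`: otherwise their images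
would be incident with a further subspace besides the image of `P` and its complement. -/
lemma same_side [CompleteSpace H] (hk : GoodDim H (m + 1))
    {e : (Comm : Gr H (m + 1) → Gr H (m + 1) → Prop) ≃r
      (Comm : Gr H (m + 1) → Gr H (m + 1) → Prop)}
    {g : Gr H m ≃ Gr H m} (hg : ∀ X P, Inc X P ↔ Inc (g X) (e P)) {X Y : Gr H m}
    (hXY : Adj X Y) {P : Gr H (m + 1)} (hX : X.1 ≤ P.1) (hY : Y.1 ≤ P.1) :
    ∃ Z : Gr H (m + 1), (Z = e P ∨ Z.1 = (e P).1ᗮ) ∧ (g X).1 ≤ Z.1 ∧ (g Y).1 ≤ Z.1 := by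
  have hm := hk.two_le
  have hsup := Gr.sup_eq_of_le hX hY hXY.ne
  -- two complementary sides are impossible
  have key : ∀ Q Q' : Gr H (m + 1), (Q = e P ∨ Q.1 = (e P).1ᗮ) → Q'.1 = Q.1ᗮ →
      (g X).1 ≤ Q.1 → (g Y).1 ≤ Q'.1 → False := by
    intro Q Q' hQ hQ' hXQ hYQ
    have hr := rank_eq_of_orthogonal hQ'
    have h4 := hk.four_le hr
    obtain ⟨a, ha, haX⟩ : ∃ a ∈ Q.1, a ∉ (g X).1 := by
      by_contra! hcon
      have := finrank_mono (show Q.1 ≤ (g X).1 from hcon)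
      rw [Q.2.2, (g X).2.2] at this
      omega
    obtain ⟨b, hb, hbY⟩ : ∃ b ∈ Q'.1 ⊓ (g Y).1ᗮ, b ≠ 0 := by
      by_contra! hcon
      have h1 := finrank_add_inf_finrank_orthogonal hYQ
      rw [inf_comm, (Submodule.eq_bot_iff _).2 hcon, finrank_bot, Q'.2.2, (g Y).2.2] at h1
      omega
    have hbQ : b ∈ Q.1ᗮ := hQ' ▸ hb.1
    have hab : a + b ∉ Q.1 := fun h =>
      notMem_of_mem_orthogonal hbQ hbY ((Submodule.add_mem_iff_right _ ha).1 h)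
    have habX : a + b ∉ (g X).1 := fun h => hab (hXQ h)
    set R := (g X).cons (a + b) habX with hR
    obtain ⟨R', hR'⟩ := exists_orthogonal hr R
    have hYR : (g Y).1 ≤ R'.1 := by
      rw [hR', le_orthogonal_iff_le_orthogonal]
      have hQY : Q.1 ≤ (g Y).1ᗮ := by
        rw [← le_orthogonal_iff_le_orthogonal, ← hQ']
        exact hYQ
      refine sup_le (hXQ.trans hQY) ((span_singleton_le_iff_mem _ _).2 ?_)
      exact add_mem (hQY ha) hb.2
    have hincX : Inc X (e.symm R) := by
      rw [hg, e.apply_symm_apply]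
      exact Or.inl (le_cons _ _)
    have hincY : Inc Y (e.symm R) := by
      rw [hg, e.apply_symm_apply]
      exact Or.inr ⟨R', hR', hYR⟩
    have hdisj : ∀ S S' : Gr H (m + 1), S'.1 = S.1ᗮ → X.1 ≤ S.1 → Y.1 ≤ S'.1 → False := by
      intro S S' hS hXS hYS
      have h1 : X.1 ⊓ Y.1 = ⊥ := by
        rw [eq_bot_iff]
        exact fun x hx => (mem_bot ℂ).2 (eq_zero_of_mem_of_mem_orthogonal (hXS hx.1)
          (hS ▸ hYS hx.2))
      have h2 := hXY
      rw [Adj, h1, finrank_bot] at h2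
      omega
    have hRP : P = e.symm R ∨ P.1 = (e.symm R).1ᗮ := by
      rcases hincX with h1 | ⟨S, hS, h1⟩ <;> rcases hincY with h2 | ⟨S', hS', h2⟩
      · exact Or.inl (Gr.eq_of_le (hsup ▸ sup_le h1 h2))
      · exact (hdisj _ _ hS' h1 h2).elim
      · exact (hdisj _ _ (eq_orthogonal_symm hS) h1 h2).elim
      · obtain rfl : S = S' := Subtype.ext (hS.trans hS'.symm)
        exact Or.inr (by rw [← hS, Gr.eq_of_le (P := P) (hsup ▸ sup_le h1 h2)])
    have hRP' : R = e P ∨ R.1 = (e P).1ᗮ := by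
      rcases hRP with rfl | h
      · exact Or.inl (by simp)
      · right
        have := map_orthogonal hk e h
        rw [e.apply_symm_apply] at this
        exact eq_orthogonal_symm this
    have hRQ : R = Q ∨ R.1 = Q.1ᗮ := by
      rcases hRP' with h1 | h1 <;> rcases hQ with h2 | h2
      · exact Or.inl (h1.trans h2.symm)
      · exact Or.inr (by rw [h1]; exact eq_orthogonal_symm h2)
      · exact Or.inr (by rw [h1, h2])
      · exact Or.inl (Subtype.ext (h1.trans h2.symm))
    rcases hRQ with h | h
    · exact hab (h ▸ mem_cons _ habX)
    · have h1 := Gr.eq_zero_of_le_of_le_orthogonal (X := g X) hXQ (h ▸ le_cons _ habX)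
      omega
  rcases (hg X P).1 (Or.inl hX) with h1 | ⟨S, hS, h1⟩ <;>
    rcases (hg Y P).1 (Or.inl hY) with h2 | ⟨S', hS', h2⟩
  · exact ⟨e P, Or.inl rfl, h1, h2⟩
  · exact (key _ _ (Or.inl rfl) hS' h1 h2).elim
  · exact (key _ _ (Or.inr hS) (eq_orthogonal_symm hS) h1 h2).elim
  · obtain rfl : S = S' := Subtype.ext (hS.trans hS'.symm)
    exact ⟨S, Or.inr hS, h1, h2⟩

/-- `g` preserves adjacency, and maps all subspaces of a given `(m + 1)`-dimensional subspace into
another one. -/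
structure TopPreserving (g : Gr H m → Gr H m) : Prop where
  adj : ∀ X Y, Adj X Y → Adj (g X) (g Y)
  top : ∀ Z : Gr H (m + 1), ∃ Z' : Gr H (m + 1), ∀ X : Gr H m, X.1 ≤ Z.1 → (g X).1 ≤ Z'.1

/-- All the `m`-dimensional subspaces of `P` are mapped to the same side of the image of `P`. -/
lemma exists_side [CompleteSpace H] (hk : GoodDim H (m + 1))
    {e : (Comm : Gr H (m + 1) → Gr H (m + 1) → Prop) ≃r
      (Comm : Gr H (m + 1) → Gr H (m + 1) → Prop)}
    {g : Gr H m ≃ Gr H m} (hg : ∀ X P, Inc X P ↔ Inc (g X) (e P)) (P : Gr H (m + 1)) :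
    ∃ Z : Gr H (m + 1), (Z = e P ∨ Z.1 = (e P).1ᗮ) ∧
      ∀ X : Gr H m, X.1 ≤ P.1 → (g X).1 ≤ Z.1 := by
  have hm := hk.two_le
  by_cases hX : ∃ X : Gr H m, X.1 ≤ P.1
  · obtain ⟨X, hX⟩ := hX
    obtain ⟨Z, hZ, hXZ⟩ : ∃ Z : Gr H (m + 1), (Z = e P ∨ Z.1 = (e P).1ᗮ) ∧ (g X).1 ≤ Z.1 := by
      rcases (hg X P).1 (Or.inl hX) with h | ⟨S, hS, h⟩
      · exact ⟨_, Or.inl rfl, h⟩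
      · exact ⟨S, Or.inr hS, h⟩
    refine ⟨Z, hZ, fun Y hY => ?_⟩
    by_cases hXY : X = Y
    · exact hXY ▸ hXZ
    obtain ⟨Z', hZ', hXZ', hYZ'⟩ := same_side hk hg
      (Gr.adj_of_le_of_le hX hY hXY) hX hY
    suffices h : Z' = Z from h ▸ hYZ'
    have hopp : Z'.1 = Z.1ᗮ → Z' = Z := fun h => by
      have := Gr.eq_zero_of_le_of_le_orthogonal (X := g X) hXZ (h ▸ hXZ')
      omega
    rcases hZ with h1 | h1 <;> rcases hZ' with h2 | h2
    · exact h2.trans h1.symm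
    · exact hopp (by rw [h2, h1])
    · exact hopp (by rw [h2]; exact eq_orthogonal_symm h1)
    · exact Subtype.ext (h2.trans h1.symm)
  · exact ⟨e P, Or.inl rfl, fun Y hY => absurd ⟨Y, hY⟩ hX⟩

lemma topPreserving_of_inc [CompleteSpace H] (hk : GoodDim H (m + 1))
    {e : (Comm : Gr H (m + 1) → Gr H (m + 1) → Prop) ≃r
      (Comm : Gr H (m + 1) → Gr H (m + 1) → Prop)}
    {g : Gr H m ≃ Gr H m} (hg : ∀ X P, Inc X P ↔ Inc (g X) (e P)) : TopPreserving g := by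
  have hm := hk.two_le
  refine ⟨fun X Y h => ?_, fun Z => ?_⟩
  · obtain ⟨Z, -, hXZ, hYZ⟩ := same_side hk hg h
      (P := ⟨X.1 ⊔ Y.1, inferInstance, h.finrank_sup⟩) le_sup_left le_sup_right
    exact Gr.adj_of_le_of_le hXZ hYZ (g.injective.ne h.ne)
  · obtain ⟨Z', -, hZ'⟩ := exists_side hk hg Z
    exact ⟨Z', hZ'⟩

/-- Stars are mapped into stars. -/
lemma exists_le_map {g : Gr H (m + 1) ≃ Gr H (m + 1)} (hg : TopPreserving g)
    (hg' : TopPreserving g.symm) (hn : ((m + 3 : ℕ) : Cardinal) ≤ Module.rank ℂ H) (X : Gr H m) :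
    ∃ X' : Gr H m, ∀ P : Gr H (m + 1), X.1 ≤ P.1 → X'.1 ≤ (g P).1 := by
  obtain ⟨P₁, P₂, hP₁, hP₂, hne⟩ := exists_pair_above X
    (le_trans (by exact_mod_cast (by omega)) hn)
  let S : Set (Gr H (m + 1)) := g '' {P | X.1 ≤ P.1}
  have hS : ∀ A ∈ S, ∀ B ∈ S, A ≠ B → Adj A B := by
    rintro _ ⟨P, hP, rfl⟩ _ ⟨Q, hQ, rfl⟩ hPQ
    exact hg.adj _ _ (adj_of_common hP hQ fun h => hPQ (h ▸ rfl))
  have hadj := hg.adj _ _ (adj_of_common hP₁ hP₂ hne)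
  rcases star_or_top hS ⟨P₁, hP₁, rfl⟩ ⟨P₂, hP₂, rfl⟩ (g.injective.ne hne) with h | h
  · exact ⟨⟨_, inferInstance, hadj.finrank_inf⟩, fun P hP => h _ ⟨P, hP, rfl⟩⟩
  · -- a star is not contained in a top
    exfalso
    obtain ⟨Z, hZ⟩ := hg'.top ⟨(g P₁).1 ⊔ (g P₂).1, inferInstance, hadj.finrank_sup⟩
    have hZ' : ∀ P : Gr H (m + 1), X.1 ≤ P.1 → P.1 ≤ Z.1 := fun P hP => by
      simpa using hZ (g P) (h _ ⟨P, hP, rfl⟩)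
    obtain ⟨u, hu, hu0⟩ := exists_ne_zero_mem_orthogonal Z.1 (by
      refine lt_of_lt_of_le ?_ hn
      rw [Gr.finrank_val]
      exact_mod_cast (by omega))
    have huZ := notMem_of_mem_orthogonal hu hu0
    have huX : u ∉ X.1 := fun h => huZ (hZ' P₁ hP₁ (hP₁ h))
    exact huZ (hZ' _ (le_cons X huX) (mem_cons X huX))

lemma eq_of_forall_le (hn : ((m + 3 : ℕ) : Cardinal) ≤ Module.rank ℂ H) {X Y : Gr H m}
    (h : ∀ P : Gr H (m + 1), X.1 ≤ P.1 → Y.1 ≤ P.1) : X = Y := by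
  obtain ⟨P₁, P₂, hP₁, hP₂, hne⟩ := exists_pair_above X
    (le_trans (by exact_mod_cast (by omega)) hn)
  refine (Gr.eq_of_le ?_).symm
  rw [← inf_eq_of_common hP₁ hP₂ hne]
  exact le_inf (h _ hP₁) (h _ hP₂)

lemma topPreserving_of_le {g : Gr H (m + 1) → Gr H (m + 1)} {g' : Gr H m ≃ Gr H m}
    (h : ∀ (X : Gr H m) (P : Gr H (m + 1)), X.1 ≤ P.1 → (g' X).1 ≤ (g P).1) :
    TopPreserving g' := by
  refine ⟨fun X Y hXY => ?_, fun Z => ⟨g Z, fun X hX => h X Z hX⟩⟩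
  exact Gr.adj_of_le_of_le (h X ⟨X.1 ⊔ Y.1, inferInstance, hXY.finrank_sup⟩ le_sup_left)
    (h Y _ le_sup_right) (g'.injective.ne hXY.ne)

/-- A bijection preserving adjacency and tops induces such a bijection one dimension lower. -/
lemma exists_equiv_le {g : Gr H (m + 1) ≃ Gr H (m + 1)} (hg : TopPreserving g)
    (hg' : TopPreserving g.symm) (hn : ((m + 3 : ℕ) : Cardinal) ≤ Module.rank ℂ H) :
    ∃ g' : Gr H m ≃ Gr H m, (∀ (X : Gr H m) (P : Gr H (m + 1)), X.1 ≤ P.1 ↔ (g' X).1 ≤ (g P).1) ∧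
      TopPreserving g' ∧ TopPreserving g'.symm := by
  choose f hf using exists_le_map hg hg' hn
  choose f' hf' using exists_le_map hg' (by simpa using hg) hn
  have h1 : ∀ X, f' (f X) = X := fun X => (eq_of_forall_le hn fun P hP => by
    simpa using hf' _ _ (hf X P hP)).symm
  have h2 : ∀ X, f (f' X) = X := fun X => (eq_of_forall_le hn fun P hP => by
    simpa using hf _ _ (hf' X P hP)).symm
  refine ⟨⟨f, f', h1, h2⟩, fun X P => ⟨hf X P, fun h => ?_⟩, topPreserving_of_le hf,
    topPreserving_of_le (g' := ⟨f', f, h2, h1⟩) hf'⟩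
  have := hf' _ _ h
  rw [g.symm_apply_apply] at this
  change (f' (f X)).1 ≤ P.1 at this
  rwa [h1] at this

lemma exists_gr_between_add {i j : ℕ} {V : Gr H i} {P : Gr H j} (hVP : V.1 ≤ P.1) (d : ℕ)
    (hd : i + d ≤ j) : ∃ X : Gr H (i + d), V.1 ≤ X.1 ∧ X.1 ≤ P.1 := by
  induction d with
  | zero => exact ⟨V, le_rfl, hVP⟩
  | succ d ih =>
    obtain ⟨X, hVX, hXP⟩ := ih (by omega)
    obtain ⟨x, hx, hxX⟩ : ∃ x ∈ P.1, x ∉ X.1 := by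
      by_contra! hcon
      have := finrank_mono (show P.1 ≤ X.1 from hcon)
      rw [P.2.2, X.2.2] at this
      omega
    exact ⟨X.cons x hxX, hVX.trans (le_cons _ _),
      sup_le hXP ((span_singleton_le_iff_mem _ _).2 hx)⟩

lemma exists_gr_between {i l j : ℕ} {V : Gr H i} {P : Gr H j} (hVP : V.1 ≤ P.1) (h₁ : i ≤ l)
    (h₂ : l ≤ j) : ∃ X : Gr H l, V.1 ≤ X.1 ∧ X.1 ≤ P.1 := by
  obtain ⟨d, rfl⟩ := Nat.exists_eq_add_of_le h₁
  exact exists_gr_between_add hVP d h₂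

/-- A bijection that preserves adjacency and tops is induced by a bijection of the set of
lines. -/
theorem exists_line_equiv (j : ℕ) (hn : ((j + 3 : ℕ) : Cardinal) ≤ Module.rank ℂ H)
    (g : Gr H (j + 1) ≃ Gr H (j + 1)) (hg : TopPreserving g) (hg' : TopPreserving g.symm) :
    ∃ h : Gr H 1 ≃ Gr H 1, ∀ (v : Gr H 1) (X : Gr H (j + 1)), v.1 ≤ X.1 ↔ (h v).1 ≤ (g X).1 := by
  induction j with
  | zero =>
    refine ⟨g, fun v X => ⟨fun h => ?_, fun h => ?_⟩⟩
    · rw [Gr.eq_of_le h]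
    · rw [g.injective (Gr.eq_of_le h)]
  | succ j ih =>
    obtain ⟨g', h1, h2, h3⟩ := exists_equiv_le hg hg'
      (le_trans (by exact_mod_cast (by omega)) hn)
    obtain ⟨h, hh⟩ := ih (le_trans (by exact_mod_cast (by omega)) hn) g' h2 h3
    refine ⟨h, fun v P => ⟨fun hv => ?_, fun hv => ?_⟩⟩
    · obtain ⟨X, hvX, hXP⟩ := exists_gr_between (l := j + 1) hv (by omega) (by omega)
      exact ((hh v X).1 hvX).trans ((h1 X P).1 hXP)
    · obtain ⟨X, hvX, hXP⟩ := exists_gr_between (l := j + 1) hv (by omega) (by omega)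
      obtain ⟨X, rfl⟩ := g'.surjective X
      exact ((hh v X).2 hvX).trans ((h1 X P).2 hXP)

end Descent

/-! ### From commutativity to orthogonality of lines -/

section LineMaps

open Gr

variable {H : Type*} [NormedAddCommGroup H] [InnerProductSpace ℂ H] {m : ℕ}

/-- Orthogonal lines extend to orthogonal `(j + 1)`-dimensional subspaces. -/
lemma exists_orthogonal_pair {j : ℕ} (hn : ((2 * (j + 1) : ℕ) : Cardinal) ≤ Module.rank ℂ H)
    {v w : Gr H 1} (hvw : v.1 ≤ w.1ᗮ) :
    ∃ X Y : Gr H (j + 1), v.1 ≤ X.1 ∧ w.1 ≤ Y.1 ∧ X.1 ≤ Y.1ᗮ := by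
  have h2 := Submodule.finrank_add_le_finrank_add_finrank v.1 w.1
  rw [v.2.2, w.2.2] at h2
  obtain ⟨R, hR⟩ := exists_gr_le_orthogonal (v.1 ⊔ w.1) j (by
    refine le_trans ?_ hn
    exact_mod_cast (by omega))
  rw [← inf_orthogonal] at hR
  have hvR : v.1 ≤ R.1ᗮ := le_orthogonal_iff_le_orthogonal.1 (hR.trans inf_le_left)
  have h3 := Submodule.finrank_add_le_finrank_add_finrank (v.1 ⊔ w.1) R.1
  rw [R.2.2] at h3
  obtain ⟨S, hS⟩ := exists_gr_le_orthogonal (v.1 ⊔ w.1 ⊔ R.1) j (by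
    refine le_trans ?_ hn
    exact_mod_cast (by omega))
  rw [← inf_orthogonal, ← inf_orthogonal] at hS
  have hwS : w.1 ≤ S.1ᗮ :=
    le_orthogonal_iff_le_orthogonal.1 (hS.trans (inf_le_left.trans inf_le_right))
  refine ⟨⟨v.1 ⊔ R.1, inferInstance, by
      rw [finrank_sup_of_le_orthogonal hvR, v.2.2, R.2.2, add_comm]⟩,
    ⟨w.1 ⊔ S.1, inferInstance, by
      rw [finrank_sup_of_le_orthogonal hwS, w.2.2, S.2.2, add_comm]⟩,
    le_sup_left, le_sup_left, ?_⟩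
  change v.1 ⊔ R.1 ≤ (w.1 ⊔ S.1)ᗮ
  rw [← inf_orthogonal]
  refine sup_le (le_inf hvw ?_) (le_inf (hR.trans inf_le_right) ?_)
  · exact le_orthogonal_iff_le_orthogonal.1 (hS.trans (inf_le_left.trans inf_le_left))
  · exact le_orthogonal_iff_le_orthogonal.1 (hS.trans inf_le_right)

lemma exists_line_mem {V : Submodule ℂ H} (hV : V ≠ ⊥) : ∃ u : Gr H 1, u.1 ≤ V := by
  obtain ⟨x, hx, hx0⟩ := exists_mem_ne_zero_of_ne_bot hV
  exact ⟨⟨ℂ ∙ x, inferInstance, finrank_span_singleton hx0⟩, (span_singleton_le_iff_mem _ _).2 hx⟩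

lemma not_line_le_le_orthogonal {V : Submodule ℂ H} (u : Gr H 1) (h : u.1 ≤ V) : ¬ u.1 ≤ Vᗮ :=
  fun h' => one_ne_zero (Gr.eq_zero_of_le_of_le_orthogonal h h')

/-- When no orthogonal complement gets in the way, orthogonality of lines is described by commuting
subspaces without common line. -/
lemma line_orthogonal_iff_of_comm {k : ℕ} (hk0 : 0 < k)
    (hn : ((2 * k : ℕ) : Cardinal) ≤ Module.rank ℂ H) {v w : Gr H 1} :
    v.1 ≤ w.1ᗮ ↔ ∃ P Q : Gr H k, v.1 ≤ P.1 ∧ w.1 ≤ Q.1 ∧ Comm P Q ∧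
      ∀ u : Gr H 1, ¬ (u.1 ≤ P.1 ∧ u.1 ≤ Q.1) := by
  constructor
  · intro h
    obtain ⟨j, rfl⟩ := Nat.exists_eq_succ_of_ne_zero hk0.ne'
    obtain ⟨P, Q, hP, hQ, hPQ⟩ := exists_orthogonal_pair hn h
    refine ⟨P, Q, hP, hQ, compatible_of_le_orthogonal (le_orthogonal_iff_le_orthogonal.1 hPQ),
      fun u hu => not_line_le_le_orthogonal u hu.2 (hu.1.trans hPQ)⟩
  · rintro ⟨P, Q, hP, hQ, hPQ, hu⟩
    have hbot : Q.1 ⊓ P.1 = ⊥ := by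
      by_contra hne
      obtain ⟨u, hu'⟩ := exists_line_mem hne
      exact hu u ⟨hu'.trans inf_le_right, hu'.trans inf_le_left⟩
    have h1 := Compatible.eq_sup hPQ
    rw [hbot, bot_sup_eq] at h1
    have h2 : Q.1 ≤ P.1ᗮ := inf_eq_left.1 h1.symm
    exact hP.trans ((le_orthogonal_iff_le_orthogonal.1 h2).trans (orthogonal_le hQ))

/-- In dimension `2 * (m + 1)`, orthogonality of `m`-dimensional subspaces is described by
adjacency and `Inc`. -/
lemma orthogonal_iff_of_inc (hk : GoodDim H (m + 1))
    (hr : Module.rank ℂ H = ((2 * (m + 1) : ℕ) : Cardinal)) {X Y : Gr H m} :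
    X.1 ≤ Y.1ᗮ ↔ X ≠ Y ∧ ¬ Adj X Y ∧ ∃ P, Inc X P ∧ Inc Y P := by
  have h4 := hk.four_le hr
  constructor
  · intro h
    refine ⟨?_, ?_, ?_⟩
    · rintro rfl
      have := Gr.eq_zero_of_le_of_le_orthogonal le_rfl h
      omega
    · intro hadj
      have h1 : X.1 ⊓ Y.1 = ⊥ := by
        rw [eq_bot_iff]
        exact fun x hx => (mem_bot ℂ).2 (eq_zero_of_mem_of_mem_orthogonal hx.2 (h hx.1))
      rw [Adj, h1, finrank_bot] at hadj
      omega
    · have hfin : FiniteDimensional ℂ H := Module.finite_of_rank_eq_nat hr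
      have h1 := finrank_add_finrank_orthogonal Y.1
      rw [Y.2.2, finrank_eq_of_rank_eq hr] at h1
      obtain ⟨P, hXP, hPY⟩ := exists_gr_between (l := m + 1)
        (P := (⟨Y.1ᗮ, inferInstance, by omega⟩ : Gr H (m + 2))) h (by omega) (by omega)
      obtain ⟨P', hP'⟩ := exists_orthogonal hr P
      refine ⟨P, Or.inl hXP, Or.inr ⟨P', hP', ?_⟩⟩
      rw [hP']
      exact le_orthogonal_iff_le_orthogonal.1 hPY
  · rintro ⟨hne, hadj, P, hX, hY⟩
    rcases hX with h1 | ⟨S, hS, h1⟩ <;> rcases hY with h2 | ⟨S', hS', h2⟩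
    · exact absurd (Gr.adj_of_le_of_le h1 h2 hne) hadj
    · refine h1.trans ?_
      rw [eq_orthogonal_symm hS']
      exact orthogonal_le h2
    · rw [hS] at h1
      exact h1.trans (orthogonal_le h2)
    · obtain rfl : S = S' := Subtype.ext (hS.trans hS'.symm)
      exact absurd (Gr.adj_of_le_of_le h1 h2 hne) hadj

/-- A bijection preserving commutativity is induced, up to orthogonal complements, by a bijection of
the lines that preserves orthogonality. -/
theorem exists_line_equiv_of_comm [CompleteSpace H] (hk : GoodDim H (m + 1))
    (e : (Comm : Gr H (m + 1) → Gr H (m + 1) → Prop) ≃r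
      (Comm : Gr H (m + 1) → Gr H (m + 1) → Prop)) :
    ∃ h : Gr H 1 ≃ Gr H 1, (∀ v w : Gr H 1, v.1 ≤ w.1ᗮ ↔ (h v).1 ≤ (h w).1ᗮ) ∧
      ∀ P, ∃ Z : Gr H (m + 1), (Z = e P ∨ Z.1 = (e P).1ᗮ) ∧ ∀ v : Gr H 1, v.1 ≤ P.1 →
        (h v).1 ≤ Z.1 := by
  have h2m := hk.two_mul_le
  have hm := hk.two_le
  obtain ⟨g, hg⟩ := exists_equiv_inc hk e
  have hg' : ∀ X P, Inc X P ↔ Inc (g.symm X) (e.symm P) := fun X P => by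
    rw [hg (g.symm X), e.apply_symm_apply, g.apply_symm_apply]
  have hT := topPreserving_of_inc hk hg
  have hT' := topPreserving_of_inc hk hg'
  obtain ⟨j, rfl⟩ : ∃ j, m = j + 1 := ⟨m - 1, by omega⟩
  have h3 : ((j + 3 : ℕ) : Cardinal) ≤ Module.rank ℂ H :=
    le_trans (by exact_mod_cast (by omega)) h2m
  obtain ⟨h, hh⟩ := exists_line_equiv j h3 g hT hT'
  refine ⟨h, fun v w => ?_, fun P => ?_⟩
  · by_cases hr : Module.rank ℂ H = ((2 * (j + 1 + 1) : ℕ) : Cardinal)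
    · have horth : ∀ X Y : Gr H (j + 1), X.1 ≤ Y.1ᗮ ↔ (g X).1 ≤ (g Y).1ᗮ := by
        intro X Y
        rw [orthogonal_iff_of_inc hk hr, orthogonal_iff_of_inc hk hr]
        refine and_congr g.injective.ne_iff.symm (and_congr (not_congr ⟨hT.adj X Y, fun h => ?_⟩)
          ⟨?_, ?_⟩)
        · simpa using hT'.adj _ _ h
        · rintro ⟨P, h1, h2⟩
          exact ⟨e P, (hg X P).1 h1, (hg Y P).1 h2⟩
        · rintro ⟨P, h1, h2⟩
          obtain ⟨P, rfl⟩ := e.surjective P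
          exact ⟨P, (hg X P).2 h1, (hg Y P).2 h2⟩
      have hpair : ∀ v w : Gr H 1, v.1 ≤ w.1ᗮ ↔
          ∃ X Y : Gr H (j + 1), v.1 ≤ X.1 ∧ w.1 ≤ Y.1 ∧ X.1 ≤ Y.1ᗮ := by
        refine fun v w => ⟨exists_orthogonal_pair
          (le_trans (by exact_mod_cast (by omega)) h2m), ?_⟩
        rintro ⟨X, Y, h1, h2, h3⟩
        exact h1.trans (h3.trans (orthogonal_le h2))
      rw [hpair, hpair]
      constructor
      · rintro ⟨X, Y, h1, h2, h3⟩
        exact ⟨g X, g Y, (hh _ _).1 h1, (hh _ _).1 h2, (horth _ _).1 h3⟩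
      · rintro ⟨X, Y, h1, h2, h3⟩
        obtain ⟨X, rfl⟩ := g.surjective X
        obtain ⟨Y, rfl⟩ := g.surjective Y
        exact ⟨X, Y, (hh _ _).2 h1, (hh _ _).2 h2, (horth _ _).2 h3⟩
    · have hinc : ∀ (X : Gr H (j + 1)) (P : Gr H (j + 1 + 1)), Inc X P ↔ X.1 ≤ P.1 := by
        refine fun X P => ⟨fun h => h.resolve_right ?_, Or.inl⟩
        rintro ⟨P', hP', -⟩
        exact hr (rank_eq_of_orthogonal hP')
      have hle : ∀ (v : Gr H 1) (P : Gr H (j + 1 + 1)), v.1 ≤ P.1 ↔ (h v).1 ≤ (e P).1 := by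
        refine fun v P => ⟨fun hv => ?_, fun hv => ?_⟩
        · obtain ⟨X, hvX, hXP⟩ := exists_gr_between (l := j + 1) hv (by omega) (by omega)
          rw [← hinc, hg, hinc] at hXP
          exact ((hh v X).1 hvX).trans hXP
        · obtain ⟨X, hvX, hXP⟩ := exists_gr_between (l := j + 1) hv (by omega) (by omega)
          obtain ⟨X, rfl⟩ := g.surjective X
          rw [← hinc, ← hg, hinc] at hXP
          exact ((hh v X).2 hvX).trans hXP
      rw [line_orthogonal_iff_of_comm (by omega) h2m, line_orthogonal_iff_of_comm (by omega) h2m]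
      constructor
      · rintro ⟨P, Q, h1, h2, h3, h4⟩
        refine ⟨e P, e Q, (hle _ _).1 h1, (hle _ _).1 h2, e.map_rel_iff.2 h3, fun u hu => ?_⟩
        obtain ⟨u, rfl⟩ := h.surjective u
        exact h4 u ⟨(hle _ _).2 hu.1, (hle _ _).2 hu.2⟩
      · rintro ⟨P, Q, h1, h2, h3, h4⟩
        obtain ⟨P, rfl⟩ := e.surjective P
        obtain ⟨Q, rfl⟩ := e.surjective Q
        exact ⟨P, Q, (hle _ _).2 h1, (hle _ _).2 h2, e.map_rel_iff.1 h3,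
          fun u hu => h4 (h u) ⟨(hle _ _).1 hu.1, (hle _ _).1 hu.2⟩⟩
  · obtain ⟨Z, hZ, hXZ⟩ := exists_side hk hg P
    refine ⟨Z, hZ, fun v hv => ?_⟩
    obtain ⟨X, hvX, hXP⟩ := exists_gr_between (l := j + 1) hv (by omega) (by omega)
    exact ((hh v X).1 hvX).trans (hXZ X hXP)

end LineMaps

/-! ### Coherent representatives of the images of lines -/

section Uhlhorn

open scoped InnerProductSpace

variable {H : Type*} [NormedAddCommGroup H] [InnerProductSpace ℂ H]

/-- A bijection of the lines of `H` preserving orthogonality in both directions, encoded by the map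
`x ↦ ℓ x` that sends a vector to the image of its line, and `0` to `⊥`. -/
structure IsOrthoMap (ℓ : H → Submodule ℂ H) : Prop where
  zero : ℓ 0 = ⊥
  finrank_eq : ∀ x ≠ 0, finrank ℂ (ℓ x) = 1
  ortho : ∀ x y, ⟪x, y⟫_ℂ = 0 ↔ ℓ x ≤ (ℓ y)ᗮ
  surj : ∀ y ≠ 0, ∃ x, ℓ x = ℂ ∙ y

lemma notMem_span_singleton_symm {x y : H} (hy : y ≠ 0) (hxy : x ∉ ℂ ∙ y) : y ∉ ℂ ∙ x := by
  intro h
  obtain ⟨c, rfl⟩ := mem_span_singleton.1 h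
  have hc : c ≠ 0 := by
    rintro rfl
    exact hy (zero_smul _ _)
  exact hxy (mem_span_singleton.2 ⟨c⁻¹, inv_smul_smul₀ hc x⟩)

lemma eq_zero_of_mem_spans {a b x : H} (hba : b ∉ ℂ ∙ a) (ha : x ∈ ℂ ∙ a) (hb : x ∈ ℂ ∙ b) :
    x = 0 := by
  by_contra hx
  obtain ⟨c, rfl⟩ := mem_span_singleton.1 hb
  have hc : c ≠ 0 := by
    rintro rfl
    exact hx (zero_smul _ _)
  exact hba ((smul_mem_iff _ hc).1 ha)

lemma sub_notMem_span_singleton {x y : H} (hxy : x ∉ ℂ ∙ y) : x - y ∉ ℂ ∙ y := fun h =>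
  hxy (by simpa using add_mem h (mem_span_singleton_self y))

namespace IsOrthoMap

variable {ℓ : H → Submodule ℂ H} (h : IsOrthoMap ℓ)

include h

lemma finiteDimensional (x : H) : FiniteDimensional ℂ (ℓ x) := by
  by_cases hx : x = 0
  · rw [hx, h.zero]; infer_instance
  · exact FiniteDimensional.of_finrank_pos (by rw [h.finrank_eq x hx]; norm_num)

/-- The image of a linear combination lies in the span of the images. -/
lemma le_sup_iff {x y z : H} : ℓ x ≤ ℓ y ⊔ ℓ z ↔ x ∈ span ℂ {y, z} := by
  have := h.finiteDimensional
  have hfin : FiniteDimensional ℂ (span ℂ {y, z}) :=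
    FiniteDimensional.span_of_finite ℂ (Set.toFinite _)
  have key : ∀ w, w ∈ (span ℂ {y, z})ᗮ ↔ ℓ w ≤ (ℓ y)ᗮ ∧ ℓ w ≤ (ℓ z)ᗮ := by
    intro w
    rw [← h.ortho, ← h.ortho, ← Set.singleton_union, span_union, ← inf_orthogonal, mem_inf,
      mem_orthogonal_singleton_iff_inner_left, mem_orthogonal_singleton_iff_inner_left]
  constructor
  · intro hx
    rw [← orthogonal_orthogonal (span ℂ {y, z}), mem_orthogonal]
    intro w hw
    rw [key] at hw
    rw [h.ortho]
    have : ℓ w ≤ (ℓ y ⊔ ℓ z)ᗮ := by rw [← inf_orthogonal]; exact le_inf hw.1 hw.2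
    exact this.trans (orthogonal_le hx)
  · intro hx
    rw [← orthogonal_orthogonal (ℓ y ⊔ ℓ z)]
    intro u hu
    rw [mem_orthogonal]
    intro w hw
    by_cases hw0 : w = 0
    · rw [hw0, inner_zero_left]
    obtain ⟨w₀, hw₀⟩ := h.surj w hw0
    have h1 : ℓ w₀ ≤ (ℓ y ⊔ ℓ z)ᗮ := by rwa [hw₀, span_singleton_le_iff_mem]
    rw [← inf_orthogonal, le_inf_iff, ← key] at h1
    have h2 := (h.ortho w₀ x).1 (inner_eq_zero_symm.1 ((mem_orthogonal _ _).1 h1 x hx))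
    refine (mem_orthogonal' _ _).1 (h2 ?_) u hu
    rw [hw₀]
    exact mem_span_singleton_self w

lemma le_iff {x y : H} : ℓ x ≤ ℓ y ↔ x ∈ ℂ ∙ y := by
  have := h.le_sup_iff (x := x) (y := y) (z := y)
  simpa using this

lemma exists_eq {x : H} (hx : x ≠ 0) : ∃ u ∈ ℓ x, u ≠ 0 ∧ ℓ x = ℂ ∙ u :=
  exists_eq_span_singleton (h.finrank_eq x hx)

lemma eq_span {x u : H} (hu : u ∈ ℓ x) (hu0 : u ≠ 0) : ℓ x = ℂ ∙ u := by
  have := h.finiteDimensional x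
  have hx : x ≠ 0 := by
    rintro rfl
    rw [h.zero, mem_bot] at hu
    exact hu0 hu
  exact (Submodule.eq_of_le_of_finrank_eq ((span_singleton_le_iff_mem _ _).2 hu)
    (by rw [finrank_span_singleton hu0, h.finrank_eq x hx])).symm

/-- Images of independent vectors meet trivially. -/
lemma eq_zero_of_mem {x y u : H} (hx : x ∉ ℂ ∙ y) (hu : u ∈ ℓ x) (hu' : u ∈ ℓ y) : u = 0 := by
  by_contra hu0
  refine hx (h.le_iff.1 ?_)
  rw [h.eq_span hu hu0, h.eq_span hu' hu0]

/-- A representative `x'` of the image of `x` determines a representative `y'` of the image of `y`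
through the condition `x' - y' ∈ ℓ (x - y)`. The two are then said to be matched. -/
lemma exists_match {x y x' : H} (hxy : x ∉ ℂ ∙ y) (hx' : x' ∈ ℓ x) :
    ∃ y' ∈ ℓ y, x' - y' ∈ ℓ (x - y) := by
  have hne : x - y ≠ 0 := fun h0 => hxy (sub_eq_zero.1 h0 ▸ mem_span_singleton_self x)
  obtain ⟨u, hu, hu0, -⟩ := h.exists_eq hne
  have hle : ℓ (x - y) ≤ ℓ x ⊔ ℓ y := h.le_sup_iff.2 (mem_span_pair.2 ⟨1, -1, by
    rw [one_smul, neg_one_smul, sub_eq_add_neg]⟩)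
  obtain ⟨a, ha, b, hb, rfl⟩ := mem_sup.1 (hle hu)
  have ha0 : a ≠ 0 := by
    rintro rfl
    rw [zero_add] at hu hu0
    exact hu0 (h.eq_zero_of_mem (sub_notMem_span_singleton hxy) hu hb)
  rw [h.eq_span ha ha0] at hx'
  obtain ⟨c, rfl⟩ := mem_span_singleton.1 hx'
  refine ⟨-(c • b), neg_mem (smul_mem _ _ hb), ?_⟩
  rw [sub_neg_eq_add, ← smul_add]
  exact smul_mem _ _ hu

/-- Matching is transitive for three independent vectors. -/
lemma match_trans {x y z x' y' z' : H} (hy : y ∉ span ℂ {x, z}) (hxz : x ≠ z)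
    (hx' : x' ∈ ℓ x) (hz' : z' ∈ ℓ z) (hxy' : x' - y' ∈ ℓ (x - y)) (hyz' : y' - z' ∈ ℓ (y - z)) :
    x' - z' ∈ ℓ (x - z) := by
  have := h.finiteDimensional
  have hxz0 : x - z ≠ 0 := sub_ne_zero.2 hxz
  -- the planes spanned by `x - y, y - z` and by `x, z` meet exactly in the line of `x - z`
  have h1 : ℓ (x - z) ≤ (ℓ (x - y) ⊔ ℓ (y - z)) ⊓ (ℓ x ⊔ ℓ z) := by
    refine le_inf (h.le_sup_iff.2 (mem_span_pair.2 ⟨1, 1, ?_⟩))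
      (h.le_sup_iff.2 (mem_span_pair.2 ⟨1, -1, ?_⟩))
    · rw [one_smul, one_smul]; abel
    · rw [one_smul, neg_one_smul]; abel
  have h2 : (ℓ (x - y) ⊔ ℓ (y - z)) ⊓ (ℓ x ⊔ ℓ z) < ℓ (x - y) ⊔ ℓ (y - z) := by
    refine lt_of_le_of_ne inf_le_left fun heq => hy (h.le_sup_iff.1 ?_)
    have h3 : ℓ y ≤ ℓ x ⊔ ℓ (x - y) := h.le_sup_iff.2 (mem_span_pair.2 ⟨1, -1, by
      rw [one_smul, neg_one_smul]; abel⟩)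
    exact h3.trans (sup_le le_sup_left (le_sup_left.trans (inf_eq_left.1 heq)))
  have h4 : ∀ w, finrank ℂ (ℓ w) ≤ 1 := by
    intro w
    by_cases hw : w = 0
    · rw [hw, h.zero, finrank_bot]; norm_num
    · rw [h.finrank_eq w hw]
  have h5 := finrank_lt_finrank_of_lt h2
  have h6 := Submodule.finrank_add_le_finrank_add_finrank (ℓ (x - y)) (ℓ (y - z))
  have h7 := h4 (x - y)
  have h8 := h4 (y - z)
  have h9 := Submodule.eq_of_le_of_finrank_le h1 (by rw [h.finrank_eq _ hxz0]; omega)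
  rw [h9]
  refine ⟨?_, sub_mem (mem_sup_left hx') (mem_sup_right hz')⟩
  have : x' - z' = (x' - y') + (y' - z') := by abel
  rw [this]
  exact add_mem_sup hxy' hyz'

lemma match_symm {x y x' y' : H} (hxy : x' - y' ∈ ℓ (x - y)) : y' - x' ∈ ℓ (y - x) := by
  have h1 : ℓ (x - y) ≤ ℓ (y - x) := h.le_iff.2 (by
    rw [← neg_sub y x]
    exact neg_mem (mem_span_singleton_self _))
  rw [← neg_sub x' y']
  exact neg_mem (h1 hxy)

/-- In dimension at least three, any two vectors matched with the same vector are matched with each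
other. -/
lemma match_of_match (hd : ∀ x y : H, ∃ z, z ∉ span ℂ {x, y}) {x y z x' y' z' : H}
    (hxy : x ∉ ℂ ∙ y) (hxz : x ∉ ℂ ∙ z) (hyz : y ∉ ℂ ∙ z)
    (hx' : x' ∈ ℓ x) (hy' : y' ∈ ℓ y) (hz' : z' ∈ ℓ z)
    (hxy' : x' - y' ∈ ℓ (x - y)) (hxz' : x' - z' ∈ ℓ (x - z)) : y' - z' ∈ ℓ (y - z) := by
  have hne : ∀ {a b : H}, a ∉ ℂ ∙ b → a ≠ b := by
    rintro a _ hab rfl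
    exact hab (mem_span_singleton_self _)
  by_cases hx : x ∈ span ℂ {y, z}
  · obtain ⟨w, hw⟩ := hd y z
    have hwl : ∀ {a}, a ∈ span ℂ {y, z} → w ∉ ℂ ∙ a := fun ha h =>
      hw ((span_singleton_le_iff_mem _ _).2 ha h)
    have hy : y ∈ span ℂ {y, z} := subset_span (by simp)
    have hz : z ∈ span ℂ {y, z} := subset_span (by simp)
    have hx0 : x ≠ 0 := by
      rintro rfl
      exact hxy (zero_mem _)
    obtain ⟨w', hw', hxw'⟩ := h.exists_match (notMem_span_singleton_symm hx0 (hwl hx)) hx'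
    have key : ∀ {a a' : H}, a ∈ span ℂ {y, z} → x ∉ ℂ ∙ a → a' ∈ ℓ a → x' - a' ∈ ℓ (x - a) →
        w' - a' ∈ ℓ (w - a) := by
      intro a a' ha hxa ha' hxa'
      refine h.match_trans (fun hmem => hw ?_) (hne (hwl ha)) hw' ha' (h.match_symm hxw') hxa'
      exact span_le.2 (Set.pair_subset hx ha) (mem_span_insert_exchange hmem hxa)
    exact h.match_trans hw (hne hyz) hy' hz' (h.match_symm (key hy hxy hy' hxy'))
      (key hz hxz hz' hxz')
  · exact h.match_trans hx (hne hyz) hy' hz' (h.match_symm hxy') hxz'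

/-- A choice of pairwise matched representatives of the image lines. They are obtained by matching
with a fixed vector `a`, or with a second vector `b` in the case of the multiples of `a`. -/
lemma exists_coherent (hd : ∀ x y : H, ∃ z, z ∉ span ℂ {x, y}) :
    ∃ F : H → H, (∀ x, F x ∈ ℓ x) ∧ (∃ b, F b ≠ 0) ∧
      ∀ x y, x ∉ ℂ ∙ y → F x - F y ∈ ℓ (x - y) := by
  obtain ⟨a, ha⟩ := hd 0 0
  have ha0 : a ≠ 0 := by
    rintro rfl
    exact ha (zero_mem _)
  obtain ⟨b, hb⟩ := hd a a
  rw [Set.pair_eq_singleton] at hb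
  have hb0 : b ≠ 0 := by
    rintro rfl
    exact hb (zero_mem _)
  have hab : a ∉ ℂ ∙ b := notMem_span_singleton_symm ha0 hb
  obtain ⟨a', ha', ha'0, -⟩ := h.exists_eq ha0
  obtain ⟨b', hb', hab'⟩ := h.exists_match hab ha'
  have hex : ∀ y, ∃ y' ∈ ℓ y, (y ∉ ℂ ∙ a → a' - y' ∈ ℓ (a - y)) ∧
      (y ∉ ℂ ∙ b → b' - y' ∈ ℓ (b - y)) := by
    intro y
    by_cases hya : y ∈ ℂ ∙ a
    · by_cases hyb : y ∈ ℂ ∙ b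
      · exact ⟨0, zero_mem _, fun h => absurd hya h, fun h => absurd hyb h⟩
      · obtain ⟨y', hy', hyy'⟩ := h.exists_match (notMem_span_singleton_symm hb0 hyb) hb'
        exact ⟨y', hy', fun h => absurd hya h, fun _ => hyy'⟩
    · obtain ⟨y', hy', hyy'⟩ := h.exists_match (notMem_span_singleton_symm ha0 hya) ha'
      refine ⟨y', hy', fun _ => hyy', fun hyb => ?_⟩
      have hy0 : y ≠ 0 := by
        rintro rfl
        exact hya (zero_mem _)
      exact h.match_of_match hd hab (notMem_span_singleton_symm ha0 hya)
        (notMem_span_singleton_symm hb0 hyb) ha' hb' hy' hab' hyy'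
  choose F hF hFa hFb using hex
  have hF0 : F 0 = 0 := by simpa [h.zero] using hF 0
  refine ⟨F, hF, ⟨b, fun h0 => ?_⟩, fun x y hxy => ?_⟩
  · have h1 := hFa b hb
    rw [h0, sub_zero] at h1
    refine ha'0 (h.eq_zero_of_mem (x := a - b) (y := a) (fun h2 => hb ?_) h1 ha')
    simpa using sub_mem (mem_span_singleton_self a) h2
  · by_cases hy0 : y = 0
    · rw [hy0, hF0, sub_zero, sub_zero]
      exact hF x
    have hx0 : x ≠ 0 := by
      rintro rfl
      exact hxy (zero_mem _)
    have viaA : ∀ {x y}, x ≠ 0 → y ≠ 0 → x ∉ ℂ ∙ y → x ∉ ℂ ∙ a → y ∉ ℂ ∙ a →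
        F x - F y ∈ ℓ (x - y) := fun {x y} hx0 hy0 hxy hx hy =>
      h.match_of_match hd (notMem_span_singleton_symm ha0 hx)
        (notMem_span_singleton_symm ha0 hy) hxy ha' (hF x) (hF y) (hFa x hx) (hFa y hy)
    have viaB : ∀ {x y}, x ≠ 0 → y ≠ 0 → x ∉ ℂ ∙ y → x ∉ ℂ ∙ b → y ∉ ℂ ∙ b →
        F x - F y ∈ ℓ (x - y) := fun {x y} hx0 hy0 hxy hx hy =>
      h.match_of_match hd (notMem_span_singleton_symm hb0 hx)
        (notMem_span_singleton_symm hb0 hy) hxy hb' (hF x) (hF y) (hFb x hx) (hFb y hy)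
    -- a multiple of `a` and a multiple of `b` are compared through a vector outside their plane
    have viaAB : ∀ {x y}, x ≠ 0 → y ≠ 0 → x ∉ ℂ ∙ y → x ∈ ℂ ∙ a → y ∈ ℂ ∙ b →
        F x - F y ∈ ℓ (x - y) := by
      intro x y hx0 hy0 hxy hx hy
      obtain ⟨z, hz⟩ := hd a b
      have haz : z ∉ ℂ ∙ a := fun h => hz (span_mono (by simp) h)
      have hbz : z ∉ ℂ ∙ b := fun h => hz (span_mono (by simp) h)
      have hz0 : z ≠ 0 := by
        rintro rfl
        exact hz (zero_mem _)
      have hzx : z ∉ ℂ ∙ x := fun h => haz ((span_singleton_le_iff_mem _ _).2 hx h)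
      have hzy : z ∉ ℂ ∙ y := fun h => hbz ((span_singleton_le_iff_mem _ _).2 hy h)
      have hxb : x ∉ ℂ ∙ b := fun hxb => hx0 (eq_zero_of_mem_spans hb hx hxb)
      have hya : y ∉ ℂ ∙ a := fun hya => hy0 (eq_zero_of_mem_spans hb hya hy)
      exact h.match_of_match hd hzx hzy hxy (hF z) (hF x) (hF y)
        (viaB hz0 hx0 hzx hbz hxb) (viaA hz0 hy0 hzy haz hya)
    by_cases hxa : x ∈ ℂ ∙ a
    · by_cases hyb : y ∈ ℂ ∙ b
      · exact viaAB hx0 hy0 hxy hxa hyb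
      · by_cases hxb : x ∈ ℂ ∙ b
        · exact absurd (eq_zero_of_mem_spans hb hxa hxb) hx0
        · exact viaB hx0 hy0 hxy hxb hyb
    · by_cases hya : y ∈ ℂ ∙ a
      · by_cases hxb : x ∈ ℂ ∙ b
        · exact h.match_symm (viaAB hy0 hx0 (notMem_span_singleton_symm hy0 hxy) hya hxb)
        · by_cases hyb : y ∈ ℂ ∙ b
          · exact absurd (eq_zero_of_mem_spans hb hya hyb) hy0
          · exact viaB hx0 hy0 hxy hxb hyb
      · exact viaA hx0 hy0 hxy hxa hya

end IsOrthoMap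

end Uhlhorn

/-! ### Uhlhorn's theorem -/

section SemilinearMaps

open scoped InnerProductSpace ComplexConjugate

variable {H : Type*} [NormedAddCommGroup H] [InnerProductSpace ℂ H]

namespace IsOrthoMap

variable {ℓ : H → Submodule ℂ H} (h : IsOrthoMap ℓ)

include h

/-- In dimension at least three, the image lines are those of an injective additive map. -/
lemma exists_addMonoidHom (hd : ∀ x y : H, ∃ z, z ∉ span ℂ {x, y}) :
    ∃ F : H →+ H, (∀ x, F x ∈ ℓ x) ∧ ∀ x, F x = 0 → x = 0 := by
  obtain ⟨F, hF, ⟨b, hb⟩, hFc⟩ := h.exists_coherent hd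
  have hd1 : ∀ x : H, ∃ z, z ∉ ℂ ∙ x := fun x => by simpa using hd x x
  have hF0 : F 0 = 0 := by simpa [h.zero] using hF 0
  have hsub : ∀ x y, x ∉ ℂ ∙ y → F (x - y) = F x - F y := by
    intro x y hxy
    by_cases hy0 : y = 0
    · rw [hy0, hF0, sub_zero, sub_zero]
    have hyx : x ∉ ℂ ∙ (x - y) := by
      have h1 := sub_notMem_span_singleton (notMem_span_singleton_symm hy0 hxy)
      rw [← neg_sub x y, neg_mem_iff] at h1
      refine notMem_span_singleton_symm ?_ h1
      rintro rfl
      exact hxy (zero_mem _)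
    have h1 := hFc x (x - y) hyx
    rw [sub_sub_cancel] at h1
    have h2 := sub_mem (hF (x - y)) (hFc x y hxy)
    have h3 := sub_mem (hF y) h1
    have h4 : F (x - y) - (F x - F y) = F y - (F x - F (x - y)) := by abel
    rw [← h4] at h3
    exact sub_eq_zero.1 (h.eq_zero_of_mem (sub_notMem_span_singleton hxy) h2 h3)
  have hadd : ∀ x y, x ∉ ℂ ∙ y → F (x + y) = F x + F y := by
    intro x y hxy
    have h1 := hsub (x + y) y (fun h1 => hxy (by simpa using sub_mem h1 (mem_span_singleton_self y)))
    rw [add_sub_cancel_right] at h1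
    rw [h1, sub_add_cancel]
  have hadd' : ∀ x y, F (x + y) = F x + F y := by
    intro x y
    by_cases hxy : x ∈ ℂ ∙ y
    · -- a vector outside the line of `y` reduces to the case of independent vectors
      obtain ⟨z, hz⟩ := hd1 y
      have hz1 : ∀ u ∈ ℂ ∙ y, z ∉ ℂ ∙ u := fun u hu h1 =>
        hz ((span_singleton_le_iff_mem _ _).2 hu h1)
      have e1 := hadd z (x + y) (hz1 _ (add_mem hxy (mem_span_singleton_self y)))
      have e2 := hadd z y hz
      have e3 := hadd (z + y) x (fun h1 => hz (by
        simpa using sub_mem ((span_singleton_le_iff_mem _ _).2 hxy h1) (mem_span_singleton_self y)))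
      rw [show z + y + x = z + (x + y) by abel, e1, e2] at e3
      have : F (x + y) = F z + F (x + y) - F z := by abel
      rw [this, e3]
      abel
    · exact hadd x y hxy
  refine ⟨⟨⟨F, hF0⟩, hadd'⟩, hF, fun x hx => ?_⟩
  change F x = 0 at hx
  by_contra hx0
  have key : ∀ {x y}, x ≠ 0 → F x = 0 → y ∉ ℂ ∙ x → F y = 0 := by
    intro x y hx0 hx hyx
    have h1 := hFc y x hyx
    rw [hx, sub_zero] at h1
    exact h.eq_zero_of_mem (x := y - x) (y := y) (fun h2 =>
      notMem_span_singleton_symm hx0 hyx (by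
        simpa using sub_mem (mem_span_singleton_self y) h2)) h1 (hF y)
  obtain ⟨y, hy⟩ := hd1 x
  have hy0 : y ≠ 0 := by
    rintro rfl
    exact hy (zero_mem _)
  have hFy := key hx0 hx hy
  by_cases hbx : b ∈ ℂ ∙ x
  · refine hb (key hy0 hFy fun hby => hb ?_)
    rw [eq_zero_of_mem_spans hy hbx hby, hF0]
  · exact hb (key hx0 hx hbx)

/-- An additive map inducing the given map of lines is semilinear. -/
lemma exists_ringHom (hd : ∀ x y : H, ∃ z, z ∉ span ℂ {x, y}) {F : H →+ H}
    (hF : ∀ x, F x ∈ ℓ x) (hF0 : ∀ x, F x = 0 → x = 0) :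
    ∃ σ : ℂ →+* ℂ, ∀ (c : ℂ) x, F (c • x) = σ c • F x := by
  have hd1 : ∀ x : H, ∃ z, z ∉ ℂ ∙ x := fun x => by simpa using hd x x
  have hsc : ∀ (c : ℂ) x, ∃ s : ℂ, F (c • x) = s • F x := by
    intro c x
    by_cases hx : x = 0
    · exact ⟨0, by rw [hx, smul_zero, map_zero, smul_zero]⟩
    have h1 : F (c • x) ∈ ℓ x :=
      h.le_iff.2 (smul_mem _ c (mem_span_singleton_self x)) (hF _)
    rw [h.eq_span (hF x) (fun h0 => hx (hF0 x h0)), mem_span_singleton] at h1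
    obtain ⟨s, hs⟩ := h1
    exact ⟨s, hs.symm⟩
  obtain ⟨a, ha⟩ := hd1 0
  have ha0 : a ≠ 0 := by
    rintro rfl
    exact ha (zero_mem _)
  have hFa : F a ≠ 0 := fun h0 => ha0 (hF0 a h0)
  choose σ hσ using fun c => hsc c a
  have hind : ∀ c x, x ∉ ℂ ∙ a → F (c • x) = σ c • F x := by
    intro c x hx
    obtain ⟨s, hs⟩ := hsc c (x + a)
    obtain ⟨t, ht⟩ := hsc c x
    have h1 : (s - t) • F x = (σ c - s) • F a := by
      rw [smul_add, map_add, map_add, ht, hσ, smul_add] at hs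
      rw [sub_smul, sub_smul, sub_eq_sub_iff_add_eq_add, ← hs, add_comm]
    have h2 : (σ c - s) • F a = 0 := h.eq_zero_of_mem (x := x) (y := a) hx
      (h1 ▸ smul_mem _ _ (hF x)) (smul_mem _ _ (hF a))
    have hFx : F x ≠ 0 := fun h0 => hx (by rw [hF0 x h0]; exact zero_mem _)
    rw [h2, smul_eq_zero, or_iff_left hFx, sub_eq_zero] at h1
    rw [smul_eq_zero, or_iff_left hFa, sub_eq_zero] at h2
    rw [ht, ← h1, h2]
  have hall : ∀ c x, F (c • x) = σ c • F x := by
    intro c x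
    by_cases hx : x ∈ ℂ ∙ a
    · obtain ⟨z, hz⟩ := hd1 a
      have h1 := hind c (x + z) (fun h1 => hz (by simpa using sub_mem h1 hx))
      rw [smul_add, map_add, map_add, hind c z hz, smul_add] at h1
      exact add_right_cancel h1
    · exact hind c x hx
  have hinj : ∀ {s t : ℂ}, s • F a = t • F a → s = t := fun h1 => smul_left_injective ℂ hFa h1
  refine ⟨⟨⟨⟨σ, hinj ?_⟩, fun c d => hinj ?_⟩, hinj ?_, fun c d => hinj ?_⟩, hall⟩
  · rw [← hall, one_smul, one_smul]
  · rw [← hall, mul_smul, hall, hall, mul_smul]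
  · rw [← hall, zero_smul, zero_smul, map_zero]
  · change σ (c + d) • F a = (σ c + σ d) • F a
    rw [← hall, add_smul, add_smul, map_add, hall, hall]

/-- For orthonormal `x`, `y`, the vectors `x + t y` and `conj t x - y` are orthogonal, hence so are
their images. -/
lemma map_conj_mul {F : H →+ H} (hF : ∀ x, F x ∈ ℓ x) {σ : ℂ →+* ℂ}
    (hσ : ∀ (c : ℂ) x, F (c • x) = σ c • F x) {x y : H} (hx : ‖x‖ = 1) (hy : ‖y‖ = 1)
    (hxy : ⟪x, y⟫_ℂ = 0) (t : ℂ) :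
    σ (conj t) * (‖F x‖ : ℂ) ^ 2 = conj (σ t) * (‖F y‖ : ℂ) ^ 2 := by
  have hor : ∀ {u v}, ⟪u, v⟫_ℂ = 0 → ⟪F u, F v⟫_ℂ = 0 := fun {u v} huv =>
    (mem_orthogonal' _ _).1 ((h.ortho u v).1 huv (hF u)) _ (hF v)
  have hyx := inner_eq_zero_symm.1 hxy
  have h1 : ⟪x + t • y, conj t • x - y⟫_ℂ = 0 := by
    simp only [inner_add_left, inner_sub_right, inner_smul_left, inner_smul_right, hxy, hyx,
      inner_self_eq_norm_sq_to_K, hx, hy]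
    simp
  have h2 := hor h1
  rw [map_add, map_sub, hσ, hσ] at h2
  simp only [inner_add_left, inner_sub_right, inner_smul_left, inner_smul_right, hor hxy, hor hyx,
      inner_self_eq_norm_sq_to_K] at h2
  simpa [sub_eq_zero] using h2

/-- Orthogonal unit vectors have images of the same norm; since any two unit vectors are orthogonal
to a third one, all unit vectors do. -/
lemma exists_norm_eq (hd : ∀ x y : H, ∃ z, z ≠ 0 ∧ ⟪x, z⟫_ℂ = 0 ∧ ⟪y, z⟫_ℂ = 0) {F : H →+ H}
    (hF : ∀ x, F x ∈ ℓ x) (hF0 : ∀ x, F x = 0 → x = 0) {σ : ℂ →+* ℂ}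
    (hσ : ∀ (c : ℂ) x, F (c • x) = σ c • F x) :
    (∀ t, σ (conj t) = conj (σ t)) ∧ ∃ r : ℝ, 0 < r ∧ ∀ x, ‖x‖ = 1 → ‖F x‖ = r := by
  have hnorm : ∀ {x y : H}, ‖x‖ = 1 → ‖y‖ = 1 → ⟪x, y⟫_ℂ = 0 → ‖F x‖ = ‖F y‖ := by
    intro x y hx hy hxy
    have h1 := h.map_conj_mul hF hσ hx hy hxy 1
    rw [map_one, map_one, map_one, one_mul, one_mul] at h1
    have h2 : ‖F x‖ ^ 2 = ‖F y‖ ^ 2 := by exact_mod_cast h1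
    exact (sq_eq_sq₀ (norm_nonneg _) (norm_nonneg _)).1 h2
  have hd' : ∀ x y : H, ∃ z : H, ‖z‖ = 1 ∧ ⟪x, z⟫_ℂ = 0 ∧ ⟪y, z⟫_ℂ = 0 := by
    intro x y
    obtain ⟨z, hz, h1, h2⟩ := hd x y
    refine ⟨((‖z‖⁻¹ : ℝ) : ℂ) • z, ?_, ?_, ?_⟩
    · rw [norm_smul, Complex.norm_real, norm_inv, norm_norm,
        inv_mul_cancel₀ (norm_ne_zero_iff.2 hz)]
    · rw [inner_smul_right, h1, mul_zero]
    · rw [inner_smul_right, h2, mul_zero]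
  obtain ⟨u, hu, -, -⟩ := hd' 0 0
  have hFu : F u ≠ 0 := fun h0 => by
    rw [hF0 u h0, norm_zero] at hu
    exact zero_ne_one hu
  refine ⟨fun t => ?_, ‖F u‖, norm_pos_iff.2 hFu, fun x hx => ?_⟩
  · obtain ⟨v, hv, huv, -⟩ := hd' u u
    have h1 := h.map_conj_mul hF hσ hu hv huv t
    rw [← hnorm hu hv huv] at h1
    exact mul_right_cancel₀ (pow_ne_zero 2 (by exact_mod_cast norm_ne_zero_iff.2 hFu)) h1
  · obtain ⟨z, hz, h1, h2⟩ := hd' x u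
    rw [hnorm hx hz h1, hnorm hu hz h2]

omit h in
/-- A ring endomorphism of `ℂ` commuting with conjugation is the identity or the conjugation. -/
lemma _root_.RingHom.eq_id_or_eq_conj {σ : ℂ →+* ℂ} (hσ : ∀ t, σ (conj t) = conj (σ t)) :
    σ = RingHom.id ℂ ∨ σ = starRingEnd ℂ := by
  have hre : ∀ r : ℝ, ((σ r).re : ℂ) = σ r := fun r => by
    have h1 := hσ r
    rw [Complex.conj_ofReal] at h1
    exact Complex.conj_eq_iff_re.1 h1.symm
  let ρ : ℝ →+* ℝ :=
    { toFun := fun r => (σ r).re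
      map_one' := by simp
      map_zero' := by simp
      map_add' := fun r s => by simp
      map_mul' := fun r s => by
        apply Complex.ofReal_injective
        rw [hre, Complex.ofReal_mul, map_mul, Complex.ofReal_mul, hre, hre] }
  have hρ : ∀ r : ℝ, σ r = r := fun r => by
    have h1 : ρ r = r := by rw [Subsingleton.elim ρ (RingHom.id ℝ), RingHom.id_apply]
    rw [← hre r]
    exact congrArg _ h1
  let A : ℂ →ₐ[ℝ] ℂ := { σ with commutes' := hρ }
  rcases Complex.real_algHom_eq_id_or_conj A with hA | hA
  · left
    ext t
    exact DFunLike.congr_fun hA t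
  · right
    ext t
    exact DFunLike.congr_fun hA t

/-- A semilinear map inducing the given map of lines is a multiple of an isometry. -/
lemma exists_isometryEquiv {σ τ : ℂ →+* ℂ} [RingHomInvPair σ τ] [RingHomInvPair τ σ] {F : H →+ H}
    (hF : ∀ x, F x ∈ ℓ x) (hF0 : ∀ x, F x = 0 → x = 0)
    (hσ : ∀ (c : ℂ) x, F (c • x) = σ c • F x) {r : ℝ} (hr : 0 < r)
    (hFr : ∀ x, ‖x‖ = 1 → ‖F x‖ = r) (hσr : ∀ r : ℝ, σ r = r) :
    ∃ U : H ≃ₛₗᵢ[σ] H, ∀ x, U x ∈ ℓ x := by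
  have hnorm : ∀ x, ‖F x‖ = r * ‖x‖ := by
    intro x
    by_cases hx : x = 0
    · rw [hx, map_zero, norm_zero, mul_zero]
    have hx' := norm_ne_zero_iff.2 hx
    have h1 := hFr (((‖x‖⁻¹ : ℝ) : ℂ) • x) (by
      rw [norm_smul, Complex.norm_real, norm_inv, norm_norm, inv_mul_cancel₀ hx'])
    rw [hσ, hσr, norm_smul, Complex.norm_real, norm_inv, norm_norm, inv_mul_eq_iff_eq_mul₀ hx']
      at h1
    rw [h1, mul_comm]
  have hr' : (r : ℂ) ≠ 0 := by exact_mod_cast hr.ne'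
  let U : H →ₛₗᵢ[σ] H :=
    { toFun := fun x => (r : ℂ)⁻¹ • F x
      map_add' := fun x y => by rw [map_add, smul_add]
      map_smul' := fun c x => by rw [hσ, smul_comm]
      norm_map' := fun x => by
        change ‖(r : ℂ)⁻¹ • F x‖ = ‖x‖
        rw [norm_smul, hnorm, norm_inv, Complex.norm_real, Real.norm_of_nonneg hr.le,
          inv_mul_cancel_left₀ hr.ne'] }
  have hU : ∀ x, U x = (r : ℂ)⁻¹ • F x := fun x => rfl
  refine ⟨LinearIsometryEquiv.ofSurjective U fun y => ?_, fun x => ?_⟩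
  · by_cases hy : y = 0
    · exact ⟨0, by rw [hy, map_zero]⟩
    obtain ⟨x, hx⟩ := h.surj y hy
    have hx0 : x ≠ 0 := by
      rintro rfl
      rw [h.zero] at hx
      exact hy ((span_singleton_eq_bot (R := ℂ)).1 hx.symm)
    have hyx : y ∈ ℂ ∙ F x := by
      rw [← h.eq_span (hF x) (fun h0 => hx0 (hF0 x h0)), hx]
      exact mem_span_singleton_self y
    obtain ⟨c, rfl⟩ := mem_span_singleton.1 hyx
    refine ⟨τ (r * c) • x, ?_⟩
    rw [hU, hσ, RingHomInvPair.comp_apply_eq₂, smul_smul, inv_mul_cancel_left₀ hr']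
  · exact smul_mem _ _ (hF x)

/-- **Uhlhorn's theorem**: in dimension at least three, a bijection of lines preserving
orthogonality is induced by a unitary or an anti-unitary operator. -/
theorem exists_unitary_or_antiunitary
    (hd : ∀ x y : H, ∃ z, z ≠ 0 ∧ ⟪x, z⟫_ℂ = 0 ∧ ⟪y, z⟫_ℂ = 0) :
    (∃ U : H ≃ₗᵢ[ℂ] H, ∀ x, U x ∈ ℓ x) ∨ ∃ U : H ≃ₗᵢ⋆[ℂ] H, ∀ x, U x ∈ ℓ x := by
  have hd' : ∀ x y : H, ∃ z, z ∉ span ℂ {x, y} := fun x y => by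
    obtain ⟨z, hz, h1, h2⟩ := hd x y
    refine ⟨z, notMem_of_mem_orthogonal ?_ hz⟩
    rw [← Set.singleton_union, span_union, ← inf_orthogonal]
    exact ⟨mem_orthogonal_singleton_iff_inner_right.2 h1,
      mem_orthogonal_singleton_iff_inner_right.2 h2⟩
  obtain ⟨F, hF, hF0⟩ := h.exists_addMonoidHom hd'
  obtain ⟨σ, hσ⟩ := h.exists_ringHom hd' hF hF0
  obtain ⟨hconj, r, hr, hFr⟩ := h.exists_norm_eq hd hF hF0 hσ
  rcases RingHom.eq_id_or_eq_conj hconj with rfl | rfl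
  · exact Or.inl (h.exists_isometryEquiv hF hF0 hσ hr hFr fun r => rfl)
  · exact Or.inr (h.exists_isometryEquiv hF hF0 hσ hr hFr Complex.conj_ofReal)

end IsOrthoMap

end SemilinearMaps

/-! ### From lines back to projections -/

section Conjugation

open scoped InnerProductSpace

variable {H : Type*} [NormedAddCommGroup H] [InnerProductSpace ℂ H]
  {σ τ : ℂ →+* ℂ} [RingHomInvPair σ τ] [RingHomInvPair τ σ]

lemma conjOperator_apply (U : H ≃ₛₗᵢ[σ] H) (A : H →L[ℂ] H) (x : H) :
    conjOperator U A x = U (A (U.symm x)) := rfl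

lemma conjOperator_id_sub (U : H ≃ₛₗᵢ[σ] H) (A : H →L[ℂ] H) :
    conjOperator U (ContinuousLinearMap.id ℂ H - A) =
      ContinuousLinearMap.id ℂ H - conjOperator U A := by
  ext x
  simp [conjOperator_apply]

lemma finrank_map_semilinear (U : H ≃ₛₗᵢ[σ] H) (V : Submodule ℂ H) :
    finrank ℂ (V.map U.toLinearEquiv.toLinearMap) = finrank ℂ V := by
  have hσ : Function.Bijective σ := Function.bijective_iff_has_inverse.2
    ⟨τ, fun _ => RingHomInvPair.comp_apply_eq, fun _ => RingHomInvPair.comp_apply_eq₂⟩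
  refine (congrArg Cardinal.toNat (rank_eq_of_equiv_equiv σ
    (U.toLinearEquiv.submoduleMap V).toAddEquiv hσ fun c x => ?_)).symm
  exact (U.toLinearEquiv.submoduleMap V).map_smulₛₗ c x

/-- If `U` preserves orthogonality and maps `P` into `Z`, then it conjugates the projection onto `P`
to the projection onto `Z`. -/
lemma starProjection_eq_conjOperator {k : ℕ} (U : H ≃ₛₗᵢ[σ] H)
    (hU : ∀ x y, ⟪x, y⟫_ℂ = 0 → ⟪U x, U y⟫_ℂ = 0) {P Z : Gr H k} (hPZ : ∀ x ∈ P.1, U x ∈ Z.1) :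
    Z.1.starProjection = conjOperator U P.1.starProjection := by
  have hZ : P.1.map U.toLinearEquiv.toLinearMap = Z.1 := by
    refine Submodule.eq_of_le_of_finrank_eq (Submodule.map_le_iff_le_comap.2 hPZ) ?_
    rw [finrank_map_semilinear, P.2.2, Z.2.2]
  ext x
  rw [conjOperator_apply]
  refine eq_starProjection_of_mem_orthogonal (hPZ _ (starProjection_apply_mem _ _)) ?_
  have h1 := sub_starProjection_mem_orthogonal (K := P.1) (U.symm x)
  rw [← hZ, mem_orthogonal]
  rintro _ ⟨y, hy, rfl⟩
  have h2 := hU _ _ ((mem_orthogonal _ _).1 h1 y hy)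
  rwa [map_sub, U.apply_symm_apply] at h2

end Conjugation

section Assembly

open Gr
open scoped InnerProductSpace

variable {H : Type*} [NormedAddCommGroup H] [InnerProductSpace ℂ H] {k : ℕ}

/-- The line spanned by a nonzero vector. -/
def line (x : H) (hx : x ≠ 0) : Gr H 1 := ⟨ℂ ∙ x, inferInstance, finrank_span_singleton hx⟩

lemma exists_eq_line (v : Gr H 1) : ∃ x, ∃ hx : x ≠ 0, v = line x hx := by
  obtain ⟨x, -, hx0, hx⟩ := exists_eq_span_singleton v.2.2
  exact ⟨x, hx0, Subtype.ext hx⟩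

lemma line_le_orthogonal_iff {x y : H} (hx : x ≠ 0) (hy : y ≠ 0) :
    (line x hx).1 ≤ (line y hy).1ᗮ ↔ ⟪x, y⟫_ℂ = 0 := by
  change ℂ ∙ x ≤ (ℂ ∙ y)ᗮ ↔ _
  rw [span_singleton_le_iff_mem, mem_orthogonal_singleton_iff_inner_left]

/-- Uhlhorn's theorem for bijections of the set of lines. -/
lemma exists_unitary_of_line_equiv (hH : ((2 : ℕ) : Cardinal) < Module.rank ℂ H)
    (h : Gr H 1 ≃ Gr H 1) (hh : ∀ v w : Gr H 1, v.1 ≤ w.1ᗮ ↔ (h v).1 ≤ (h w).1ᗮ) :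
    (∃ U : H ≃ₗᵢ[ℂ] H, ∀ x hx, U x ∈ (h (line x hx)).1) ∨
      ∃ U : H ≃ₗᵢ⋆[ℂ] H, ∀ x hx, U x ∈ (h (line x hx)).1 := by
  classical
  let ℓ : H → Submodule ℂ H := fun x => if hx : x = 0 then ⊥ else (h (line x hx)).1
  have hℓ : ∀ x hx, ℓ x = (h (line x hx)).1 := fun x hx => dif_neg hx
  have hℓ0 : ℓ 0 = ⊥ := dif_pos rfl
  have hom : IsOrthoMap ℓ := by
    refine ⟨hℓ0, fun x hx => ?_, fun x y => ?_, fun y hy => ?_⟩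
    · rw [hℓ x hx, (h _).2.2]
    · by_cases hx : x = 0
      · rw [hx, hℓ0, inner_zero_left]
        simp
      by_cases hy : y = 0
      · rw [hy, hℓ0, inner_zero_right, bot_orthogonal_eq_top]
        simp
      rw [hℓ x hx, hℓ y hy, ← hh, line_le_orthogonal_iff]
    · obtain ⟨x, hx, hxy⟩ := exists_eq_line (h.symm (line y hy))
      refine ⟨x, ?_⟩
      rw [hℓ x hx, ← hxy, h.apply_symm_apply]
      rfl
  have hd : ∀ x y : H, ∃ z, z ≠ 0 ∧ ⟪x, z⟫_ℂ = 0 ∧ ⟪y, z⟫_ℂ = 0 := by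
    intro x y
    have h1 : ∀ u : H, finrank ℂ (ℂ ∙ u) ≤ 1 := fun u => by
      simpa using finrank_span_le_card (R := ℂ) ({u} : Set H)
    have h2 : finrank ℂ (ℂ ∙ x ⊔ ℂ ∙ y : Submodule ℂ H) ≤ 2 :=
      (Submodule.finrank_add_le_finrank_add_finrank _ _).trans
        (add_le_add (h1 x) (h1 y))
    obtain ⟨z, hz, hz0⟩ := exists_ne_zero_mem_orthogonal (ℂ ∙ x ⊔ ℂ ∙ y)
      (lt_of_le_of_lt (by exact_mod_cast h2) hH)
    rw [← inf_orthogonal] at hz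
    exact ⟨z, hz0, mem_orthogonal_singleton_iff_inner_right.1 hz.1,
      mem_orthogonal_singleton_iff_inner_right.1 hz.2⟩
  rcases hom.exists_unitary_or_antiunitary hd with ⟨U, hU⟩ | ⟨U, hU⟩
  · exact Or.inl ⟨U, fun x hx => hℓ x hx ▸ hU x⟩
  · exact Or.inr ⟨U, fun x hx => hℓ x hx ▸ hU x⟩

/-- The conclusion for a fixed operator `U`: each `e P` is the image of `P` under `U` or, in
dimension `2 * k` only, the orthogonal complement of that image. -/
def ImplementsUpToCompl {σ τ : ℂ →+* ℂ} [RingHomInvPair σ τ] [RingHomInvPair τ σ]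
    (U : H ≃ₛₗᵢ[σ] H) (e : Gr H k → Gr H k) : Prop :=
  ∀ P, (e P).1.starProjection = conjOperator U P.1.starProjection ∨
    Module.rank ℂ H = ((2 * k : ℕ) : Cardinal) ∧ (e P).1.starProjection =
      ContinuousLinearMap.id ℂ H - conjOperator U P.1.starProjection

lemma implementsUpToCompl_of_line_equiv {σ τ : ℂ →+* ℂ} [RingHomInvPair σ τ] [RingHomInvPair τ σ]
    {U : H ≃ₛₗᵢ[σ] H} {h : Gr H 1 ≃ Gr H 1}
    (hh : ∀ v w : Gr H 1, v.1 ≤ w.1ᗮ ↔ (h v).1 ≤ (h w).1ᗮ)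
    (hU : ∀ x hx, U x ∈ (h (line x hx)).1) {e : Gr H k → Gr H k}
    (he : ∀ P, ∃ Z : Gr H k, (Z = e P ∨ Z.1 = (e P).1ᗮ) ∧ ∀ v : Gr H 1, v.1 ≤ P.1 →
        (h v).1 ≤ Z.1) : ImplementsUpToCompl U e := by
  have hor : ∀ x y, ⟪x, y⟫_ℂ = 0 → ⟪U x, U y⟫_ℂ = 0 := by
    intro x y hxy
    by_cases hx : x = 0
    · rw [hx, map_zero, inner_zero_left]
    by_cases hy : y = 0
    · rw [hy, map_zero, inner_zero_right]
    rw [← line_le_orthogonal_iff hx hy, hh] at hxy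
    exact (mem_orthogonal' _ _).1 (hxy (hU x hx)) _ (hU y hy)
  intro P
  obtain ⟨Z, hZ, hPZ⟩ := he P
  have h1 := starProjection_eq_conjOperator U hor (P := P) (Z := Z) fun x hx => by
    by_cases hx0 : x = 0
    · rw [hx0, map_zero]
      exact zero_mem _
    · exact hPZ (line x hx0) ((span_singleton_le_iff_mem _ _).2 hx) (hU x hx0)
  rcases hZ with rfl | hZ
  · exact Or.inl h1
  · refine Or.inr ⟨rank_eq_of_orthogonal hZ, ?_⟩
    rw [← h1, ← starProjection_orthogonal]
    congr 1
    exact eq_orthogonal_symm hZ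

/-- Distinct lines commute exactly if they are orthogonal. -/
lemma line_orthogonal_iff_comm {v w : Gr H 1} : v.1 ≤ w.1ᗮ ↔ v ≠ w ∧ Comm v w := by
  constructor
  · refine fun h => ⟨?_, compatible_of_le_orthogonal (le_orthogonal_iff_le_orthogonal.1 h)⟩
    rintro rfl
    exact not_line_le_le_orthogonal v le_rfl h
  · rintro ⟨hne, h⟩
    obtain ⟨x, hx0, hx⟩ := exists_eq_line v
    have h1 : Compatible w.1 (ℂ ∙ x) := by
      have := h.symm
      rwa [hx] at this
    have hvx : v.1 = ℂ ∙ x := congrArg Subtype.val hx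
    rcases compatible_span_singleton.1 h1 with h2 | h2
    · exact absurd (Gr.eq_of_le (hvx ▸ (span_singleton_le_iff_mem _ _).2 h2)) hne
    · exact hvx ▸ (span_singleton_le_iff_mem _ _).2 h2

/-- The theorem in terms of the Grassmannian, in dimension at least `2 * k`. For `k = 1` the given
bijection is itself a bijection of lines preserving orthogonality. -/
theorem exists_implementsUpToCompl_of_two_mul_le [CompleteSpace H] (hk0 : 0 < k)
    (hk : ((2 * k : ℕ) : Cardinal) ≤ Module.rank ℂ H)
    (hk4 : Module.rank ℂ H = ((2 * k : ℕ) : Cardinal) → 4 ≤ k)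
    (e : (Comm : Gr H k → Gr H k → Prop) ≃r (Comm : Gr H k → Gr H k → Prop)) :
    (∃ U : H ≃ₗᵢ[ℂ] H, ImplementsUpToCompl U e) ∨ ∃ U : H ≃ₗᵢ⋆[ℂ] H, ImplementsUpToCompl U e := by
  have hlines : ∃ h : Gr H 1 ≃ Gr H 1, (∀ v w : Gr H 1, v.1 ≤ w.1ᗮ ↔ (h v).1 ≤ (h w).1ᗮ) ∧
      ∀ P, ∃ Z : Gr H k, (Z = e P ∨ Z.1 = (e P).1ᗮ) ∧ ∀ v : Gr H 1, v.1 ≤ P.1 →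
        (h v).1 ≤ Z.1 := by
    obtain ⟨m, rfl⟩ := Nat.exists_eq_succ_of_ne_zero hk0.ne'
    rcases Nat.eq_zero_or_pos m with rfl | hm
    · refine ⟨e.toEquiv, fun v w => ?_, fun P => ⟨e P, Or.inl rfl, fun v hv => ?_⟩⟩
      · rw [line_orthogonal_iff_comm, line_orthogonal_iff_comm]
        exact and_congr e.injective.ne_iff.symm e.map_rel_iff.symm
      · rw [Gr.eq_of_le hv]
        exact le_rfl
    · exact exists_line_equiv_of_comm ⟨by omega, hk, hk4⟩ e
  have h2 : ((2 : ℕ) : Cardinal) < Module.rank ℂ H := by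
    refine lt_of_le_of_ne (le_trans (by exact_mod_cast (by omega)) hk) fun h2 => ?_
    rw [← h2] at hk hk4
    have hk1 : 2 * k ≤ 2 := by exact_mod_cast hk
    have := hk4 (by exact_mod_cast (by omega))
    omega
  obtain ⟨h, hh, he⟩ := hlines
  rcases exists_unitary_of_line_equiv h2 h hh with ⟨U, hU⟩ | ⟨U, hU⟩
  · exact Or.inl ⟨U, implementsUpToCompl_of_line_equiv hh hU he⟩
  · exact Or.inr ⟨U, implementsUpToCompl_of_line_equiv hh hU he⟩

/-- Orthogonal complementation between Grassmannians of a finite-dimensional space. -/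
noncomputable def complEquiv {j k : ℕ} [FiniteDimensional ℂ H] (hjk : j + k = finrank ℂ H) : Gr H j ≃ Gr H k where
  toFun P := ⟨P.1ᗮ, inferInstance, by
    have h1 := finrank_add_finrank_orthogonal P.1
    rw [P.2.2] at h1
    omega⟩
  invFun Q := ⟨Q.1ᗮ, inferInstance, by
    have h1 := finrank_add_finrank_orthogonal Q.1
    rw [Q.2.2] at h1
    omega⟩
  left_inv P := Subtype.ext (orthogonal_orthogonal P.1)
  right_inv Q := Subtype.ext (orthogonal_orthogonal Q.1)

lemma comm_complEquiv {j k : ℕ} [FiniteDimensional ℂ H] (hjk : j + k = finrank ℂ H)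
    {P Q : Gr H j} : Comm (complEquiv hjk P) (complEquiv hjk Q) ↔ Comm P Q := by
  have key : ∀ V W : Submodule ℂ H, Compatible Vᗮ Wᗮ ↔ Compatible V W := fun V W => by
    rw [compatible_orthogonal_left]
    exact ⟨fun h => by simpa using h.orthogonal, Compatible.orthogonal⟩
  exact key P.1 Q.1

/-- The theorem in terms of the Grassmannian. -/
theorem exists_implementsUpToCompl [CompleteSpace H] (hk0 : 0 < k)
    (hk : (k : Cardinal) < Module.rank ℂ H)
    (hk4 : Module.rank ℂ H = ((2 * k : ℕ) : Cardinal) → 4 ≤ k)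
    (e : (Comm : Gr H k → Gr H k → Prop) ≃r (Comm : Gr H k → Gr H k → Prop)) :
    (∃ U : H ≃ₗᵢ[ℂ] H, ImplementsUpToCompl U e) ∨ ∃ U : H ≃ₗᵢ⋆[ℂ] H, ImplementsUpToCompl U e := by
  rcases le_or_gt ((2 * k : ℕ) : Cardinal) (Module.rank ℂ H) with h2 | h2
  · exact exists_implementsUpToCompl_of_two_mul_le hk0 h2 hk4 e
  -- below dimension `2 * k`, pass to the orthogonal complements
  have hfin : FiniteDimensional ℂ H :=
    Module.rank_lt_aleph0_iff.1 (h2.trans (Cardinal.natCast_lt_aleph0))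
  have hk' := hk
  have h2' := h2
  rw [← finrank_eq_rank ℂ H] at hk' h2'
  have hk1 : k < finrank ℂ H := by exact_mod_cast hk'
  have h21 : finrank ℂ H < 2 * k := by exact_mod_cast h2'
  obtain ⟨j, hj⟩ : ∃ j, j + k = finrank ℂ H := ⟨finrank ℂ H - k, by omega⟩
  let c := complEquiv hj
  let e' : (Comm : Gr H j → Gr H j → Prop) ≃r (Comm : Gr H j → Gr H j → Prop) :=
    { toEquiv := (c.trans e.toEquiv).trans c.symm
      map_rel_iff' := fun {P Q} => by
        rw [← comm_complEquiv hj, ← comm_complEquiv hj (P := P)]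
        change Comm (c (c.symm (e (c P)))) (c (c.symm (e (c Q)))) ↔ Comm (c P) (c Q)
        rw [c.apply_symm_apply, c.apply_symm_apply, e.map_rel_iff] }
  have hrank : Module.rank ℂ H ≠ ((2 * j : ℕ) : Cardinal) := by
    rw [← finrank_eq_rank ℂ H]
    intro h
    have : finrank ℂ H = 2 * j := by exact_mod_cast h
    omega
  have key : ∀ {σ τ : ℂ →+* ℂ} [RingHomInvPair σ τ] [RingHomInvPair τ σ] {U : H ≃ₛₗᵢ[σ] H},
      ImplementsUpToCompl U e' → ImplementsUpToCompl U e := by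
    intro σ τ _ _ U hU P
    left
    obtain ⟨Q, rfl⟩ := c.surjective P
    have h1 := (hU Q).resolve_right fun h => hrank h.1
    have h3 : (c (e' Q)).1.starProjection = ContinuousLinearMap.id ℂ H -
        (e' Q).1.starProjection := starProjection_orthogonal (e' Q).1
    have h4 : (c Q).1.starProjection = ContinuousLinearMap.id ℂ H - Q.1.starProjection :=
      starProjection_orthogonal Q.1
    have h5 : (e (c Q)).1.starProjection = (c (e' Q)).1.starProjection := by
      congr 1
      exact congrArg Subtype.val (c.apply_symm_apply (e (c Q))).symm
    rw [h5, h3, h4, h1, conjOperator_id_sub]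
  rcases exists_implementsUpToCompl_of_two_mul_le (k := j) (by omega)
    (by rw [← finrank_eq_rank ℂ H]; exact_mod_cast (by omega)) (fun h => absurd h hrank) e' with
    ⟨U, hU⟩ | ⟨U, hU⟩
  · exact Or.inl ⟨U, key hU⟩
  · exact Or.inr ⟨U, key hU⟩

/-- Rank-`k` projections correspond to `k`-dimensional subspaces, through their ranges. -/
noncomputable def rankProjectionsEquiv [CompleteSpace H] : rankProjections H k ≃ Gr H k where
  toFun P := ⟨LinearMap.range (P.1 : H →ₗ[ℂ] H), Module.finite_of_rank_eq_nat P.2.2,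
    finrank_eq_of_rank_eq P.2.2⟩
  invFun V := ⟨V.1.starProjection, isStarProjection_starProjection, by
    rw [range_starProjection, ← finrank_eq_rank, V.2.2]⟩
  left_inv P := Subtype.ext (by
    obtain ⟨_, h⟩ := isStarProjection_iff_eq_starProjection_range.1 P.2.1
    exact h.symm)
  right_inv V := Subtype.ext (range_starProjection V.1)

lemma starProjection_rankProjectionsEquiv [CompleteSpace H] (P : rankProjections H k) :
    (rankProjectionsEquiv P).1.starProjection = P.1 :=
  congrArg Subtype.val (rankProjectionsEquiv.symm_apply_apply P)

lemma comm_rankProjectionsEquiv [CompleteSpace H] {P Q : rankProjections H k} :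
    Comm (rankProjectionsEquiv P) (rankProjectionsEquiv Q) ↔ Commute P.1 Q.1 := by
  rw [Comm, compatible_iff_commute, starProjection_rankProjectionsEquiv,
    starProjection_rankProjectionsEquiv]

end Assembly

end

theorem theorem2 {H : Type*} [NormedAddCommGroup H] [InnerProductSpace ℂ H] [CompleteSpace H]
    (k : ℕ) (hk0 : 0 < k) (hk : (k : Cardinal) < Module.rank ℂ H)
    (hk4 : Module.rank ℂ H = ((2 * k : ℕ) : Cardinal) → 4 ≤ k)
    (f : rankProjections H k → rankProjections H k) (hf : Function.Bijective f)
    (hcomm : ∀ P Q : rankProjections H k,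
      Commute (P : H →L[ℂ] H) (Q : H →L[ℂ] H) ↔
        Commute (f P : H →L[ℂ] H) (f Q : H →L[ℂ] H)) :
    ((∃ U : H ≃ₗᵢ[ℂ] H, ∀ P : rankProjections H k, (f P : H →L[ℂ] H) = conjOperator U P) ∨
      (∃ U : H ≃ₗᵢ⋆[ℂ] H, ∀ P : rankProjections H k, (f P : H →L[ℂ] H) = conjOperator U P)) ∨
    (Module.rank ℂ H = ((2 * k : ℕ) : Cardinal) ∧
      ((∃ U : H ≃ₗᵢ[ℂ] H, ∀ P : rankProjections H k,
          (f P : H →L[ℂ] H) = conjOperator U P ∨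
            (f P : H →L[ℂ] H) = ContinuousLinearMap.id ℂ H - conjOperator U P) ∨
        (∃ U : H ≃ₗᵢ⋆[ℂ] H, ∀ P : rankProjections H k,
          (f P : H →L[ℂ] H) = conjOperator U P ∨
            (f P : H →L[ℂ] H) = ContinuousLinearMap.id ℂ H - conjOperator U P))) := by
  let ρ : rankProjections H k ≃ Gr H k := rankProjectionsEquiv
  let e : (Gr.Comm : Gr H k → Gr H k → Prop) ≃r (Gr.Comm : Gr H k → Gr H k → Prop) :=
    { toEquiv := (ρ.symm.trans (Equiv.ofBijective f hf)).trans ρ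
      map_rel_iff' := fun {P Q} => by
        obtain ⟨P, rfl⟩ := ρ.surjective P
        obtain ⟨Q, rfl⟩ := ρ.surjective Q
        change Gr.Comm (ρ (f (ρ.symm (ρ P)))) (ρ (f (ρ.symm (ρ Q)))) ↔ Gr.Comm (ρ P) (ρ Q)
        rw [ρ.symm_apply_apply, ρ.symm_apply_apply, comm_rankProjectionsEquiv,
          comm_rankProjectionsEquiv]
        exact (hcomm P Q).symm }
  have he : ∀ P, (e (ρ P)).1.starProjection = (f P).1 := fun P => by
    change (ρ (f (ρ.symm (ρ P)))).1.starProjection = (f P).1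
    rw [ρ.symm_apply_apply]
    exact starProjection_rankProjectionsEquiv (f P)
  have key : ∀ {σ τ : ℂ →+* ℂ} [RingHomInvPair σ τ] [RingHomInvPair τ σ] {U : H ≃ₛₗᵢ[σ] H},
      ImplementsUpToCompl U e → ∀ P, (f P).1 = conjOperator U P.1 ∨
        Module.rank ℂ H = ((2 * k : ℕ) : Cardinal) ∧
          (f P).1 = ContinuousLinearMap.id ℂ H - conjOperator U P.1 := by
    intro σ τ _ _ U hU P
    have h1 := hU (ρ P)
    rwa [he P, show (ρ P).1.starProjection = P.1 from starProjection_rankProjectionsEquiv P] at h1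
  by_cases hr : Module.rank ℂ H = ((2 * k : ℕ) : Cardinal)
  · refine Or.inr ⟨hr, (exists_implementsUpToCompl hk0 hk hk4 e).imp ?_ ?_⟩ <;>
    · rintro ⟨U, hU⟩
      exact ⟨U, fun P => (key hU P).imp_right And.right⟩
  · refine Or.inl ((exists_implementsUpToCompl hk0 hk hk4 e).imp ?_ ?_) <;>
    · rintro ⟨U, hU⟩
      exact ⟨U, fun P => (key hU P).resolve_right fun h => hr h.1⟩
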